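/- **Setting.** Let $\mathcal H$ be a complex Hilbert space with an orthogonal decomposition $\mathcal H=\mathcal H_+\oplus\mathcal H_-$ into infinite-dimensional closed subspaces, and let $P_+$ be the orthogonal projector onto $\mathcal H_+$. Let $p$ be a real number with $1<p<\infty$, or $p=0$. Write $L^p(E,F)$ for the Schatten class of operators between Hilbert spaces $E$ and $F$ with its norm $\|\cdot\|_p$ if $1<p<\infty$, and for the space of compact operators with the operator norm if $p=0$. Identify closed subspaces $W\subset\mathcal H$ with the orthogonal projectors $P_W$ onto them. * The *$p$-restricted Grassmannian* $\mathrm{Gr}^p_{\rm res}$ is the set of closed subspaces $W$ such that the orthogonal projection $W\to\mathcal H_+$ is Fredholm and the orthogonal projection $W\to\mathcal H_-$ belongs to $L^p$. For $W\in\mathrm{Gr}^p_{\rm res}$ put $\phi_W(V)=P_{W^\perp}(P_W|_V)^{-1}$ for all $V\in\mathrm{Gr}^p_{\rm res}$ with $V\oplus W^\perp=\mathcal H$ (so $V$ is the graph of $\phi_W(V):W\to W^\perp$). * $\mathfrak U^p_{\rm res}$ is the set of partial isometries $u$ on $\mathcal H$ with $s(u):=u^*u\in\mathrm{Gr}^p_{\rm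 res}$ and $t(u):=uu^*\in\mathrm{Gr}^p_{\rm res}$. It is a groupoid over $\mathrm{Gr}^p_{\rm res}$ with source $s$, target $t$, multiplication $m(u,v)=uv$ (for $u^*u=vv^*$), identity section $\varepsilon(P)=P$ and inversion $\iota(u)=u^*$. * $U^p_{\rm res}=\{u\text{ unitary on }\mathcal H : [u,P_+]\in L^p\}$, with the smooth structure given by $u\mapsto(u,[u,P_+])\in L^\infty(\mathcal H)\times L^p(\mathcal H)$. A *smooth local cross section* is a smooth map $\sigma:\Omega\to U^p_{\rm res}$ on an open set $\Omega\subset\mathrm{Gr}^p_{\rm res}$ with $\sigma(V)\mathcal H_+=V$ for all $V\in\Omega$. * $\mathfrak u_+$ is the real Banach space of skew-adjoint bounded operators on $\mathcal H_+$, and $U_+$ is the unitary group of $\mathcal H_+$, with the charts $\psi_g(v)=(g^{-1}v-1)(g^{-1}v+1)^{-1}\in\mathfrak u_+$, $g\in U_+$, defined where $g^{-1}v+1$ is invertible. A *Banach Lie groupoid* is a groupoid whose total space and base are Hausdorff smooth Banach manifolds, whose source and target are surjective submersions (the tangent maps are surjective with split kernel), whose multiplication is smooth on the set of composable pairs, whose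 identity section is a topological embedding, and whose inversion is a diffeomorphism. **Proposition.** The sets $\mathrm{Gr}^p_{\rm res}$ and $\mathfrak U^p_{\rm res}$ carry structures of real smooth Banach manifolds such that: 1. for every $W\in\mathrm{Gr}^p_{\rm res}$, the space $L^p(W,W^\perp)$ is complete and $\phi_W$ is a smooth chart of $\mathrm{Gr}^p_{\rm res}$ with image all of $L^p(W,W^\perp)$; 2. every $W\in\mathrm{Gr}^p_{\rm res}$ lies in the domain of a smooth local cross section; 3. for all $W,W'\in\mathrm{Gr}^p_{\rm res}$, all smooth local cross sections $\sigma:\Omega\to U^p_{\rm res}$ and $\sigma':\Omega'\to U^p_{\rm res}$ with $\Omega$, $\Omega'$ contained in the domains of $\phi_W$, $\phi_{W'}$, and all $g\in U_+$, the map $$u\mapsto\bigl(\phi_W(uu^*),\ \phi_{W'}(u^*u),\ \psi_g(\sigma(uu^*)^{-1}\,u\,\sigma'(u^*u)|_{\mathcal H_+})\bigr)\in L^p(W,W^\perp)\times L^p(W',W'^\perp)\times\mathfrak u_+ ,$$ defined where $uu^*\in\Omega$, $u^*u\in\Omega'$ and the third component makes sense, is a smooth chart of $\mathfrak U^p_{\rm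 res}$; thus $\mathfrak U^p_{\rm res}$ is modelled on the Banach spaces $L^p(W,W^\perp)\times L^p(W',W'^\perp)\times\mathfrak u_+$; 4. with these structures $\mathfrak U^p_{\rm res}\rightrightarrows\mathrm{Gr}^p_{\rm res}$, with the maps $s,t,m,\varepsilon,\iota$ above, is a Banach Lie groupoid. -/

import Mathlib

open scoped Manifold ContDiff ENNReal

noncomputable section

/-! ### Schatten classes of operators between Hilbert spaces -/

section Schatten

variable {p : ℝ} {E F : Type*} [NormedAddCommGroup E] [InnerProductSpace ℂ E]
  [NormedAddCommGroup F] [InnerProductSpace ℂ F]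

/-- The norm of the operator ideal `L^p`, with values in `[0, ∞]`.  For `p = 0` (the ideal of compact
operators) it is the operator norm.  Otherwise it is the von Neumann-Schatten norm: the supremum of
`(∑ i, |⟨f i, T (e i)⟩| ^ p) ^ (1 / p)` over all finite orthonormal families `e` and `f` of the same
length.  (For `1 < p < ∞` this number is finite exactly when `T` is compact with `p`-summable
singular values, and it is then the `ℓ^p` norm of the sequence of singular values.) -/
def schattenENorm (p : ℝ) (T : E →L[ℂ] F) : ℝ≥0∞ :=
  if p = 0 then ‖T‖ₑ
  else ⨆ (n : ℕ) (e : {e : Fin n → E // Orthonormal ℂ e}) (f : {f : Fin n → F // Orthonormal ℂ f}),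
    (∑ i, ‖inner ℂ (f.1 i) (T (e.1 i))‖ₑ ^ p) ^ (1 / p)

/-- `T ∈ L^p`: for `p = 0` the operator is compact, otherwise its `p`-Schatten norm is finite. -/
def IsSchatten (p : ℝ) (T : E →L[ℂ] F) : Prop :=
  if p = 0 then IsCompactOperator T else schattenENorm p T ≠ ⊤

lemma schattenENorm_of_eq (hp : p = 0) (T : E →L[ℂ] F) : schattenENorm p T = ‖T‖ₑ := if_pos hp

lemma schattenENorm_add_le [hp : Fact (p = 0 ∨ 1 < p)] (S T : E →L[ℂ] F) :
    schattenENorm p (S + T) ≤ schattenENorm p S + schattenENorm p T := by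
  rcases hp.out with h | h
  · simp only [schattenENorm_of_eq h]
    exact enorm_add_le S T
  · have h0 : p ≠ 0 := by linarith
    simp only [schattenENorm, if_neg h0]
    refine iSup_le fun n => iSup_le fun e => iSup_le fun f => ?_
    refine le_trans ?_ (add_le_add (le_iSup_of_le n (le_iSup_of_le e (le_iSup_of_le f le_rfl)))
      (le_iSup_of_le n (le_iSup_of_le e (le_iSup_of_le f le_rfl))))
    refine le_trans ?_ (ENNReal.Lp_add_le Finset.univ _ _ h.le)
    refine ENNReal.rpow_le_rpow (Finset.sum_le_sum fun i _ => ?_) (by positivity)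
    refine ENNReal.rpow_le_rpow ?_ (by linarith)
    rw [add_apply, inner_add_right]
    exact enorm_add_le _ _

lemma schattenENorm_smul [hp : Fact (p = 0 ∨ 1 < p)] (c : ℂ) (T : E →L[ℂ] F) :
    schattenENorm p (c • T) = ‖c‖ₑ * schattenENorm p T := by
  rcases hp.out with h | h
  · simp only [schattenENorm_of_eq h]
    exact enorm_smul c T
  · have h0 : p ≠ 0 := by linarith
    have h1 : 0 ≤ p := by linarith
    simp only [schattenENorm, if_neg h0, ENNReal.mul_iSup]
    refine iSup_congr fun n => iSup_congr fun e => iSup_congr fun f => ?_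
    simp only [smul_apply, inner_smul_right, enorm_mul,
      ENNReal.mul_rpow_of_nonneg _ _ h1, ← Finset.mul_sum]
    rw [ENNReal.mul_rpow_of_nonneg _ _ (by positivity), ← ENNReal.rpow_mul,
      mul_one_div_cancel h0, ENNReal.rpow_one]

lemma eq_zero_of_schattenENorm [hp : Fact (p = 0 ∨ 1 < p)] {T : E →L[ℂ] F}
    (hT : schattenENorm p T = 0) : T = 0 := by
  rcases hp.out with h | h
  · rw [schattenENorm_of_eq h] at hT
    have h1 := congrArg ENNReal.toReal hT
    rw [toReal_enorm, ENNReal.toReal_zero] at h1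
    exact norm_eq_zero.1 h1
  · have h0 : p ≠ 0 := by linarith
    by_contra hne
    obtain ⟨x, hx⟩ : ∃ x, T x ≠ 0 := by
      by_contra! hall
      exact hne (ContinuousLinearMap.ext hall)
    have hx0 : x ≠ 0 := fun h => hx (by simp [h])
    have hxn : ‖x‖ ≠ 0 := norm_ne_zero_iff.2 hx0
    have hTn : ‖T x‖ ≠ 0 := norm_ne_zero_iff.2 hx
    let e : {e : Fin 1 → E // Orthonormal ℂ e} := ⟨fun _ => ((‖x‖⁻¹ : ℝ) : ℂ) • x, by
      refine ⟨fun i => ?_, fun i j hij => absurd (Subsingleton.elim i j) hij⟩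
      simp [norm_smul, hxn]⟩
    let f : {f : Fin 1 → F // Orthonormal ℂ f} := ⟨fun _ => ((‖T x‖⁻¹ : ℝ) : ℂ) • T x, by
      refine ⟨fun i => ?_, fun i j hij => absurd (Subsingleton.elim i j) hij⟩
      simp [norm_smul, hTn]⟩
    simp only [schattenENorm, if_neg h0, ENNReal.iSup_eq_zero] at hT
    have h1 := hT 1 e f
    rw [ENNReal.rpow_eq_zero_iff_of_pos (by positivity), Fin.sum_univ_one,
      ENNReal.rpow_eq_zero_iff_of_pos (by linarith)] at h1
    have h2 : inner ℂ (f.1 0) (T (e.1 0)) = 0 := by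
      have h3 := congrArg ENNReal.toReal h1
      rw [toReal_enorm, ENNReal.toReal_zero] at h3
      exact norm_eq_zero.1 h3
    simp [e, f, hx, hx0] at h2

lemma schattenENorm_ne_top [Fact (p = 0 ∨ 1 < p)] {T : E →L[ℂ] F} (hT : IsSchatten p T) :
    schattenENorm p T ≠ ⊤ := by
  by_cases h : p = 0
  · rw [schattenENorm_of_eq h]
    exact enorm_ne_top
  · simpa [IsSchatten, h] using hT

variable (p E F)

/-- `L^p(E, F)` as a subspace of the bounded operators. -/
def schattenSubmodule [hp : Fact (p = 0 ∨ 1 < p)] : Submodule ℂ (E →L[ℂ] F) where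
  carrier := {T | IsSchatten p T}
  add_mem' {S T} hS hT := by
    by_cases h : p = 0
    · simp only [IsSchatten, h, if_true, Set.mem_ofPred_eq] at hS hT ⊢
      exact hS.add hT
    · have h1 := schattenENorm_ne_top hS
      have h2 := schattenENorm_ne_top hT
      simp only [IsSchatten, h, if_false, Set.mem_ofPred_eq]
      exact ne_top_of_le_ne_top (ENNReal.add_ne_top.2 ⟨h1, h2⟩) (schattenENorm_add_le S T)
  zero_mem' := by
    by_cases h : p = 0
    · simp only [IsSchatten, h, if_true, Set.mem_ofPred_eq]
      exact isCompactOperator_zero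
    · simp only [IsSchatten, h, if_false, Set.mem_ofPred_eq]
      have := schattenENorm_smul (p := p) 0 (0 : E →L[ℂ] F)
      rw [zero_smul] at this
      rw [this]
      simp
  smul_mem' c T hT := by
    by_cases h : p = 0
    · simp only [IsSchatten, h, if_true, Set.mem_ofPred_eq] at hT ⊢
      exact hT.smul c
    · have h1 := schattenENorm_ne_top hT
      simp only [IsSchatten, h, if_false, Set.mem_ofPred_eq]
      rw [schattenENorm_smul]
      exact ENNReal.mul_ne_top enorm_ne_top h1

/-- The space `L^p(E, F)`, carrying its own norm (not the norm induced from the bounded operators,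
unless `p = 0`). -/
def SchattenClass [Fact (p = 0 ∨ 1 < p)] : Type _ := schattenSubmodule p E F

namespace SchattenClass

variable [Fact (p = 0 ∨ 1 < p)]

instance : AddCommGroup (SchattenClass p E F) := inferInstanceAs (AddCommGroup (schattenSubmodule p E F))

instance : Module ℂ (SchattenClass p E F) := inferInstanceAs (Module ℂ (schattenSubmodule p E F))

variable {p E F}

/-- The bounded operator underlying an element of `L^p(E, F)`. -/
def toCLM (T : SchattenClass p E F) : E →L[ℂ] F := T.1

instance : Norm (SchattenClass p E F) := ⟨fun T => (schattenENorm p T.toCLM).toReal⟩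

lemma norm_core : NormedSpace.Core ℂ (SchattenClass p E F) where
  norm_nonneg _ := ENNReal.toReal_nonneg
  norm_smul c T := by
    change (schattenENorm p (c • T.toCLM)).toReal = ‖c‖ * (schattenENorm p T.toCLM).toReal
    rw [schattenENorm_smul, ENNReal.toReal_mul, toReal_enorm]
  norm_triangle S T := by
    change (schattenENorm p (S.toCLM + T.toCLM)).toReal ≤
      (schattenENorm p S.toCLM).toReal + (schattenENorm p T.toCLM).toReal
    refine le_trans ?_
      (ENNReal.toReal_add (schattenENorm_ne_top S.2) (schattenENorm_ne_top T.2)).le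
    exact ENNReal.toReal_mono
      (ENNReal.add_ne_top.2 ⟨schattenENorm_ne_top S.2, schattenENorm_ne_top T.2⟩)
      (schattenENorm_add_le _ _)
  norm_eq_zero_iff T := by
    change (schattenENorm p T.toCLM).toReal = 0 ↔ T = 0
    constructor
    · intro h
      rcases (ENNReal.toReal_eq_zero_iff _).1 h with h | h
      · exact Subtype.ext (eq_zero_of_schattenENorm h)
      · exact absurd h (schattenENorm_ne_top T.2)
    · rintro rfl
      have := schattenENorm_smul (p := p) 0 (0 : E →L[ℂ] F)
      rw [zero_smul, enorm_zero, zero_mul] at this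
      change (schattenENorm p (0 : E →L[ℂ] F)).toReal = 0
      rw [this, ENNReal.toReal_zero]

instance : NormedAddCommGroup (SchattenClass p E F) := NormedAddCommGroup.ofCore norm_core

instance : NormedSpace ℂ (SchattenClass p E F) := NormedSpace.ofCore norm_core

end SchattenClass

end Schatten

/-! ### Banach Lie groupoids -/

section Groupoid

variable {EG EM : Type*} [NormedAddCommGroup EG] [NormedSpace ℝ EG]
  [NormedAddCommGroup EM] [NormedSpace ℝ EM]
  {G M : Type*} [TopologicalSpace G] [ChartedSpace EG G] [TopologicalSpace M] [ChartedSpace EM M]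

/-- A smooth map of Banach manifolds all of whose tangent maps are surjective with split kernel. -/
structure IsBanachSubmersion (f : G → M) : Prop where
  contMDiff : ContMDiff 𝓘(ℝ, EG) 𝓘(ℝ, EM) ∞ f
  surjective_mfderiv : ∀ x, Function.Surjective (mfderiv 𝓘(ℝ, EG) 𝓘(ℝ, EM) f x)
  split_ker : ∀ x, (mfderiv 𝓘(ℝ, EG) 𝓘(ℝ, EM) f x).ker.ClosedComplemented

variable (G M) in
open Classical in
/-- The maps `s`, `t`, `m`, `ε`, `ι` make the pair `(G, M)` a (Hausdorff, real, smooth) Banach Lie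
groupoid, where `m` is defined on the set of composable pairs.  Smoothness of `m` on this subset of
`G × G` is meant in the sense of `ContMDiffOn`, for which the values off the subset are irrelevant;
as the subset is a split submanifold (`s` and `t` are submersions), this is smoothness of `m` as a
map on that submanifold. -/
structure IsBanachLieGroupoid (s t : G → M) (m : {gh : G × G // s gh.1 = t gh.2} → G)
    (ε : M → G) (ι : G → G) : Prop where
  complete_total : CompleteSpace EG
  complete_base : CompleteSpace EM
  hausdorff_total : T2Space G
  hausdorff_base : T2Space M
  manifold_total : IsManifold 𝓘(ℝ, EG) ∞ G
  manifold_base : IsManifold 𝓘(ℝ, EM) ∞ M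
  source_surjective : Function.Surjective s
  source_submersion : IsBanachSubmersion (EG := EG) (EM := EM) s
  target_surjective : Function.Surjective t
  target_submersion : IsBanachSubmersion (EG := EG) (EM := EM) t
  smooth_mul : ContMDiffOn (𝓘(ℝ, EG).prod 𝓘(ℝ, EG)) 𝓘(ℝ, EG) ∞
    (fun gh : G × G => if h : s gh.1 = t gh.2 then m ⟨gh, h⟩ else gh.1)
    {gh : G × G | s gh.1 = t gh.2}
  source_mul : ∀ gh, s (m gh) = s gh.1.2
  target_mul : ∀ gh, t (m gh) = t gh.1.1
  assoc_defined : ∀ g h k : G,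
    (∃ h₁ : s g = t h, s (m ⟨(g, h), h₁⟩) = t k) ↔ (∃ h₂ : s h = t k, s g = t (m ⟨(h, k), h₂⟩))
  mul_assoc : ∀ (g h k : G) (h₁ : s g = t h) (h₂ : s h = t k) (h₃ : s (m ⟨(g, h), h₁⟩) = t k)
    (h₄ : s g = t (m ⟨(h, k), h₂⟩)),
    m ⟨(m ⟨(g, h), h₁⟩, k), h₃⟩ = m ⟨(g, m ⟨(h, k), h₂⟩), h₄⟩
  embedding_unit : Topology.IsEmbedding ε
  source_unit : ∀ x, s (ε x) = x
  target_unit : ∀ x, t (ε x) = x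
  mul_unit : ∀ (g : G) (h : s g = t (ε (s g))), m ⟨(g, ε (s g)), h⟩ = g
  unit_mul : ∀ (g : G) (h : s (ε (t g)) = t g), m ⟨(ε (t g), g), h⟩ = g
  diffeomorph_inv : ∃ d : Diffeomorph 𝓘(ℝ, EG) 𝓘(ℝ, EG) G G ∞, ⇑d = ι
  mul_inv : ∀ g, ∃ h : s g = t (ι g), m ⟨(g, ι g), h⟩ = ε (t g)
  inv_mul : ∀ g, ∃ h : s (ι g) = t g, m ⟨(ι g, g), h⟩ = ε (s g)

end Groupoid

/-! ### The restricted Grassmannian and the partial isometries over it -/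

section Restricted

variable {H : Type*} [NormedAddCommGroup H] [InnerProductSpace ℂ H] [CompleteSpace H]

/-- The orthogonal projector `P` belongs to the `p`-restricted Grassmannian of the polarization
`H = Hp ⊕ Hpᗮ`: for its image `W`, the orthogonal projection `W → Hp` is Fredholm, and the orthogonal
projection `W → Hpᗮ` is of class `L^p`. -/
structure IsRestrictedProjector (p : ℝ) (Hp : Submodule ℂ H) [CompleteSpace Hp]
    (P : H →L[ℂ] H) : Prop where
  isStarProjection : IsStarProjection P
  fredholm : (Hp.orthogonalProjectionOnto ∘L P.range.subtypeL).IsFredholm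
  schatten : IsSchatten p (Hpᗮ.orthogonalProjectionOnto ∘L P.range.subtypeL)

/-- The `p`-restricted Grassmannian; closed subspaces are identified with the orthogonal projectors
onto them. -/
@[ext]
structure RestrictedGrassmannian (p : ℝ) (Hp : Submodule ℂ H) [CompleteSpace Hp] where
  proj : H →L[ℂ] H
  isRestricted : IsRestrictedProjector p Hp proj

/-- A partial isometry of the Hilbert space `H`. -/
def IsPartialIsometry (u : H →L[ℂ] H) : Prop := IsStarProjection (star u * u)

/-- The set of partial isometries whose source `u* u` and target `u u*` belong to the
`p`-restricted Grassmannian. -/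
@[ext]
structure RestrictedPartialIsometry (p : ℝ) (Hp : Submodule ℂ H) [CompleteSpace Hp] where
  toCLM : H →L[ℂ] H
  isPartialIsometry : IsPartialIsometry toCLM
  source_mem : IsRestrictedProjector p Hp (star toCLM * toCLM)
  target_mem : IsRestrictedProjector p Hp (toCLM * star toCLM)

variable {p : ℝ} {Hp : Submodule ℂ H} [CompleteSpace Hp]

/-- The closed subspace corresponding to a point of the restricted Grassmannian. -/
def RestrictedGrassmannian.space (W : RestrictedGrassmannian p Hp) : Submodule ℂ H := W.proj.range

lemma RestrictedGrassmannian.proj_mem (W : RestrictedGrassmannian p Hp) (x : H) :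
    W.proj x ∈ W.space := ⟨x, rfl⟩

namespace RestrictedPartialIsometry

/-- `s u = u* u` -/
def source (u : RestrictedPartialIsometry p Hp) : RestrictedGrassmannian p Hp :=
  ⟨star u.toCLM * u.toCLM, u.source_mem⟩

/-- `t u = u u*` -/
def target (u : RestrictedPartialIsometry p Hp) : RestrictedGrassmannian p Hp :=
  ⟨u.toCLM * star u.toCLM, u.target_mem⟩

/-- `ε P = P` -/
def unit (P : RestrictedGrassmannian p Hp) : RestrictedPartialIsometry p Hp :=
  have h : star P.proj * P.proj = P.proj := by
    rw [P.isRestricted.isStarProjection.isSelfAdjoint.star_eq,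
      P.isRestricted.isStarProjection.isIdempotentElem.eq]
  have h' : P.proj * star P.proj = P.proj := by
    rw [P.isRestricted.isStarProjection.isSelfAdjoint.star_eq,
      P.isRestricted.isStarProjection.isIdempotentElem.eq]
  ⟨P.proj, by rw [IsPartialIsometry, h]; exact P.isRestricted.isStarProjection,
    h.symm ▸ P.isRestricted, h'.symm ▸ P.isRestricted⟩

/-- `ι u = u*` -/
def inv (u : RestrictedPartialIsometry p Hp) : RestrictedPartialIsometry p Hp :=
  ⟨star u.toCLM, by rw [IsPartialIsometry, star_star]; exact u.target_mem.isStarProjection,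
    by rw [star_star]; exact u.target_mem, by rw [star_star]; exact u.source_mem⟩

/-- `m (u, v) = u v`, defined when `u* u = v v*` -/
def mul (uv : {uv : RestrictedPartialIsometry p Hp × RestrictedPartialIsometry p Hp //
    source uv.1 = target uv.2}) : RestrictedPartialIsometry p Hp :=
  have h : star uv.1.1.toCLM * uv.1.1.toCLM = uv.1.2.toCLM * star uv.1.2.toCLM :=
    congrArg RestrictedGrassmannian.proj uv.2
  have hs : star (uv.1.1.toCLM * uv.1.2.toCLM) * (uv.1.1.toCLM * uv.1.2.toCLM) =
      star uv.1.2.toCLM * uv.1.2.toCLM := by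
    have := uv.1.2.source_mem.isStarProjection.isIdempotentElem.eq
    calc _ = star uv.1.2.toCLM * (star uv.1.1.toCLM * uv.1.1.toCLM) * uv.1.2.toCLM := by
          simp only [star_mul, mul_assoc]
      _ = star uv.1.2.toCLM * uv.1.2.toCLM * (star uv.1.2.toCLM * uv.1.2.toCLM) := by
          rw [h]; simp only [mul_assoc]
      _ = _ := this
  have ht : (uv.1.1.toCLM * uv.1.2.toCLM) * star (uv.1.1.toCLM * uv.1.2.toCLM) =
      uv.1.1.toCLM * star uv.1.1.toCLM := by
    have := uv.1.1.target_mem.isStarProjection.isIdempotentElem.eq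
    calc _ = uv.1.1.toCLM * (uv.1.2.toCLM * star uv.1.2.toCLM) * star uv.1.1.toCLM := by
          simp only [star_mul, mul_assoc]
      _ = uv.1.1.toCLM * star uv.1.1.toCLM * (uv.1.1.toCLM * star uv.1.1.toCLM) := by
          rw [← h]; simp only [mul_assoc]
      _ = _ := this
  ⟨uv.1.1.toCLM * uv.1.2.toCLM, by
    rw [IsPartialIsometry, hs]; exact uv.1.2.source_mem.isStarProjection,
    hs.symm ▸ uv.1.2.source_mem, ht.symm ▸ uv.1.1.target_mem⟩

end RestrictedPartialIsometry

/-! ### Charts -/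

/-- The Banach Lie algebra of skew-adjoint operators on `Hp` (over `ℝ`, with the operator norm). -/
def SkewAdjointOperators (Hp : Submodule ℂ H) [CompleteSpace Hp] : Type _ :=
  skewAdjoint (Hp →L[ℂ] Hp)

namespace SkewAdjointOperators

/-- The bounded operator underlying an element of the Lie algebra. -/
def toCLM (X : SkewAdjointOperators Hp) : Hp →L[ℂ] Hp := X.1

instance : NormedAddCommGroup (SkewAdjointOperators Hp) :=
  inferInstanceAs (NormedAddCommGroup (skewAdjoint (Hp →L[ℂ] Hp)))

instance : Module ℝ (SkewAdjointOperators Hp) :=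
  inferInstanceAs (Module ℝ (skewAdjoint (Hp →L[ℂ] Hp)))

instance : NormedSpace ℝ (SkewAdjointOperators Hp) where
  norm_smul_le r X := by
    refine ContinuousLinearMap.opNorm_le_bound _ (by positivity) fun x => ?_
    change ‖(r : ℂ) • X.toCLM x‖ ≤ _
    rw [norm_smul, Complex.norm_real, mul_assoc]
    exact mul_le_mul_of_nonneg_left (X.toCLM.le_opNorm x) (norm_nonneg r)

end SkewAdjointOperators

/-- The domain of the chart around `W`: the subspaces `V` with `V ⊕ Wᗮ = H`. -/
def grassmannianChartDomain (W : RestrictedGrassmannian p Hp) : Set (RestrictedGrassmannian p Hp) :=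
  {V | IsCompl V.space W.spaceᗮ}

/-- `A = φ_W(V) = P_{Wᗮ} (P_W |_V)⁻¹`, expressed as `A (P_W x) = P_{Wᗮ} x` for all `x ∈ V`; in other
words `V` is the graph of `A`. -/
def IsGrassmannianCoordinate [Fact (p = 0 ∨ 1 < p)] (W V : RestrictedGrassmannian p Hp)
    (A : SchattenClass p W.space W.spaceᗮ) : Prop :=
  ∀ x ∈ V.space, (A.toCLM ⟨W.proj x, W.proj_mem x⟩ : H) = x - W.proj x

/-- `σ` is a smooth local cross section, defined on the open set `Ω` of the restricted Grassmannian
and valued in the restricted unitary group `{u unitary | [u, P₊] ∈ L^p}`, with `V = σ(V) Hp`.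
Smoothness into this Banach Lie group, which is topologized by the norm of `u` together with the
`L^p` norm of `[u, P₊]`, is smoothness of `V ↦ σ V` and of `V ↦ [σ V, P₊]` into the respective
Banach spaces. -/
structure IsSmoothCrossSection [Fact (p = 0 ∨ 1 < p)] {E : Type*} [NormedAddCommGroup E]
    [NormedSpace ℝ E] [TopologicalSpace (RestrictedGrassmannian p Hp)]
    [ChartedSpace E (RestrictedGrassmannian p Hp)]
    (Ω : Set (RestrictedGrassmannian p Hp)) (σ : RestrictedGrassmannian p Hp → (H →L[ℂ] H)) :
    Prop where
  isOpen : IsOpen Ω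
  mem_unitary : ∀ V ∈ Ω, σ V ∈ unitary (H →L[ℂ] H)
  map_eq : ∀ V ∈ Ω, Hp.map (σ V : H →ₗ[ℂ] H) = V.space
  smooth : ContMDiffOn 𝓘(ℝ, E) 𝓘(ℝ, H →L[ℂ] H) ∞ σ Ω
  smooth_commutator : ∃ c : RestrictedGrassmannian p Hp → SchattenClass p H H,
    (∀ V ∈ Ω, (c V).toCLM = σ V * Hp.starProjection - Hp.starProjection * σ V) ∧
    ContMDiffOn 𝓘(ℝ, E) 𝓘(ℝ, SchattenClass p H H) ∞ c Ω

/-- The operator `σ(u u*)⁻¹ u σ'(u* u)` restricted to `Hp`. -/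
def transportToHp (σ σ' : RestrictedGrassmannian p Hp → (H →L[ℂ] H))
    (u : RestrictedPartialIsometry p Hp) : Hp →L[ℂ] Hp :=
  Hp.orthogonalProjectionOnto ∘L (star (σ u.target) * u.toCLM * σ' u.source) ∘L Hp.subtypeL

/-- The domain of the chart of the set of partial isometries built from two local cross sections and
from the Cayley chart of the unitary group of `Hp` centred at `g`, whose domain consists of the
unitary `v` with `g⁻¹ v + 1` invertible. -/
def groupoidChartDomain (Ω Ω' : Set (RestrictedGrassmannian p Hp))
    (σ σ' : RestrictedGrassmannian p Hp → (H →L[ℂ] H)) (g : unitary (Hp →L[ℂ] Hp)) :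
    Set (RestrictedPartialIsometry p Hp) :=
  {u | u.target ∈ Ω ∧ u.source ∈ Ω' ∧
    IsUnit (star (g : Hp →L[ℂ] Hp) * transportToHp σ σ' u + 1)}

/-- `Z` is the triple of coordinates of `u`: the coordinates of its target in the chart around `W`,
of its source in the chart around `W'`, and of the unitary operator
`v = σ(u u*)⁻¹ u σ'(u* u)|_{Hp}` in the Cayley chart `v ↦ (g⁻¹ v - 1) (g⁻¹ v + 1)⁻¹`. -/
def IsGroupoidCoordinate [Fact (p = 0 ∨ 1 < p)] (W W' : RestrictedGrassmannian p Hp)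
    (σ σ' : RestrictedGrassmannian p Hp → (H →L[ℂ] H)) (g : unitary (Hp →L[ℂ] Hp))
    (u : RestrictedPartialIsometry p Hp)
    (Z : SchattenClass p W.space W.spaceᗮ × SchattenClass p W'.space W'.spaceᗮ ×
      SkewAdjointOperators Hp) : Prop :=
  IsGrassmannianCoordinate W u.target Z.1 ∧
  IsGrassmannianCoordinate W' u.source Z.2.1 ∧
  Z.2.2.toCLM = (star (g : Hp →L[ℂ] Hp) * transportToHp σ σ' u - 1) *
    Ring.inverse (star (g : Hp →L[ℂ] Hp) * transportToHp σ σ' u + 1)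

/-- `φ` is a diffeomorphism from an open subset of the manifold `M` onto an open subset of the
normed space `E'`, that is, a smooth chart of `M` with values in `E'`. -/
def IsSmoothChart {E M E' : Type*} [NormedAddCommGroup E] [NormedSpace ℝ E] [TopologicalSpace M]
    [ChartedSpace E M] [NormedAddCommGroup E'] [NormedSpace ℝ E']
    (φ : OpenPartialHomeomorph M E') : Prop :=
  ContMDiffOn 𝓘(ℝ, E) 𝓘(ℝ, E') ∞ φ φ.source ∧ ContMDiffOn 𝓘(ℝ, E') 𝓘(ℝ, E) ∞ φ.symm φ.target

end Restricted

end

/-! Both sets are embedded into linear or already constructed smooth objects, and all smoothness is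
read off there. A projector `P_W` belongs to the restricted Grassmannian exactly when `P_W - P₊` is
of class `L^p` (`IsRestrictedProjector.isSchatten_sub`, `isRestrictedProjector_of_isSchatten_sub`),
so `diff` embeds the Grassmannian into the Banach space `L^p(H, H)`; `toProd` embeds a partial
isometry as the triple `(u, u u*, u* u)`. A chart is adapted to such an embedding if its inverse is
smooth into the ambient space and the chart itself is the restriction of a smooth map defined on an
open set there. Any two adapted charts are smoothly compatible, and a map into the embedded set is
smooth as soon as its composite with the embedding is. Hence no transition map is ever computed.

Graph charts: if `V` is a complement of `Wᗮ`, the oblique projection `T` onto `V` along `Wᗮ` equals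
`P_W + φ_W(V)`. With `X = P_W P_V + (1 - P_W)(1 - P_V)`, `V` is such a complement iff `X` is
invertible, and then `T = X⁻¹ P_W`. Conversely the orthogonal projector onto a graph is `T (T + T* -
1)⁻¹`. Both formulas are smooth, and the ideal property of `L^p` keeps the relevant differences in
`L^p`.

Cross sections: `X*` carries `W` to `V` and is close to `1` for `V` near `W`; its unitary polar
part, followed after a fixed unitary taking `Hp` to `W`, is a smooth local section
(`exists_isSmoothCrossSection`).

Groupoid: two sections trivialise it, `u` corresponding to `(u u*, u* u, σ(u u*)⁻¹ u σ'(u* u))` in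
`Ω × Ω' × U₊`, and the Cayley transform is a chart of `U₊` (`exists_groupoidChart`). In the ambient
description the structure maps are operator products, adjoints and coordinate projections; `s` and
`t` are submersions because they have smooth local sections through every point.

The analytic input is that `L^p`, defined through pairs of orthonormal families, is a complete
operator ideal, closed under adjoints, whose elements are norm limits of finite-rank operators. The
last fact makes inverses modulo `L^p` into Fredholm inverses. A cardinality argument for Hilbert
bases shows `W ≅ Hp` and `Wᗮ ≅ Hpᗮ` isometrically, so one model space serves all charts. -/

noncomputable section

/-! ### Operator ideal properties of the Schatten classes -/

section SchattenIdeal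

variable {p : ℝ} {D E F G : Type*} [NormedAddCommGroup D] [InnerProductSpace ℂ D]
  [NormedAddCommGroup E] [InnerProductSpace ℂ E]
  [NormedAddCommGroup F] [InnerProductSpace ℂ F] [NormedAddCommGroup G] [InnerProductSpace ℂ G]

/-- Singular value decomposition of an operator restricted to a finite-dimensional subspace. -/
lemma exists_singular_value_decomposition (T : E →L[ℂ] F) (X : Submodule ℂ E)
    [FiniteDimensional ℂ X] :
    ∃ (κ : Type) (_ : Fintype κ) (u : κ → E) (v : κ → F) (s : κ → ℝ), Orthonormal ℂ u ∧
      Orthonormal ℂ v ∧ (∀ k, 0 ≤ s k) ∧ (∀ k, T (u k) = (s k : ℂ) • v k) ∧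
      ∀ x ∈ X, T x = ∑ k, ((s k : ℂ) * inner ℂ (u k) x) • v k := by
  classical
  let T₁ : X →ₗ[ℂ] F := (T : E →ₗ[ℂ] F) ∘ₗ X.subtype
  let T₂ : X →ₗ[ℂ] T₁.range := T₁.rangeRestrict
  have hsym : (LinearMap.adjoint T₂ ∘ₗ T₂).IsSymmetric := T₂.isPositive_adjoint_comp_self.isSymmetric
  let b := hsym.eigenvectorBasis rfl
  have horth : ∀ k l, k ≠ l → inner ℂ (T (b k)) (T (b l)) = 0 := by
    intro k l hkl
    have h1 : inner ℂ (T₂ (b k)) (T₂ (b l)) = 0 := by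
      rw [← LinearMap.adjoint_inner_right]
      change inner ℂ (b k) ((LinearMap.adjoint T₂ ∘ₗ T₂) (b l)) = 0
      rw [hsym.apply_eigenvectorBasis, inner_smul_right, b.orthonormal.2 hkl, mul_zero]
    exact h1
  let κ := {k // T (b k) ≠ 0}
  have hpos : ∀ k : κ, ‖T (b k.1)‖ ≠ 0 := fun k => norm_ne_zero_iff.2 k.2
  refine ⟨κ, inferInstance, fun k => (b k.1 : E), fun k => ((‖T (b k.1)‖⁻¹ : ℝ) : ℂ) • T (b k.1),
    fun k => ‖T (b k.1)‖, ?_, ?_, fun k => norm_nonneg _, ?_, ?_⟩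
  · refine ⟨fun k => b.orthonormal.1 k.1, fun k l hkl => ?_⟩
    exact b.orthonormal.2 fun h => hkl (Subtype.ext h)
  · refine ⟨fun k => ?_, fun k l hkl => ?_⟩
    · simp [norm_smul, hpos k]
    · simp only [inner_smul_left, inner_smul_right]
      rw [horth _ _ fun h => hkl (Subtype.ext h)]
      simp
  · intro k
    rw [smul_smul, ← Complex.ofReal_mul, mul_inv_cancel₀ (hpos k), Complex.ofReal_one, one_smul]
  · intro x hx
    have h1 := congrArg (fun y : X => T (y : E)) (b.sum_repr' ⟨x, hx⟩)
    simp only [Submodule.coe_sum, map_sum, Submodule.coe_smul, map_smul] at h1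
    rw [← h1, ← Finset.sum_filter_of_ne (p := fun k => T (b k) ≠ 0)
      fun k _ hk h => hk (by rw [h, smul_zero]),
      Finset.sum_subtype (p := fun k => T (b k) ≠ 0) _ (fun k => by simp)]
    refine Finset.sum_congr rfl fun k _ => ?_
    rw [smul_smul, mul_right_comm, ← Complex.ofReal_mul, mul_inv_cancel₀ (hpos k),
      Complex.ofReal_one, one_mul]
    rfl

lemma sum_enorm_inner_le_schattenENorm (hp : 1 < p) (T : E →L[ℂ] F) {κ : Type*} [Fintype κ]
    {e : κ → E} {f : κ → F} (he : Orthonormal ℂ e) (hf : Orthonormal ℂ f) :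
    (∑ k, ‖inner ℂ (f k) (T (e k))‖ₑ ^ p) ^ (1 / p) ≤ schattenENorm p T := by
  have h0 : p ≠ 0 := by linarith
  simp only [schattenENorm, if_neg h0]
  let c := (Fintype.equivFin κ).symm
  refine le_trans (le_of_eq ?_) (le_iSup_of_le (Fintype.card κ)
    (le_iSup_of_le ⟨e ∘ c, he.comp _ c.injective⟩ (le_iSup_of_le ⟨f ∘ c, hf.comp _ c.injective⟩ le_rfl)))
  rw [← c.sum_comp]
  rfl

/-- The defining supremum of the Schatten norm also bounds the sums over Bessel families. -/
lemma sum_enorm_inner_le_of_bessel (hp : 1 < p) (T : E →L[ℂ] F) {ι : Type*} [Fintype ι]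
    {x : ι → E} {y : ι → F} (hx : ∀ z, ∑ i, ‖inner ℂ (x i) z‖ ^ 2 ≤ ‖z‖ ^ 2)
    (hy : ∀ z, ∑ i, ‖inner ℂ (y i) z‖ ^ 2 ≤ ‖z‖ ^ 2) :
    (∑ i, ‖inner ℂ (y i) (T (x i))‖ₑ ^ p) ^ (1 / p) ≤ schattenENorm p T := by
  have hp0 : 0 < p := by linarith
  -- Testing the Bessel inequality on `x i` itself gives `‖x i‖ ^ 4 ≤ ‖x i‖ ^ 2`.
  have hx1 : ∀ i, ‖x i‖ ^ 2 ≤ 1 := by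
    intro i
    have h1 : ‖inner ℂ (x i) (x i)‖ ^ 2 ≤ ‖x i‖ ^ 2 :=
      (Finset.single_le_sum (fun j _ => sq_nonneg ‖inner ℂ (x j) (x i)‖) (Finset.mem_univ i)).trans
        (hx (x i))
    rw [inner_self_eq_norm_sq_to_K] at h1
    simp only [Complex.coe_algebraMap, norm_pow, Complex.norm_real, norm_norm] at h1
    by_contra! h
    nlinarith
  have hy1 : ∀ i, ‖y i‖ ^ 2 ≤ 1 := by
    intro i
    have h1 : ‖inner ℂ (y i) (y i)‖ ^ 2 ≤ ‖y i‖ ^ 2 :=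
      (Finset.single_le_sum (fun j _ => sq_nonneg ‖inner ℂ (y j) (y i)‖) (Finset.mem_univ i)).trans
        (hy (y i))
    rw [inner_self_eq_norm_sq_to_K] at h1
    simp only [Complex.coe_algebraMap, norm_pow, Complex.norm_real, norm_norm] at h1
    by_contra! h
    nlinarith
  have : FiniteDimensional ℂ (Submodule.span ℂ (Set.range x)) :=
    FiniteDimensional.span_of_finite ℂ (Set.finite_range x)
  obtain ⟨κ, _, u, v, s, hu, hv, hs, huv, hT⟩ :=
    exists_singular_value_decomposition T (Submodule.span ℂ (Set.range x))
  refine le_trans ?_ (sum_enorm_inner_le_schattenENorm hp T hu hv)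
  refine ENNReal.rpow_le_rpow ?_ (by positivity)
  have hsv : ∀ k, ‖inner ℂ (v k) (T (u k))‖ = s k := by
    intro k
    rw [huv, inner_smul_right, inner_self_eq_norm_sq_to_K, hv.1 k]
    simp [abs_of_nonneg (hs k)]
  have hreal : ∑ i, ‖inner ℂ (y i) (T (x i))‖ ^ p ≤ ∑ k, s k ^ p := by
    -- The matrix `w` is doubly substochastic: its row sums are bounded because `u`, `v` are
    -- orthonormal, its column sums because `x`, `y` are Bessel families. By the inequality between
    -- geometric and arithmetic means, the expansion of `⟨y i, T (x i)⟩` along the singular vectors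
    -- is at most `∑ k, w i k * s k`.
    let w : ι → κ → ℝ := fun i k => (‖inner ℂ (u k) (x i)‖ ^ 2 + ‖inner ℂ (v k) (y i)‖ ^ 2) / 2
    have hw0 : ∀ i k, 0 ≤ w i k := fun i k => by positivity
    have hw1 : ∀ i, ∑ k, w i k ≤ 1 := by
      intro i
      have h1 := (hu.sum_inner_products_le (x i) (s := Finset.univ)).trans (hx1 i)
      have h2 := (hv.sum_inner_products_le (y i) (s := Finset.univ)).trans (hy1 i)
      simp only [w, ← Finset.sum_div, Finset.sum_add_distrib]
      linarith
    have hw2 : ∀ k, ∑ i, w i k ≤ 1 := by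
      intro k
      have h1 := hx (u k)
      have h2 := hy (v k)
      rw [hu.1 k] at h1
      rw [hv.1 k] at h2
      simp only [w, ← Finset.sum_div, Finset.sum_add_distrib]
      simp only [norm_inner_symm (u k), norm_inner_symm (v k)]
      linarith
    have hterm : ∀ i, ‖inner ℂ (y i) (T (x i))‖ ^ p ≤ ∑ k, w i k * s k ^ p := by
      intro i
      have h1 : ‖inner ℂ (y i) (T (x i))‖ ≤ ∑ k, w i k * s k := by
        rw [hT _ (Submodule.subset_span ⟨i, rfl⟩), inner_sum]
        refine (norm_sum_le _ _).trans (Finset.sum_le_sum fun k _ => ?_)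
        rw [inner_smul_right, norm_mul, norm_mul, Complex.norm_real, Real.norm_of_nonneg (hs k),
          norm_inner_symm (y i)]
        have := mul_nonneg (hs k) (sq_nonneg (‖inner ℂ (u k) (x i)‖ - ‖inner ℂ (v k) (y i)‖))
        simp only [w]
        nlinarith
      -- Weighted Hölder; since the total weight of a row is at most one, the factor `(∑ k, w i k) ^
      -- (1 - p⁻¹)` can be dropped.
      have h2 := Real.inner_le_weight_mul_Lp_of_nonneg Finset.univ hp.le (w i) s (hw0 i) hs
      have hS : 0 ≤ ∑ k, w i k * s k ^ p :=
        Finset.sum_nonneg fun k _ => mul_nonneg (hw0 i k) (Real.rpow_nonneg (hs k) p)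
      have h3 : ‖inner ℂ (y i) (T (x i))‖ ≤ (∑ k, w i k * s k ^ p) ^ p⁻¹ := by
        refine h1.trans (h2.trans ?_)
        refine mul_le_of_le_one_left (Real.rpow_nonneg hS _) ?_
        refine Real.rpow_le_one (Finset.sum_nonneg fun k _ => hw0 i k) (hw1 i) ?_
        rw [sub_nonneg]
        exact inv_le_one_of_one_le₀ hp.le
      calc _ ≤ ((∑ k, w i k * s k ^ p) ^ p⁻¹) ^ p :=
            Real.rpow_le_rpow (norm_nonneg _) h3 hp0.le
        _ = _ := Real.rpow_inv_rpow hS hp0.ne'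
    calc _ ≤ ∑ i, ∑ k, w i k * s k ^ p := Finset.sum_le_sum fun i _ => hterm i
      _ = ∑ k, (∑ i, w i k) * s k ^ p := by
        rw [Finset.sum_comm]
        simp only [Finset.sum_mul]
      _ ≤ _ := Finset.sum_le_sum fun k _ =>
        mul_le_of_le_one_left (Real.rpow_nonneg (hs k) p) (hw2 k)
  have hconv : ∀ z : ℂ, ‖z‖ₑ ^ p = ENNReal.ofReal (‖z‖ ^ p) := by
    intro z
    rw [← ofReal_norm, ENNReal.ofReal_rpow_of_nonneg (norm_nonneg _) hp0.le]
  simp only [hconv]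
  rw [← ENNReal.ofReal_sum_of_nonneg fun i _ => Real.rpow_nonneg (norm_nonneg _) p,
    ← ENNReal.ofReal_sum_of_nonneg fun i _ => Real.rpow_nonneg (norm_nonneg _) p]
  refine ENNReal.ofReal_le_ofReal (hreal.trans (le_of_eq ?_))
  simp only [hsv]

end SchattenIdeal

section SchattenIdeal

variable {p : ℝ} {D E F G : Type*} [NormedAddCommGroup D] [InnerProductSpace ℂ D]
  [NormedAddCommGroup E] [InnerProductSpace ℂ E]
  [NormedAddCommGroup F] [InnerProductSpace ℂ F] [NormedAddCommGroup G] [InnerProductSpace ℂ G]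

/-- A contraction does not preserve orthonormality, but it does preserve Bessel's inequality: move
`R` to the other side, where its adjoint is again a contraction. This is why the Schatten norm is
first compared with sums over Bessel families. -/
lemma bessel_comp_of_norm_le_one [CompleteSpace D] [CompleteSpace E] {R : D →L[ℂ] E}
    (hR : ‖R‖ ≤ 1) {ι : Type*} [Fintype ι] {e : ι → D} (he : Orthonormal ℂ e) (z : E) :
    ∑ i, ‖inner ℂ (R (e i)) z‖ ^ 2 ≤ ‖z‖ ^ 2 := by
  simp only [← ContinuousLinearMap.adjoint_inner_right R]
  refine (he.sum_inner_products_le _).trans ?_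
  have h : ‖ContinuousLinearMap.adjoint R z‖ ≤ ‖z‖ := by
    refine (ContinuousLinearMap.le_opNorm _ z).trans ?_
    rw [LinearIsometryEquiv.norm_map]
    exact mul_le_of_le_one_left (norm_nonneg z) hR
  gcongr

/-- For `p ≠ 0`, `⟨f, S T R e⟩ = ⟨S* f, T (R e)⟩`, and the families `R e` and `S* f` are Bessel. -/
lemma schattenENorm_comp_le_of_norm_le_one [hp : Fact (p = 0 ∨ 1 < p)] [CompleteSpace D]
    [CompleteSpace E] [CompleteSpace F] [CompleteSpace G] {S : F →L[ℂ] G} (T : E →L[ℂ] F)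
    {R : D →L[ℂ] E} (hS : ‖S‖ ≤ 1) (hR : ‖R‖ ≤ 1) :
    schattenENorm p (S ∘L T ∘L R) ≤ schattenENorm p T := by
  rcases hp.out with h | h
  · simp only [schattenENorm_of_eq h]
    rw [enorm_le_iff_norm_le]
    calc ‖S ∘L T ∘L R‖ ≤ ‖S‖ * (‖T‖ * ‖R‖) :=
          (S.opNorm_comp_le _).trans (by gcongr; exact T.opNorm_comp_le R)
      _ ≤ 1 * (‖T‖ * 1) := by gcongr
      _ = ‖T‖ := by ring
  · have h0 : p ≠ 0 := by linarith
    rw [schattenENorm, if_neg h0]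
    refine iSup_le fun n => iSup_le fun e => iSup_le fun f => ?_
    have hS' : ‖ContinuousLinearMap.adjoint S‖ ≤ 1 := by rwa [LinearIsometryEquiv.norm_map]
    refine le_trans (le_of_eq ?_) (sum_enorm_inner_le_of_bessel h T
      (bessel_comp_of_norm_le_one hR e.2) (bessel_comp_of_norm_le_one hS' f.2))
    simp only [ContinuousLinearMap.adjoint_inner_left]
    rfl

lemma exists_norm_le_one_eq_smul (A : E →L[ℂ] F) : ∃ A' : E →L[ℂ] F,
    ‖A'‖ ≤ 1 ∧ A = (‖A‖ : ℂ) • A' := by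
  refine ⟨((‖A‖⁻¹ : ℝ) : ℂ) • A, ?_, ?_⟩
  · rw [norm_smul, Complex.norm_real, norm_inv, norm_norm]
    exact inv_mul_le_one
  · rcases eq_or_ne A 0 with rfl | hA
    · simp
    · rw [smul_smul, ← Complex.ofReal_mul, mul_inv_cancel₀ (norm_ne_zero_iff.2 hA),
        Complex.ofReal_one, one_smul]

/-- `L^p` is an operator ideal. -/
lemma schattenENorm_comp_le [hp : Fact (p = 0 ∨ 1 < p)] [CompleteSpace D]
    [CompleteSpace E] [CompleteSpace F] [CompleteSpace G] (S : F →L[ℂ] G) (T : E →L[ℂ] F)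
    (R : D →L[ℂ] E) :
    schattenENorm p (S ∘L T ∘L R) ≤ ‖S‖ₑ * schattenENorm p T * ‖R‖ₑ := by
  obtain ⟨S', hS', hS⟩ := exists_norm_le_one_eq_smul S
  obtain ⟨R', hR', hR⟩ := exists_norm_le_one_eq_smul R
  have h1 : S ∘L T ∘L R = ((‖S‖ : ℂ) * (‖R‖ : ℂ)) • (S' ∘L T ∘L R') := by
    conv_lhs => rw [hS, hR]
    simp only [ContinuousLinearMap.smul_comp, ContinuousLinearMap.comp_smul, smul_smul]
    rw [mul_comm]
  have h2 : ∀ r : ℝ, 0 ≤ r → ‖(r : ℂ)‖ₑ = ENNReal.ofReal r := by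
    intro r hr
    rw [← ofReal_norm, Complex.norm_real, Real.norm_of_nonneg hr]
  rw [h1, schattenENorm_smul, enorm_mul, h2 _ (norm_nonneg S), h2 _ (norm_nonneg R), ofReal_norm,
    ofReal_norm, mul_right_comm]
  gcongr
  exact schattenENorm_comp_le_of_norm_le_one T hS' hR'

lemma IsSchatten.comp [hp : Fact (p = 0 ∨ 1 < p)] [CompleteSpace D]
    [CompleteSpace E] [CompleteSpace F] [CompleteSpace G] {T : E →L[ℂ] F} (hT : IsSchatten p T)
    (S : F →L[ℂ] G) (R : D →L[ℂ] E) : IsSchatten p (S ∘L T ∘L R) := by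
  by_cases h : p = 0
  · simp only [IsSchatten, h, if_true] at hT ⊢
    exact (hT.comp_clm R).clm_comp S
  · have h1 := schattenENorm_ne_top hT
    simp only [IsSchatten, h, if_false]
    exact ne_top_of_le_ne_top (ENNReal.mul_ne_top (ENNReal.mul_ne_top enorm_ne_top h1) enorm_ne_top)
      (schattenENorm_comp_le S T R)

lemma norm_inner_le_schattenENorm (hp : 1 < p) (T : E →L[ℂ] F) {e : E} {f : F} (he : ‖e‖ = 1)
    (hf : ‖f‖ = 1) : ‖inner ℂ f (T e)‖ₑ ≤ schattenENorm p T := by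
  have h1 : Orthonormal ℂ (fun _ : Fin 1 => e) :=
    ⟨fun _ => he, fun i j hij => absurd (Subsingleton.elim i j) hij⟩
  have h2 : Orthonormal ℂ (fun _ : Fin 1 => f) :=
    ⟨fun _ => hf, fun i j hij => absurd (Subsingleton.elim i j) hij⟩
  have h3 := sum_enorm_inner_le_schattenENorm hp T h1 h2
  rwa [Fin.sum_univ_one, ← ENNReal.rpow_mul, mul_one_div_cancel (by linarith),
    ENNReal.rpow_one] at h3

/-- The Schatten norm dominates the operator norm. -/
lemma enorm_le_schattenENorm [hp : Fact (p = 0 ∨ 1 < p)] (T : E →L[ℂ] F) :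
    ‖T‖ₑ ≤ schattenENorm p T := by
  rcases hp.out with h | h
  · rw [schattenENorm_of_eq h]
  · rcases eq_or_ne (schattenENorm p T) ⊤ with ht | ht
    · rw [ht]; exact le_top
    rw [← ofReal_norm]
    refine ENNReal.ofReal_le_of_le_toReal ?_
    refine T.opNorm_le_bound ENNReal.toReal_nonneg fun x => ?_
    rcases eq_or_ne (T x) 0 with hx | hx
    · rw [hx, norm_zero]
      exact mul_nonneg ENNReal.toReal_nonneg (norm_nonneg x)
    have hx0 : x ≠ 0 := fun h => hx (by simp [h])
    have hxn : ‖x‖ ≠ 0 := norm_ne_zero_iff.2 hx0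
    have hTn : ‖T x‖ ≠ 0 := norm_ne_zero_iff.2 hx
    have h1 := norm_inner_le_schattenENorm h T (e := ((‖x‖⁻¹ : ℝ) : ℂ) • x)
      (f := ((‖T x‖⁻¹ : ℝ) : ℂ) • T x) (by simp [norm_smul, hxn]) (by simp [norm_smul, hTn])
    have h2 := ENNReal.toReal_mono ht h1
    rw [toReal_enorm, map_smul, inner_smul_left, inner_smul_right,
      inner_self_eq_norm_sq_to_K] at h2
    simp only [Complex.conj_ofReal, Complex.coe_algebraMap, norm_mul, Complex.norm_real, norm_inv,
      norm_norm, norm_pow] at h2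
    have hxp : 0 < ‖x‖ := norm_pos_iff.2 hx0
    calc ‖T x‖ = (‖T x‖⁻¹ * (‖x‖⁻¹ * ‖T x‖ ^ 2)) * ‖x‖ := by field_simp
      _ ≤ _ := by gcongr

lemma schattenENorm_adjoint_le [hp : Fact (p = 0 ∨ 1 < p)] [CompleteSpace E] [CompleteSpace F]
    (T : E →L[ℂ] F) : schattenENorm p (ContinuousLinearMap.adjoint T) ≤ schattenENorm p T := by
  rcases hp.out with h | h
  · simp only [schattenENorm_of_eq h]
    rw [enorm_le_iff_norm_le, LinearIsometryEquiv.norm_map]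
  · have h0 : p ≠ 0 := by linarith
    rw [schattenENorm, if_neg h0]
    refine iSup_le fun n => iSup_le fun e => iSup_le fun f => ?_
    refine le_trans (le_of_eq ?_) (sum_enorm_inner_le_schattenENorm h T f.2 e.2)
    congr 1
    refine Finset.sum_congr rfl fun i _ => ?_
    rw [ContinuousLinearMap.adjoint_inner_right, ← ofReal_norm, norm_inner_symm, ofReal_norm]

lemma schattenENorm_adjoint [hp : Fact (p = 0 ∨ 1 < p)] [CompleteSpace E] [CompleteSpace F]
    (T : E →L[ℂ] F) : schattenENorm p (ContinuousLinearMap.adjoint T) = schattenENorm p T := by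
  refine le_antisymm (schattenENorm_adjoint_le T) ?_
  have h := schattenENorm_adjoint_le (p := p) (ContinuousLinearMap.adjoint T)
  rwa [ContinuousLinearMap.adjoint_adjoint] at h

/-- An orthonormal family in `E` has at most `dim E` members, and each matrix entry is bounded by
the operator norm. -/
lemma isSchatten_of_finiteDimensional [hp : Fact (p = 0 ∨ 1 < p)] [FiniteDimensional ℂ E]
    (T : E →L[ℂ] F) : IsSchatten p T := by
  by_cases h : p = 0
  · simp only [IsSchatten, h, if_true]
    have : ProperSpace E := FiniteDimensional.proper ℂ E
    exact isCompactOperator_of_locallyCompactSpace_rng T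
  · have h1 : 1 < p := hp.out.resolve_left h
    simp only [IsSchatten, schattenENorm, h, if_false]
    refine ne_top_of_le_ne_top (b := (Module.finrank ℂ E * ‖T‖ₑ ^ p) ^ (1 / p)) ?_ ?_
    · have h2 : ‖T‖ₑ ^ p ≠ ⊤ := ENNReal.rpow_ne_top_of_nonneg (by linarith) enorm_ne_top
      exact ENNReal.rpow_ne_top_of_nonneg (by positivity)
        (ENNReal.mul_ne_top (ENNReal.natCast_ne_top _) h2)
    · refine iSup_le fun n => iSup_le fun e => iSup_le fun f => ?_
      refine ENNReal.rpow_le_rpow ?_ (by positivity)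
      have h2 : ∀ i, ‖inner ℂ (f.1 i) (T (e.1 i))‖ₑ ^ p ≤ ‖T‖ₑ ^ p := by
        intro i
        refine ENNReal.rpow_le_rpow ?_ (by linarith)
        rw [enorm_le_iff_norm_le]
        refine (norm_inner_le_norm _ _).trans ?_
        rw [f.2.1 i, one_mul]
        exact (T.le_opNorm _).trans (by rw [e.2.1 i, mul_one])
      refine (Finset.sum_le_sum fun i _ => h2 i).trans ?_
      rw [Finset.sum_const, Finset.card_univ, nsmul_eq_mul]
      gcongr
      exact e.2.linearIndependent.fintype_card_le_finrank

lemma isSchatten_of_finiteDimensional_range [hp : Fact (p = 0 ∨ 1 < p)] [CompleteSpace E]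
    [CompleteSpace F] (T : E →L[ℂ] F) [FiniteDimensional ℂ T.range] : IsSchatten p T := by
  have : CompleteSpace T.range := FiniteDimensional.complete ℂ _
  have h1 := (isSchatten_of_finiteDimensional (p := p) T.range.subtypeL).comp
    (ContinuousLinearMap.id ℂ F) (T.codRestrict T.range fun x => ⟨x, rfl⟩)
  exact h1

/-- Operators of class `L^p` are approximable by operators of finite rank. -/
lemma IsSchatten.exists_finiteDimensional_range [hp : Fact (p = 0 ∨ 1 < p)] {T : E →L[ℂ] F}
    (hT : IsSchatten p T) {ε : ℝ} (hε : 0 < ε) :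
    ∃ K : E →L[ℂ] F, FiniteDimensional ℂ K.range ∧ ‖T - K‖ ≤ ε := by
  by_cases h : p = 0
  · simp only [IsSchatten, h, if_true] at hT
    obtain ⟨C, hC, hCT⟩ := hT.image_closedBall_subset_compact 1
    obtain ⟨t, -, ht, htC⟩ := hC.finite_cover_balls hε
    -- The balls of radius `ε` around `t` cover the image of the unit ball, and the orthogonal
    -- projection onto the span of `t` is at least as close to `T x` as any point of `t`.
    let N := Submodule.span ℂ t
    have : FiniteDimensional ℂ N := FiniteDimensional.span_of_finite ℂ ht
    refine ⟨N.starProjection ∘L T, ?_, ?_⟩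
    · refine Submodule.finiteDimensional_of_le (S₂ := N) ?_
      rintro _ ⟨x, rfl⟩
      exact N.starProjection_apply_mem (T x)
    · refine ContinuousLinearMap.opNorm_le_of_unit_norm hε.le fun x hx => ?_
      have h1 : T x ∈ C := hCT ⟨x, by simp [hx], rfl⟩
      obtain ⟨y, hy, hxy⟩ := Set.mem_iUnion₂.1 (htC h1)
      change ‖T x - N.starProjection (T x)‖ ≤ ε
      rw [Submodule.starProjection_minimal]
      refine (ciInf_le ⟨0, ?_⟩ (⟨y, Submodule.subset_span hy⟩ : N)).trans ?_
      · rintro _ ⟨z, rfl⟩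
        exact norm_nonneg _
      · rw [mem_ball_iff_norm] at hxy
        exact hxy.le
  · have h1 : 1 < p := hp.out.resolve_left h
    have hp0 : 0 < p := by linarith
    have ht := schattenENorm_ne_top hT
    -- `P n`: there are orthonormal families of length `n` all of whose diagonal entries have
    -- modulus at least `ε`. Finiteness of the Schatten norm bounds such `n`, and a family that
    -- cannot be lengthened is selected.
    let P : ℕ → Prop := fun n => ∃ (e : Fin n → E) (f : Fin n → F), Orthonormal ℂ e ∧
      Orthonormal ℂ f ∧ ∀ i, ε ≤ ‖inner ℂ (f i) (T (e i))‖
    have hP0 : P 0 := ⟨Fin.elim0, Fin.elim0, ⟨fun i => i.elim0, fun i => i.elim0⟩,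
      ⟨fun i => i.elim0, fun i => i.elim0⟩, fun i => i.elim0⟩
    have hPb : ∀ n, P n → n * ε ^ p ≤ (schattenENorm p T).toReal ^ p := by
      rintro n ⟨e, f, he, hf, hef⟩
      have h2 := sum_enorm_inner_le_schattenENorm h1 T he hf
      rw [one_div, ENNReal.rpow_inv_le_iff hp0] at h2
      have h3 := ENNReal.toReal_mono (ENNReal.rpow_ne_top_of_nonneg hp0.le ht) h2
      rw [ENNReal.toReal_sum fun i _ => ENNReal.rpow_ne_top_of_nonneg hp0.le enorm_ne_top,
        ← ENNReal.toReal_rpow] at h3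
      refine le_trans ?_ h3
      simp only [← ENNReal.toReal_rpow, toReal_enorm]
      calc (n : ℝ) * ε ^ p = ∑ i : Fin n, ε ^ p := by simp
        _ ≤ _ := Finset.sum_le_sum fun i _ => Real.rpow_le_rpow hε.le (hef i) hp0.le
    obtain ⟨n, hn, hn'⟩ : ∃ n, P n ∧ ¬ P (n + 1) := by
      by_contra! hall
      have hPn : ∀ n, P n := fun n => Nat.rec hP0 hall n
      obtain ⟨n, hn⟩ := exists_nat_gt ((schattenENorm p T).toReal ^ p / ε ^ p)
      rw [div_lt_iff₀ (Real.rpow_pos_of_pos hε p)] at hn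
      exact absurd (hPb n (hPn n)) (not_le.2 hn)
    obtain ⟨e, f, he, hf, hef⟩ := hn
    let M := Submodule.span ℂ (Set.range e)
    let N := Submodule.span ℂ (Set.range f)
    have : FiniteDimensional ℂ M := FiniteDimensional.span_of_finite ℂ (Set.finite_range e)
    have : FiniteDimensional ℂ N := FiniteDimensional.span_of_finite ℂ (Set.finite_range f)
    -- If the component `y` of `T x` orthogonal to `N` were too large, the normalised `x` and `y`
    -- would lengthen the two families, because `⟨y, T x⟩ = ‖y‖ ^ 2`.
    have hbound : ∀ x ∈ Mᗮ, ‖T x - N.starProjection (T x)‖ ≤ ε * ‖x‖ := by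
      intro x hx
      set y := T x - N.starProjection (T x) with hy
      have hyN : y ∈ Nᗮ := Submodule.sub_starProjection_mem_orthogonal (T x)
      have hyT : inner ℂ y (T x) = (‖y‖ : ℂ) ^ 2 := by
        have h2 : T x = y + N.starProjection (T x) := by rw [hy]; abel
        rw [h2, inner_add_right, inner_self_eq_norm_sq_to_K,
          Submodule.inner_left_of_mem_orthogonal (N.starProjection_apply_mem (T x)) hyN, add_zero]
        rfl
      rcases eq_or_ne y 0 with hy0 | hy0
      · rw [hy0, norm_zero]; positivity
      have hx0 : x ≠ 0 := by
        rintro rfl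
        exact hy0 (by simp [hy])
      have hxn : ‖x‖ ≠ 0 := norm_ne_zero_iff.2 hx0
      have hyn : ‖y‖ ≠ 0 := norm_ne_zero_iff.2 hy0
      by_contra! hlt
      refine hn' ⟨Matrix.vecCons (((‖x‖⁻¹ : ℝ) : ℂ) • x) e,
        Matrix.vecCons (((‖y‖⁻¹ : ℝ) : ℂ) • y) f, ?_, ?_, ?_⟩
      · refine orthonormal_vecCons_iff.2 ⟨by simp [norm_smul, hxn], fun i => ?_, he⟩
        rw [inner_smul_left, Submodule.inner_left_of_mem_orthogonal
          (Submodule.subset_span (Set.mem_range_self i)) hx, mul_zero]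
      · refine orthonormal_vecCons_iff.2 ⟨by simp [norm_smul, hyn], fun i => ?_, hf⟩
        rw [inner_smul_left, Submodule.inner_left_of_mem_orthogonal
          (Submodule.subset_span (Set.mem_range_self i)) hyN, mul_zero]
      · refine Fin.cases ?_ fun i => hef i
        simp only [Matrix.cons_val_zero, map_smul, inner_smul_left, inner_smul_right, hyT]
        simp only [Complex.conj_ofReal, norm_mul, Complex.norm_real, norm_inv,
          norm_norm, norm_pow]
        have hxp : 0 < ‖x‖ := norm_pos_iff.2 hx0
        have h2 : ‖x‖⁻¹ * (‖y‖⁻¹ * ‖y‖ ^ 2) = ‖y‖ / ‖x‖ := by field_simp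
        rw [h2, le_div_iff₀ hxp]
        exact hlt.le
    -- What remains of `T` after subtracting this operator is `(1 - P_N) T` on `Mᗮ`, which was just
    -- bounded.
    refine ⟨N.starProjection ∘L T ∘L Mᗮ.starProjection + T ∘L M.starProjection, ?_, ?_⟩
    · refine Submodule.finiteDimensional_of_le (S₂ := N ⊔ M.map (T : E →ₗ[ℂ] F)) ?_
      rintro _ ⟨x, rfl⟩
      exact Submodule.add_mem_sup (N.starProjection_apply_mem _)
        ⟨_, M.starProjection_apply_mem x, rfl⟩
    · refine ContinuousLinearMap.opNorm_le_bound _ hε.le fun x => ?_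
      have h2 : (T - (N.starProjection ∘L T ∘L Mᗮ.starProjection + T ∘L M.starProjection)) x =
          T (Mᗮ.starProjection x) - N.starProjection (T (Mᗮ.starProjection x)) := by
        have h3 : x = M.starProjection x + Mᗮ.starProjection x :=
          (M.starProjection_add_starProjection_orthogonal x).symm
        have h4 : T x = T (M.starProjection x) + T (Mᗮ.starProjection x) := by
          rw [← map_add, ← h3]
        change T x - (N.starProjection (T (Mᗮ.starProjection x)) + T (M.starProjection x)) = _
        rw [h4]
        abel
      rw [h2]
      refine (hbound _ (Mᗮ.starProjection_apply_mem x)).trans ?_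
      gcongr
      exact Submodule.norm_starProjection_apply_le _ x

/-- Factor `T` through its range: the adjoint then ends with an operator whose domain is that
finite-dimensional space. -/
lemma finiteDimensional_range_adjoint [CompleteSpace E] [CompleteSpace F] (T : E →L[ℂ] F)
    [FiniteDimensional ℂ T.range] : FiniteDimensional ℂ (ContinuousLinearMap.adjoint T).range := by
  have : CompleteSpace T.range := FiniteDimensional.complete ℂ _
  let r : E →L[ℂ] T.range := T.codRestrict T.range fun x => ⟨x, rfl⟩
  refine Submodule.finiteDimensional_of_le (S₂ := (ContinuousLinearMap.adjoint r).range) ?_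
  have h : ContinuousLinearMap.adjoint T =
      ContinuousLinearMap.adjoint r ∘L ContinuousLinearMap.adjoint T.range.subtypeL := by
    rw [← ContinuousLinearMap.adjoint_comp]
    rfl
  rw [h]
  rintro _ ⟨x, rfl⟩
  exact ⟨ContinuousLinearMap.adjoint T.range.subtypeL x, rfl⟩

/-- For `p = 0` this is Schauder's theorem: adjoints of finite-rank approximations approximate the
adjoint, and the compact operators are closed. For `p ≠ 0` exchanging the two orthonormal families
shows that the norms agree. -/
lemma IsSchatten.adjoint [hp : Fact (p = 0 ∨ 1 < p)] [CompleteSpace E] [CompleteSpace F]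
    {T : E →L[ℂ] F} (hT : IsSchatten p T) : IsSchatten p (ContinuousLinearMap.adjoint T) := by
  by_cases h : p = 0
  · have h1 : ContinuousLinearMap.adjoint T ∈
        closure {S : F →L[ℂ] E | IsCompactOperator S} := by
      refine Metric.mem_closure_iff.2 fun ε hε => ?_
      obtain ⟨K, hK, hTK⟩ := hT.exists_finiteDimensional_range (half_pos hε)
      refine ⟨ContinuousLinearMap.adjoint K, ?_, ?_⟩
      · have := finiteDimensional_range_adjoint K
        have h2 := isSchatten_of_finiteDimensional_range (p := p) (ContinuousLinearMap.adjoint K)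
        simpa [IsSchatten, h] using h2
      · rw [dist_eq_norm, ← map_sub, LinearIsometryEquiv.norm_map]
        linarith
    rw [isClosed_setOfPred_isCompactOperator.closure_eq] at h1
    simpa [IsSchatten, h] using h1
  · have h1 := schattenENorm_ne_top hT
    simp only [IsSchatten, h, if_false]
    rwa [schattenENorm_adjoint]

/-- A supremum of continuous functions of `T`. Hence Schatten balls are closed in the operator norm,
which is what completeness of `L^p` rests on. -/
lemma lowerSemicontinuous_schattenENorm [hp : Fact (p = 0 ∨ 1 < p)] :
    LowerSemicontinuous (fun T : E →L[ℂ] F => schattenENorm p T) := by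
  rcases hp.out with h | h
  · simp only [schattenENorm_of_eq h]
    exact continuous_enorm.lowerSemicontinuous
  · have h0 : p ≠ 0 := by linarith
    simp only [schattenENorm, if_neg h0]
    refine lowerSemicontinuous_iSup fun n => lowerSemicontinuous_iSup fun e =>
      lowerSemicontinuous_iSup fun f => Continuous.lowerSemicontinuous ?_
    refine ENNReal.continuous_rpow_const.comp (continuous_finsetSum _ fun i _ => ?_)
    refine ENNReal.continuous_rpow_const.comp (Continuous.enorm ?_)
    exact Continuous.inner continuous_const (ContinuousLinearMap.apply ℂ F (e.1 i)).continuous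

end SchattenIdeal

/-! ### The Banach space `L^p(E, F)` and bounded bilinear composition -/

namespace SchattenClass

variable {p : ℝ} [Fact (p = 0 ∨ 1 < p)] {D E F G : Type*}
  [NormedAddCommGroup D] [InnerProductSpace ℂ D] [NormedAddCommGroup E] [InnerProductSpace ℂ E]
  [NormedAddCommGroup F] [InnerProductSpace ℂ F] [NormedAddCommGroup G] [InnerProductSpace ℂ G]

/-- An operator of class `L^p` as an element of `L^p(E, F)`. -/
def mk (T : E →L[ℂ] F) (hT : IsSchatten p T) : SchattenClass p E F := ⟨T, hT⟩

@[simp] lemma toCLM_mk (T : E →L[ℂ] F) (hT : IsSchatten p T) : (mk T hT).toCLM = T := rfl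

lemma isSchatten (T : SchattenClass p E F) : IsSchatten p T.toCLM := T.2

lemma toCLM_injective : Function.Injective (toCLM : SchattenClass p E F → E →L[ℂ] F) :=
  Subtype.val_injective

@[simp] lemma toCLM_add (S T : SchattenClass p E F) : (S + T).toCLM = S.toCLM + T.toCLM := rfl

@[simp] lemma toCLM_neg (T : SchattenClass p E F) : (-T).toCLM = -T.toCLM := rfl

@[simp] lemma toCLM_sub (S T : SchattenClass p E F) : (S - T).toCLM = S.toCLM - T.toCLM := rfl

@[simp] lemma toCLM_zero : (0 : SchattenClass p E F).toCLM = 0 := rfl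

@[simp] lemma toCLM_smul (c : ℂ) (T : SchattenClass p E F) : (c • T).toCLM = c • T.toCLM := rfl

lemma norm_def (T : SchattenClass p E F) : ‖T‖ = (schattenENorm p T.toCLM).toReal := rfl

lemma ofReal_norm (T : SchattenClass p E F) :
    ENNReal.ofReal ‖T‖ = schattenENorm p T.toCLM :=
  ENNReal.ofReal_toReal (schattenENorm_ne_top T.isSchatten)

lemma norm_toCLM_le (T : SchattenClass p E F) : ‖T.toCLM‖ ≤ ‖T‖ := by
  have h := enorm_le_schattenENorm (p := p) T.toCLM
  rw [← T.ofReal_norm, ← _root_.ofReal_norm] at h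
  exact (ENNReal.ofReal_le_ofReal_iff (norm_nonneg _)).1 h

variable (p E F) in
/-- The inclusion of `L^p` into the bounded operators. -/
def toCLML : SchattenClass p E F →L[ℂ] (E →L[ℂ] F) :=
  LinearMap.mkContinuous ⟨⟨toCLM, toCLM_add⟩, toCLM_smul⟩ 1 fun T => by
    rw [one_mul]; exact T.norm_toCLM_le

@[simp] lemma toCLML_apply (T : SchattenClass p E F) : toCLML p E F T = T.toCLM := rfl

/-- A Cauchy sequence of `L^p` converges in operator norm. Lower semicontinuity lets the Cauchy
estimate pass to the limit, giving convergence in the `L^p` norm; for `p = 0` the limit is compact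
because compactness is a closed condition. -/
instance [CompleteSpace F] : CompleteSpace (SchattenClass p E F) := by
  refine Metric.complete_of_cauchySeq_tendsto fun u hu => ?_
  obtain ⟨T, hT⟩ := cauchySeq_tendsto_of_complete
    ((toCLML p E F).uniformContinuous.comp_cauchySeq hu)
  have key : ∀ ε > 0, ∃ N, ∀ n ≥ N, schattenENorm p ((u n).toCLM - T) ≤ ENNReal.ofReal ε := by
    intro ε hε
    obtain ⟨N, hN⟩ := Metric.cauchySeq_iff.1 hu ε hε
    refine ⟨N, fun n hn => ?_⟩
    have hcl : IsClosed {S : E →L[ℂ] F | schattenENorm p S ≤ ENNReal.ofReal ε} :=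
      lowerSemicontinuous_schattenENorm.isClosed_preimage _
    refine hcl.mem_of_tendsto (tendsto_const_nhds.sub hT)
      (Filter.eventually_atTop.2 ⟨N, fun m hm => ?_⟩)
    change schattenENorm p ((u n - u m).toCLM) ≤ _
    rw [← SchattenClass.ofReal_norm, ← dist_eq_norm]
    exact ENNReal.ofReal_le_ofReal (hN n hn m hm).le
  have hTp : IsSchatten p T := by
    by_cases h : p = 0
    · simp only [IsSchatten, h, if_true]
      refine (isClosed_setOfPred_isCompactOperator (σ₁₂ := RingHom.id ℂ) (M₁ := E)
        (M₂ := F)).mem_of_tendsto hT (Filter.Eventually.of_forall fun n => ?_)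
      simpa [IsSchatten, h] using (u n).isSchatten
    · obtain ⟨N, hN⟩ := key 1 one_pos
      have h1 : IsSchatten p ((u N).toCLM - T) := by
        simp only [IsSchatten, h, if_false]
        exact ne_top_of_le_ne_top ENNReal.ofReal_ne_top (hN N le_rfl)
      have h2 := (schattenSubmodule p E F).sub_mem (u N).isSchatten h1
      rwa [sub_sub_cancel] at h2
  refine ⟨mk T hTp, Metric.tendsto_atTop.2 fun ε hε => ?_⟩
  obtain ⟨N, hN⟩ := key (ε / 2) (half_pos hε)
  refine ⟨N, fun n hn => ?_⟩
  rw [dist_eq_norm]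
  refine lt_of_le_of_lt ?_ (half_lt_self hε)
  have h1 := hN n hn
  change schattenENorm p ((u n - mk T hTp).toCLM) ≤ _ at h1
  rw [← SchattenClass.ofReal_norm] at h1
  exact (ENNReal.ofReal_le_ofReal_iff (half_pos hε).le).1 h1

section Ideal

variable [CompleteSpace D] [CompleteSpace E] [CompleteSpace F] [CompleteSpace G]

lemma norm_comp_le (S : F →L[ℂ] G) (T : SchattenClass p E F) (R : D →L[ℂ] E) :
    ‖mk (S ∘L T.toCLM ∘L R) (T.isSchatten.comp S R)‖ ≤ ‖S‖ * ‖T‖ * ‖R‖ := by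
  have h := schattenENorm_comp_le (p := p) S T.toCLM R
  have h' := ENNReal.toReal_mono (ENNReal.mul_ne_top (ENNReal.mul_ne_top enorm_ne_top
    (schattenENorm_ne_top T.isSchatten)) enorm_ne_top) h
  rwa [ENNReal.toReal_mul, ENNReal.toReal_mul, toReal_enorm, toReal_enorm] at h'

variable (p D E F G)

/-- Composition of a bounded operator with an operator of class `L^p`. -/
def compL : (F →L[ℂ] G) →L[ℂ] SchattenClass p E F →L[ℂ] SchattenClass p E G :=
  LinearMap.mkContinuous₂ (LinearMap.mk₂ ℂ
    (fun S T => mk (S ∘L T.toCLM) (T.isSchatten.comp S (ContinuousLinearMap.id ℂ E)))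
    (fun S S' T => toCLM_injective (ContinuousLinearMap.add_comp S S' T.toCLM))
    (fun c S T => toCLM_injective (ContinuousLinearMap.smul_comp c S T.toCLM))
    (fun S T T' => toCLM_injective (ContinuousLinearMap.comp_add S T.toCLM T'.toCLM))
    (fun c S T => toCLM_injective (ContinuousLinearMap.comp_smul S c T.toCLM)))
    1 fun S T => by
      rw [one_mul]
      exact (norm_comp_le S T (ContinuousLinearMap.id ℂ E)).trans
        (mul_le_of_le_one_right (by positivity) ContinuousLinearMap.norm_id_le)

/-- Composition of an operator of class `L^p` with a bounded operator. -/
def compR : (D →L[ℂ] E) →L[ℂ] SchattenClass p E F →L[ℂ] SchattenClass p D F :=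
  LinearMap.mkContinuous₂ (LinearMap.mk₂ ℂ
    (fun R T => mk (T.toCLM ∘L R) (T.isSchatten.comp (ContinuousLinearMap.id ℂ F) R))
    (fun R R' T => toCLM_injective (ContinuousLinearMap.comp_add T.toCLM R R'))
    (fun c R T => toCLM_injective (ContinuousLinearMap.comp_smul T.toCLM c R))
    (fun R T T' => toCLM_injective (ContinuousLinearMap.add_comp T.toCLM T'.toCLM R))
    (fun c R T => toCLM_injective (ContinuousLinearMap.smul_comp c T.toCLM R)))
    1 fun R T => by
      rw [one_mul, mul_comm]
      refine (norm_comp_le (ContinuousLinearMap.id ℂ F) T R).trans ?_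
      gcongr
      exact mul_le_of_le_one_left (norm_nonneg T) ContinuousLinearMap.norm_id_le

/-- The adjoint, as a real-linear map. -/
def adjointL : SchattenClass p E F →L[ℝ] SchattenClass p F E :=
  LinearMap.mkContinuous
    { toFun := fun T => mk (ContinuousLinearMap.adjoint T.toCLM) T.isSchatten.adjoint
      map_add' := fun S T => toCLM_injective (by simp)
      map_smul' := fun r T => toCLM_injective (by
        change ContinuousLinearMap.adjoint ((r : ℂ) • T.toCLM) =
          (r : ℂ) • ContinuousLinearMap.adjoint T.toCLM
        rw [map_smulₛₗ, Complex.conj_ofReal]) } 1 fun T => by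
    rw [one_mul, norm_def, norm_def]
    change (schattenENorm p (ContinuousLinearMap.adjoint T.toCLM)).toReal ≤ _
    rw [schattenENorm_adjoint]

variable {p D E F G}

@[simp] lemma toCLM_compL (S : F →L[ℂ] G) (T : SchattenClass p E F) :
    (compL p E F G S T).toCLM = S ∘L T.toCLM := rfl

@[simp] lemma toCLM_compR (R : D →L[ℂ] E) (T : SchattenClass p E F) :
    (compR p D E F R T).toCLM = T.toCLM ∘L R := rfl

@[simp] lemma toCLM_adjointL (T : SchattenClass p E F) :
    (adjointL p E F T).toCLM = ContinuousLinearMap.adjoint T.toCLM := rfl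

end Ideal

end SchattenClass

/-! ### Fredholm operators from inverses modulo `L^p` -/

section Fredholm

open scoped LinearMap.FiniteRangeSetoid

variable {p : ℝ} [Fact (p = 0 ∨ 1 < p)] {E F : Type*} [NormedAddCommGroup E]
  [InnerProductSpace ℂ E] [NormedAddCommGroup F] [InnerProductSpace ℂ F] [CompleteSpace E]
  [CompleteSpace F]

/-- Approximate `K` by a finite-rank `S` with `‖K - S‖ < 1`. Then `1 - K` is the invertible operator
`1 - (K - S)` minus `S`, and the inverse of the former is a two-sided inverse of `1 - K` modulo
finite rank. -/
lemma exists_quasiInverse_one_sub {K : E →L[ℂ] E} (hK : IsSchatten p K) :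
    ∃ A : E →L[ℂ] E, ((A ∘L (1 - K) : E →L[ℂ] E) : E →ₗ[ℂ] E) ≈ LinearMap.id ∧
      (((1 - K) ∘L A : E →L[ℂ] E) : E →ₗ[ℂ] E) ≈ LinearMap.id := by
  obtain ⟨S, hS, hKS⟩ := hK.exists_finiteDimensional_range (ε := 1 / 2) (by norm_num)
  let u := Units.oneSub (K - S) (by linarith)
  have hu : (u : E →L[ℂ] E) = 1 - (K - S) := rfl
  have h1 : 1 - K = (u : E →L[ℂ] E) - S := by rw [hu]; abel
  have hS' : (S : E →ₗ[ℂ] E) ≈ 0 := by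
    rw [LinearMap.FiniteRangeSetoid.equiv_zero_iff_hasFiniteRange]
    exact Module.finite_def.1 hS |> (Submodule.fg_top _).1
  refine ⟨(↑u⁻¹ : E →L[ℂ] E), ?_, ?_⟩
  · have h2 : (↑u⁻¹ : E →L[ℂ] E) ∘L (1 - K) = 1 - (↑u⁻¹ : E →L[ℂ] E) ∘L S := by
      rw [h1]
      change (↑u⁻¹ : E →L[ℂ] E) * (↑u - S) = _
      rw [mul_sub, Units.inv_mul]
      rfl
    rw [h2, LinearMap.FiniteRangeSetoid.equiv_iff_hasNoetherianRange]
    rw [LinearMap.FiniteRangeSetoid.equiv_zero_iff_hasNoetherianRange] at hS'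
    have h3 := (hS'.comp_left (↑u⁻¹ : E →L[ℂ] E).toLinearMap).neg
    have h4 : ((1 - ((↑u⁻¹ : E →L[ℂ] E) ∘L S) : E →L[ℂ] E) : E →ₗ[ℂ] E) - LinearMap.id = -((↑u⁻¹ : E →L[ℂ] E).toLinearMap ∘ₗ S.toLinearMap) := by
      ext x
      change x - ((↑u⁻¹ : E →L[ℂ] E) ∘L S) x - x = -((↑u⁻¹ : E →L[ℂ] E) ∘L S) x
      abel
    rw [h4]
    exact h3
  · have h2 : (1 - K) ∘L (↑u⁻¹ : E →L[ℂ] E) = 1 - S ∘L (↑u⁻¹ : E →L[ℂ] E) := by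
      rw [h1]
      change (↑u - S) * (↑u⁻¹ : E →L[ℂ] E) = _
      rw [sub_mul, Units.mul_inv]
      rfl
    rw [h2, LinearMap.FiniteRangeSetoid.equiv_iff_hasNoetherianRange]
    rw [LinearMap.FiniteRangeSetoid.equiv_zero_iff_hasNoetherianRange] at hS'
    have h3 := (hS'.comp_right (↑u⁻¹ : E →L[ℂ] E).toLinearMap).neg
    have h4 : ((1 - (S ∘L (↑u⁻¹ : E →L[ℂ] E)) : E →L[ℂ] E) : E →ₗ[ℂ] E) - LinearMap.id = -(S.toLinearMap ∘ₗ (↑u⁻¹ : E →L[ℂ] E).toLinearMap) := by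
      ext x
      change x - (S ∘L (↑u⁻¹ : E →L[ℂ] E)) x - x = -(S ∘L (↑u⁻¹ : E →L[ℂ] E)) x
      abel
    rw [h4]
    exact h3

/-- An operator with an inverse modulo `L^p` is Fredholm. -/
lemma isFredholm_of_isSchatten {T : E →L[ℂ] F} {S : F →L[ℂ] E}
    (h₁ : IsSchatten p (1 - S ∘L T)) (h₂ : IsSchatten p (1 - T ∘L S)) : T.IsFredholm := by
  obtain ⟨A, hA, -⟩ := exists_quasiInverse_one_sub h₁
  obtain ⟨B, -, hB⟩ := exists_quasiInverse_one_sub h₂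
  rw [sub_sub_cancel] at hA hB
  let L : F →ₗ[ℂ] E := ((A ∘L S : F →L[ℂ] E) : F →ₗ[ℂ] E)
  let R : F →ₗ[ℂ] E := ((S ∘L B : F →L[ℂ] E) : F →ₗ[ℂ] E)
  have hL : L ∘ₗ (T : E →ₗ[ℂ] F) ≈ LinearMap.id := hA
  have hR : (T : E →ₗ[ℂ] F) ∘ₗ R ≈ LinearMap.id := hB
  -- As in a monoid, a left inverse and a right inverse agree, here modulo finite rank: `L ≈ L T R ≈
  -- R`.
  have hLR : L ≈ R := by
    have h3 : L ∘ₗ ((T : E →ₗ[ℂ] F) ∘ₗ R) ≈ L :=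
      LinearMap.FiniteRangeSetoid.equiv_comp_left (u' := L) hR
    have h4 : (L ∘ₗ (T : E →ₗ[ℂ] F)) ∘ₗ R ≈ R :=
      LinearMap.FiniteRangeSetoid.equiv_comp_right (u := R) hL
    exact Setoid.trans (Setoid.symm h3) h4
  refine ContinuousLinearMap.IsFredholm.of_isQuasiInverse (v := A ∘L S) ⟨hL, ?_⟩
  exact Setoid.trans (LinearMap.FiniteRangeSetoid.equiv_comp_left (u' := (T : E →ₗ[ℂ] F)) hLR) hR

end Fredholm

/-! ### Hilbert dimension is invariant under Fredholm operators in infinite dimension -/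

section HilbertDimension

open scoped LinearMap.FiniteRangeSetoid Cardinal

universe u

lemma HilbertBasis.infinite {ι E : Type*} [NormedAddCommGroup E] [InnerProductSpace ℂ E]
    (b : HilbertBasis ι ℂ E) (h : ¬ FiniteDimensional ℂ E) : Infinite ι := by
  by_contra hfin
  rw [not_infinite_iff_finite] at hfin
  have := Fintype.ofFinite ι
  exact h (Module.Basis.finiteDimensional_of_finite b.toOrthonormalBasis.toBasis)

lemma HilbertBasis.nonempty_linearIsometryEquiv {ι κ E F : Type*} [NormedAddCommGroup E]
    [InnerProductSpace ℂ E] [NormedAddCommGroup F] [InnerProductSpace ℂ F] [CompleteSpace F]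
    (b : HilbertBasis ι ℂ E) (c : HilbertBasis κ ℂ F) (e : ι ≃ κ) : Nonempty (E ≃ₗᵢ[ℂ] F) := by
  have h : ⊤ ≤ (Submodule.span ℂ (Set.range (c ∘ e))).topologicalClosure := by
    rw [e.surjective.range_comp, c.dense_span]
  exact ⟨b.repr.trans (HilbertBasis.mk (c.orthonormal.comp e e.injective) h).repr.symm⟩

variable {E F : Type u} [NormedAddCommGroup E] [InnerProductSpace ℂ E] [NormedAddCommGroup F]
  [InnerProductSpace ℂ F] [CompleteSpace E] [CompleteSpace F]

lemma isQuasiInverse_adjoint {T : E →L[ℂ] F} {v : F →L[ℂ] E}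
    (h : (v : F →ₗ[ℂ] E) ∘ₗ (T : E →ₗ[ℂ] F) ≈ LinearMap.id) :
    (ContinuousLinearMap.adjoint T : F →ₗ[ℂ] E) ∘ₗ (ContinuousLinearMap.adjoint v : E →ₗ[ℂ] F) ≈
      LinearMap.id := by
  rw [LinearMap.FiniteRangeSetoid.equiv_iff_hasFiniteRange] at h ⊢
  have h1 : FiniteDimensional ℂ (v ∘L T - ContinuousLinearMap.id ℂ E).range :=
    Module.Finite.iff_fg.2 h
  have h2 := finiteDimensional_range_adjoint (v ∘L T - ContinuousLinearMap.id ℂ E)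
  rw [map_sub, ContinuousLinearMap.adjoint_comp, ContinuousLinearMap.adjoint_id] at h2
  exact Module.Finite.iff_fg.1 h2

lemma ContinuousLinearMap.IsFredholm.adjoint {T : E →L[ℂ] F} (hT : T.IsFredholm) :
    (ContinuousLinearMap.adjoint T).IsFredholm := by
  obtain ⟨v, h1, h2⟩ := hT.exists_isQuasiInverse
  exact ContinuousLinearMap.IsFredholm.of_isQuasiInverse (v := ContinuousLinearMap.adjoint v)
    ⟨isQuasiInverse_adjoint h2, isQuasiInverse_adjoint h1⟩

/-- Each vector `T (b i)` has only countably many nonzero coordinates, so the sets `A i` are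
countable. An index `j` outside all of them has `T* (c j)` orthogonal to the basis `b`, so `c j`
lies in the kernel of `T*`, and only finitely many orthonormal vectors fit there. The union has at
most `#ι * ℵ₀ = #ι` elements. -/
lemma HilbertBasis.mk_le_of_finiteDimensional_ker_adjoint {ι κ : Type u} [Infinite ι]
    (b : HilbertBasis ι ℂ E) (c : HilbertBasis κ ℂ F) (T : E →L[ℂ] F)
    [FiniteDimensional ℂ (ContinuousLinearMap.adjoint T).ker] : #κ ≤ #ι := by
  let A : ι → Set κ := fun i => {j | inner ℂ (c j) (T (b i)) ≠ 0}
  let B : Set κ := {j | ContinuousLinearMap.adjoint T (c j) = 0}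
  have hA : ∀ i, (A i).Countable := by
    intro i
    refine (c.orthonormal.inner_products_summable (T (b i))).countable_support.mono fun j hj => ?_
    have hj' : inner ℂ (c j) (T (b i)) ≠ 0 := hj
    simpa using hj'
  have hB : B.Finite := by
    have h1 : LinearIndependent ℂ
        (fun j : B => (⟨c j, j.2⟩ : (ContinuousLinearMap.adjoint T).ker)) := by
      refine LinearIndependent.of_comp (ContinuousLinearMap.adjoint T).ker.subtype ?_
      exact c.orthonormal.linearIndependent.comp _ Subtype.val_injective
    have := h1.finite
    exact Set.toFinite B
  have huniv : (Set.univ : Set κ) ⊆ (⋃ i, A i) ∪ B := by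
    intro j _
    by_contra h
    rw [Set.mem_union, not_or, Set.mem_iUnion, not_exists] at h
    refine h.2 ?_
    have h1 : ∀ i, inner ℂ (ContinuousLinearMap.adjoint T (c j)) (b i) = 0 := by
      intro i
      rw [ContinuousLinearMap.adjoint_inner_left]
      exact not_not.1 (h.1 i)
    change ContinuousLinearMap.adjoint T (c j) = 0
    refine (LinearIsometryEquiv.map_eq_zero_iff b.repr).1 (lp.ext (funext fun i => ?_))
    rw [b.repr_apply_apply, inner_eq_zero_symm.1 (h1 i)]
    rfl
  have h2 : #(⋃ i, A i) ≤ #ι := by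
    refine (Cardinal.mk_iUnion_le A).trans ?_
    refine (mul_le_mul_right (ciSup_le' fun i => (hA i).le_aleph0) _).trans ?_
    exact (Cardinal.mul_aleph0_eq (Cardinal.aleph0_le_mk ι)).le
  calc #κ = #(Set.univ : Set κ) := Cardinal.mk_univ.symm
    _ ≤ #((⋃ i, A i) ∪ B : Set κ) := Cardinal.mk_le_mk_of_subset huniv
    _ ≤ #(⋃ i, A i) + #B := Cardinal.mk_union_le _ _
    _ ≤ #ι + #ι := add_le_add h2 (hB.lt_aleph0.le.trans (Cardinal.aleph0_le_mk ι))
    _ = #ι := Cardinal.add_eq_self (Cardinal.aleph0_le_mk ι)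

/-- Hilbert spaces related by a Fredholm operator are isometric if they are infinite-dimensional. -/
lemma ContinuousLinearMap.IsFredholm.nonempty_linearIsometryEquiv {T : E →L[ℂ] F}
    (hT : T.IsFredholm) (hF : ¬ FiniteDimensional ℂ F) : Nonempty (E ≃ₗᵢ[ℂ] F) := by
  have hE : ¬ FiniteDimensional ℂ E := by
    intro hE
    refine hF ?_
    have h1 : Module.Finite ℂ (F ⧸ T.range) := hT.finite_coker
    have h2 : Module.Finite ℂ T.range := inferInstance
    exact Module.Finite.of_submodule_quotient T.range
  obtain ⟨ι, b, -⟩ := exists_hilbertBasis ℂ E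
  obtain ⟨κ, c, -⟩ := exists_hilbertBasis ℂ F
  have := b.infinite hE
  have := c.infinite hF
  have := hT.adjoint.finite_ker
  have h1 := HilbertBasis.mk_le_of_finiteDimensional_ker_adjoint b c T
  have h2 : FiniteDimensional ℂ
      (ContinuousLinearMap.adjoint (ContinuousLinearMap.adjoint T)).ker := by
    rw [ContinuousLinearMap.adjoint_adjoint]
    exact hT.finite_ker
  have h3 := HilbertBasis.mk_le_of_finiteDimensional_ker_adjoint c b (ContinuousLinearMap.adjoint T)
  obtain ⟨e⟩ := Cardinal.eq.1 (le_antisymm h3 h1)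
  exact HilbertBasis.nonempty_linearIsometryEquiv b c e

end HilbertDimension

/-! ### Restricted projectors as `L^p` perturbations of `P₊` -/

section RestrictedProjector

open scoped LinearMap.FiniteRangeSetoid

lemma IsSchatten.add {p : ℝ} [Fact (p = 0 ∨ 1 < p)] {E F : Type*} [NormedAddCommGroup E]
    [InnerProductSpace ℂ E] [NormedAddCommGroup F] [InnerProductSpace ℂ F] {S T : E →L[ℂ] F}
    (hS : IsSchatten p S) (hT : IsSchatten p T) : IsSchatten p (S + T) :=
  (schattenSubmodule p E F).add_mem hS hT

lemma IsSchatten.neg {p : ℝ} [Fact (p = 0 ∨ 1 < p)] {E F : Type*} [NormedAddCommGroup E]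
    [InnerProductSpace ℂ E] [NormedAddCommGroup F] [InnerProductSpace ℂ F] {T : E →L[ℂ] F}
    (hT : IsSchatten p T) : IsSchatten p (-T) :=
  (schattenSubmodule p E F).neg_mem hT

lemma IsSchatten.sub {p : ℝ} [Fact (p = 0 ∨ 1 < p)] {E F : Type*} [NormedAddCommGroup E]
    [InnerProductSpace ℂ E] [NormedAddCommGroup F] [InnerProductSpace ℂ F] {S T : E →L[ℂ] F}
    (hS : IsSchatten p S) (hT : IsSchatten p T) : IsSchatten p (S - T) :=
  (schattenSubmodule p E F).sub_mem hS hT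

variable {p : ℝ} [Fact (p = 0 ∨ 1 < p)] {H : Type*} [NormedAddCommGroup H]
  [InnerProductSpace ℂ H] [CompleteSpace H] {Hp : Submodule ℂ H} [CompleteSpace Hp]

lemma IsStarProjection.completeSpace_range {P : H →L[ℂ] H} (hP : IsStarProjection P) :
    CompleteSpace P.range :=
  (ContinuousLinearMap.IsIdempotentElem.isClosed_range hP.isIdempotentElem).completeSpace_coe

lemma IsStarProjection.apply_of_mem_range {P : H →L[ℂ] H} (hP : IsStarProjection P) {x : H}
    (hx : x ∈ P.range) : P x = x := by
  obtain ⟨y, rfl⟩ := hx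
  exact congrArg (fun T : H →L[ℂ] H => T y) hP.isIdempotentElem.eq

lemma IsStarProjection.eq_starProjection {P : H →L[ℂ] H} (hP : IsStarProjection P)
    [P.range.HasOrthogonalProjection] : P = P.range.starProjection :=
  (ContinuousLinearMap.IsStarProjection.ext_iff hP isStarProjection_starProjection).2
    (Submodule.range_starProjection _).symm

/-- With `e = P₊`, one has `P - e = (1 - e) P - ((1 - P) e)*`. The first term is of class `L^p` by
hypothesis; the Fredholm condition is what controls the second. This embeds the Grassmannian into
`L^p(H, H)`. -/
lemma IsRestrictedProjector.isSchatten_sub {P : H →L[ℂ] H} (hP : IsRestrictedProjector p Hp P) :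
    IsSchatten p (P - Hp.starProjection) := by
  have hcomp := hP.isStarProjection.completeSpace_range
  have hPeq := hP.isStarProjection.eq_starProjection
  set e := Hp.starProjection with he
  let r : H →L[ℂ] P.range := P.range.orthogonalProjectionOnto
  have hr : ∀ x, (r x : H) = P x := fun x => by
    conv_rhs => rw [hPeq]
    rfl
  have h1 : IsSchatten p ((1 - e) * P) := by
    have h := hP.schatten.comp Hpᗮ.subtypeL r
    convert h using 1
    ext x
    change P x - e (P x) = Hpᗮ.starProjection (r x : H)
    rw [hr, Submodule.starProjection_orthogonal']
    rfl
  obtain ⟨v, -, hv⟩ := hP.fredholm.exists_isQuasiInverse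
  let T : P.range →L[ℂ] Hp := Hp.orthogonalProjectionOnto ∘L P.range.subtypeL
  let R : Hp →L[ℂ] Hp := T ∘L v - ContinuousLinearMap.id ℂ Hp
  have hR : IsSchatten p R := by
    have hfin : FiniteDimensional ℂ R.range := by
      refine Module.Finite.iff_fg.2 ?_
      exact LinearMap.FiniteRangeSetoid.equiv_iff_hasFiniteRange.1 hv
    exact isSchatten_of_finiteDimensional_range R
  -- For `y` in `Hp`, `y = e (v y) - R y`. As `v y` is in the range of `P`, `(1 - P) e (v y) = -(1 -
  -- P) (1 - e) P (v y)`, so both contributions to `(1 - P) y` contain an `L^p` factor.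
  have h2 : IsSchatten p ((1 - P) * e) := by
    have h3 := h1.comp (1 - P) (P.range.subtypeL ∘L v ∘L Hp.orthogonalProjectionOnto)
    have h4 := hR.comp ((1 - P) ∘L Hp.subtypeL) Hp.orthogonalProjectionOnto
    convert (h3.add h4).neg using 1
    ext x
    set y : Hp := Hp.orthogonalProjectionOnto x with hy
    have hey : e x = y := rfl
    have hRy : (R y : H) = e (v y : H) - y := rfl
    have hPv : P (v y : H) = v y := hP.isStarProjection.apply_of_mem_range (v y).2
    change e x - P (e x) = -((((P (v y : H)) - e (P (v y : H))) - P ((P (v y : H)) - e (P (v y : H))))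
      + ((R y : H) - P (R y : H)))
    rw [hPv, hRy, hey]
    simp only [map_sub, hPv]
    abel
  have h5 : P - e = (1 - e) * P - ContinuousLinearMap.adjoint ((1 - P) * e) := by
    have h6 : star e = e := isStarProjection_starProjection.isSelfAdjoint.star_eq
    have h7 : star P = P := hP.isStarProjection.isSelfAdjoint.star_eq
    rw [← ContinuousLinearMap.star_eq_adjoint, star_mul, star_sub, star_one, h6, h7]
    noncomm_ring
  rw [h5]
  exact h1.sub h2.adjoint

/-- The restriction of `P` to `Hp` is an inverse modulo `L^p` of the projection from the range of
`P` to `Hp`: both defects are compressions of `±(P - P₊)`. -/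
lemma isRestrictedProjector_of_isSchatten_sub {P : H →L[ℂ] H} (hP : IsStarProjection P)
    (h : IsSchatten p (P - Hp.starProjection)) : IsRestrictedProjector p Hp P := by
  have hcomp := hP.completeSpace_range
  have hPeq := hP.eq_starProjection
  set e := Hp.starProjection with he
  let r : H →L[ℂ] P.range := P.range.orthogonalProjectionOnto
  have hr : ∀ x, (r x : H) = P x := fun x => by
    conv_rhs => rw [hPeq]
    rfl
  have hPr : ∀ x : P.range, P x = x := fun x => hP.apply_of_mem_range x.2
  have hee : ∀ x : Hp, e x = x := fun x => Submodule.starProjection_eq_self_iff.2 x.2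
  refine ⟨hP, ?_, ?_⟩
  · refine isFredholm_of_isSchatten (p := p) (S := r ∘L Hp.subtypeL) ?_ ?_
    · convert h.comp r P.range.subtypeL using 1
      ext x
      change (x : H) - (r (e (x : H)) : H) = (r (P x - e x) : H)
      rw [hr, hr, map_sub, hPr, hPr]
    · convert h.neg.comp Hp.orthogonalProjectionOnto Hp.subtypeL using 1
      ext x
      change (x : H) - e (r (x : H) : H) = e (-(P x - e x))
      rw [hr, map_neg, map_sub, hee, hee]
      abel
  · convert h.comp Hpᗮ.orthogonalProjectionOnto P.range.subtypeL using 1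
    ext x
    change Hpᗮ.starProjection (x : H) = Hpᗮ.starProjection (P x - e x)
    rw [Submodule.starProjection_orthogonal']
    change (x : H) - e x = (P x - e x) - e (P x - e x)
    have hee' : e (e (x : H)) = e x := hee (Hp.orthogonalProjectionOnto (x : H))
    rw [map_sub, hPr, hee']
    abel

/-- Passing to complements only changes the sign of `P - P₊`. This makes the Fredholm results
available for `Wᗮ` and `Hpᗮ`. -/
lemma IsRestrictedProjector.one_sub {P : H →L[ℂ] H} (hP : IsRestrictedProjector p Hp P) :
    IsRestrictedProjector p Hpᗮ (1 - P) := by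
  refine isRestrictedProjector_of_isSchatten_sub hP.isStarProjection.one_sub ?_
  convert hP.isSchatten_sub.neg using 1
  rw [Submodule.starProjection_orthogonal']
  change (1 - P) - (1 - Hp.starProjection) = _
  abel

lemma exists_partialIsometry {K L : Submodule ℂ H} [CompleteSpace K] [CompleteSpace L]
    (f : K ≃ₗᵢ[ℂ] L) : ∃ a : H →L[ℂ] H, star a * a = K.starProjection ∧
      a * star a = L.starProjection ∧ L.starProjection * a = a ∧ a * K.starProjection = a := by
  let a : H →L[ℂ] H := L.subtypeL ∘L (f : K →L[ℂ] L) ∘L K.orthogonalProjectionOnto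
  have hstar : star a = K.subtypeL ∘L (f.symm : L →L[ℂ] K) ∘L L.orthogonalProjectionOnto := by
    rw [ContinuousLinearMap.star_eq_adjoint, ContinuousLinearMap.adjoint_comp,
      ContinuousLinearMap.adjoint_comp, Submodule.adjoint_subtypeL,
      Submodule.adjoint_orthogonalProjectionOnto, LinearIsometryEquiv.adjoint_eq_symm]
    rfl
  refine ⟨a, ?_, ?_, ?_, ?_⟩
  · rw [hstar]
    ext x
    simp [a]
  · rw [hstar]
    ext x
    simp [a]
  · ext x
    simp [a]
  · ext x
    simp only [a, ContinuousLinearMap.mul_def, ContinuousLinearMap.comp_apply]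
    exact congrArg (fun z : K => ((f z : L) : H))
      (K.orthogonalProjectionOnto_mem_subspace_eq_self (K.orthogonalProjectionOnto x))

/-- The restricted unitary group acts transitively on the restricted Grassmannian. -/
lemma IsRestrictedProjector.exists_unitary {P : H →L[ℂ] H} (hP : IsRestrictedProjector p Hp P)
    (hplus : ¬ FiniteDimensional ℂ Hp) (hminus : ¬ FiniteDimensional ℂ Hpᗮ) :
    ∃ U ∈ unitary (H →L[ℂ] H), U * Hp.starProjection * star U = P := by
  have hcomp := hP.isStarProjection.completeSpace_range
  have hcomp' := hP.one_sub.isStarProjection.completeSpace_range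
  obtain ⟨f⟩ := hP.fredholm.nonempty_linearIsometryEquiv hplus
  obtain ⟨g⟩ := hP.one_sub.fredholm.nonempty_linearIsometryEquiv hminus
  obtain ⟨a, ha₁, ha₂, ha₃, ha₄⟩ := exists_partialIsometry f.symm
  obtain ⟨b, hb₁, hb₂, hb₃, hb₄⟩ := exists_partialIsometry g.symm
  rw [← hP.isStarProjection.eq_starProjection] at ha₂ ha₃
  rw [← hP.one_sub.isStarProjection.eq_starProjection] at hb₂ hb₃
  have he : Hpᗮ.starProjection = 1 - Hp.starProjection := Submodule.starProjection_orthogonal' Hp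
  rw [he] at hb₁ hb₄
  set e := Hp.starProjection with hedef
  have hes : star e = e := isStarProjection_starProjection.isSelfAdjoint.star_eq
  have hee : e * e = e := isStarProjection_starProjection.isIdempotentElem.eq
  have hPs : star P = P := hP.isStarProjection.isSelfAdjoint.star_eq
  have hPP : P * P = P := hP.isStarProjection.isIdempotentElem.eq
  have hab : star a * b = 0 := by
    rw [← ha₃, ← hb₃, star_mul, hPs]
    calc star a * P * ((1 - P) * b) = star a * (P - P * P) * b := by noncomm_ring
      _ = 0 := by rw [hPP]; simp
  have hba : star b * a = 0 := by
    have := congrArg star hab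
    simpa using this
  have hab' : a * star b = 0 := by
    rw [← ha₄, ← hb₄, star_mul, star_sub, star_one, hes]
    calc a * e * ((1 - e) * star b) = a * (e - e * e) * star b := by noncomm_ring
      _ = 0 := by rw [hee]; simp
  have hba' : b * star a = 0 := by
    have := congrArg star hab'
    simpa using this
  have hbe : b * e = 0 := by
    rw [← hb₄, mul_assoc, sub_mul, hee, one_mul, sub_self, mul_zero]
  -- `a` maps `Hp` isometrically onto the range of `P` and `b` does the same for the complements, so
  -- the sum is unitary and conjugates `e` to `P`.
  refine ⟨a + b, Unitary.mem_iff.2 ⟨?_, ?_⟩, ?_⟩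
  · rw [star_add, add_mul, mul_add, mul_add, hab, hba, ha₁, hb₁]
    abel
  · rw [star_add, add_mul, mul_add, mul_add, hab', hba', ha₂, hb₂]
    abel
  · rw [add_mul, hbe, ha₄, add_zero, star_add, mul_add, hab', ha₂, add_zero]

end RestrictedProjector

/-! ### Manifolds embedded by a map into another manifold -/

section AdaptedChart

variable {EN HN N M F F' : Type*} [NormedAddCommGroup EN] [NormedSpace ℝ EN] [TopologicalSpace HN]
  {I : ModelWithCorners ℝ EN HN} [TopologicalSpace N] [ChartedSpace HN N] {J : M → N}
  [TopologicalSpace M] [NormedAddCommGroup F] [NormedSpace ℝ F]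
  [NormedAddCommGroup F'] [NormedSpace ℝ F']

variable (I J) in
/-- The chart `φ` of `M` is compatible with the injection `J` of `M` into the manifold `N`: its
inverse is smooth as a map to `N`, and it extends to a smooth map on an open subset of `N`. -/
def IsAdaptedChart (φ : OpenPartialHomeomorph M F) : Prop :=
  ContMDiffOn 𝓘(ℝ, F) I ∞ (J ∘ φ.symm) φ.target ∧
    ∃ (O : Set N) (f : N → F), IsOpen O ∧ ContMDiffOn I 𝓘(ℝ, F) ∞ f O ∧
      ∀ x ∈ φ.source, J x ∈ O ∧ φ x = f (J x)

/-- Continuity in both directions comes for free: `e` is the restriction of `f ∘ J`, and `e.symm` is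
continuous because `J` is inducing and `J ∘ e.symm` is smooth. -/
lemma exists_isAdaptedChart (hJ : Topology.IsInducing J) (e : PartialEquiv M F)
    (htarget : IsOpen e.target) (hsymm : ContMDiffOn 𝓘(ℝ, F) I ∞ (J ∘ e.symm) e.target)
    {O : Set N} {f : N → F} (hO : IsOpen O) (hf : ContMDiffOn I 𝓘(ℝ, F) ∞ f O)
    (hsource : e.source = J ⁻¹' O) (hef : ∀ x ∈ e.source, e x = f (J x)) :
    ∃ φ : OpenPartialHomeomorph M F, φ.toPartialEquiv = e ∧ IsAdaptedChart I J φ := by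
  refine ⟨⟨⟨e, ?_, ?_⟩, hsource ▸ hO.preimage hJ.continuous, htarget⟩, rfl, hsymm, O, f, hO, hf,
    fun x hx => ⟨?_, hef x hx⟩⟩
  · refine ContinuousOn.congr (f := f ∘ J) ?_ hef
    exact hf.continuousOn.comp hJ.continuous.continuousOn fun x hx => by rwa [hsource] at hx
  · exact hJ.continuousOn_iff.2 hsymm.continuousOn
  · change x ∈ e.source at hx
    rwa [hsource] at hx

lemma IsAdaptedChart.transHomeomorph {φ : OpenPartialHomeomorph M F} (hφ : IsAdaptedChart I J φ)
    (e : F ≃L[ℝ] F') : IsAdaptedChart I J (φ.transHomeomorph e.toHomeomorph) := by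
  obtain ⟨h1, O, f, hO, hf, hfJ⟩ := hφ
  refine ⟨?_, O, e ∘ f, hO, ?_, fun x hx => ⟨(hfJ x hx).1, congrArg e (hfJ x hx).2⟩⟩
  · exact h1.comp e.symm.contDiff.contMDiff.contMDiffOn fun x hx => hx
  · exact e.contDiff.contMDiff.comp_contMDiffOn hf

/-- The transition map factors through the ambient manifold as `f ∘ (J ∘ φ.symm)`, with `f` the
smooth extension of `ψ`. -/
lemma IsAdaptedChart.contDiffOn_trans {φ : OpenPartialHomeomorph M F}
    {ψ : OpenPartialHomeomorph M F'} (hφ : IsAdaptedChart I J φ) (hψ : IsAdaptedChart I J ψ) :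
    ContDiffOn ℝ ∞ (ψ ∘ φ.symm) (φ.symm.trans ψ).source := by
  obtain ⟨h1, -⟩ := hφ
  obtain ⟨-, O, f, hO, hf, hfJ⟩ := hψ
  rw [← contMDiffOn_iff_contDiffOn]
  have hsub : ∀ x ∈ (φ.symm.trans ψ).source, x ∈ φ.target ∧ φ.symm x ∈ ψ.source := by
    intro x hx
    simpa using hx
  refine ContMDiffOn.congr (f := f ∘ (J ∘ φ.symm)) ?_ fun x hx => (hfJ _ (hsub x hx).2).2
  exact hf.comp (h1.mono fun x hx => (hsub x hx).1) fun x hx => (hfJ _ (hsub x hx).2).1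

variable [ChartedSpace F M]

lemma isManifold_of_isAdaptedChart (h : ∀ φ ∈ atlas F M, IsAdaptedChart I J φ) :
    IsManifold 𝓘(ℝ, F) ∞ M := by
  refine isManifold_of_contDiffOn _ _ _ fun φ ψ hφ hψ => ?_
  simpa using (h φ hφ).contDiffOn_trans (h ψ hψ)

/-- Smoothness into `M` can be tested in the ambient manifold: in a chart, `g` reads `f ∘ (J ∘ g)`.
All structure maps of the groupoid are treated this way. -/
lemma contMDiffWithinAt_of_isAdaptedChart (hJ : Topology.IsInducing J)
    (h : ∀ φ ∈ atlas F M, IsAdaptedChart I J φ) {E' H' N' : Type*} [NormedAddCommGroup E']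
    [NormedSpace ℝ E'] [TopologicalSpace H'] {I' : ModelWithCorners ℝ E' H'} [TopologicalSpace N']
    [ChartedSpace H' N'] {g : N' → M} {s : Set N'} {x : N'}
    (hg : ContMDiffWithinAt I' I ∞ (J ∘ g) s x) : ContMDiffWithinAt I' 𝓘(ℝ, F) ∞ g s x := by
  have hcont : ContinuousWithinAt g s x := hJ.continuousWithinAt_iff.2 hg.continuousWithinAt
  refine contMDiffWithinAt_iff_target.2 ⟨hcont, ?_⟩
  obtain ⟨-, O, f, hO, hf, hfJ⟩ := h _ (chart_mem_atlas F (g x))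
  have hx := hfJ _ (mem_chart_source F (g x))
  have h1 : ContMDiffWithinAt I' 𝓘(ℝ, F) ∞ (f ∘ (J ∘ g)) s x :=
    (hf.contMDiffAt (hO.mem_nhds hx.1)).comp_contMDiffWithinAt x hg
  refine h1.congr_of_eventuallyEq ?_ ?_
  · filter_upwards [hcont ((chartAt F (g x)).open_source.mem_nhds (mem_chart_source F (g x)))]
      with y hy
    simpa using (hfJ _ hy).2
  · simpa using hx.2

lemma contMDiff_of_isAdaptedChart (h : ∀ φ ∈ atlas F M, IsAdaptedChart I J φ) :
    ContMDiff 𝓘(ℝ, F) I ∞ J := by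
  have := isManifold_of_isAdaptedChart h
  intro x
  obtain ⟨h1, -⟩ := h _ (chart_mem_atlas F x)
  have h2 : ContMDiffOn 𝓘(ℝ, F) 𝓘(ℝ, F) ∞ (chartAt F x) (chartAt F x).source :=
    contMDiffOn_chart
  have hx := mem_chart_source F x
  have hn := (chartAt F x).open_source.mem_nhds hx
  have h3 := ((h1.comp h2 fun y hy => (chartAt F x).map_source hy) x hx).contMDiffAt hn
  refine h3.congr_of_eventuallyEq ?_
  filter_upwards [hn] with y hy
  exact congrArg J ((chartAt F x).left_inv hy).symm

/-- Applies to charts outside the chosen atlas as well, which is needed since the atlas uses only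
some of the charts to be shown smooth. -/
lemma IsAdaptedChart.isSmoothChart (hJ : Topology.IsInducing J)
    (h : ∀ φ ∈ atlas F M, IsAdaptedChart I J φ) {ψ : OpenPartialHomeomorph M F'}
    (hψ : IsAdaptedChart I J ψ) : IsSmoothChart (E := F) ψ := by
  obtain ⟨h1, O, f, hO, hf, hfJ⟩ := hψ
  refine ⟨?_, fun x hx => contMDiffWithinAt_of_isAdaptedChart hJ h (h1 x hx)⟩
  refine ContMDiffOn.congr (f := f ∘ J) ?_ fun x hx => (hfJ x hx).2
  exact hf.comp (contMDiff_of_isAdaptedChart h).contMDiffOn fun x hx => (hfJ x hx).1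

end AdaptedChart

/-! ### Pairs of projections in general position -/

section Oblique

variable {A : Type*}

/-- `T` is the oblique projection onto the range of the projection `P` along the kernel of the
projection `Q`. -/
structure IsObliqueProjection [Mul A] (P Q T : A) : Prop where
  left_mul : P * T = T
  mul_left : T * P = P
  mul_right : T * Q = T
  right_mul : Q * T = Q

/-- The operator intertwining the projections `P` and `Q`: it satisfies `T * P = Q * T`. -/
def projectionIntertwiner [Ring A] (P Q : A) : A := Q * P + (1 - Q) * (1 - P)

/-- In this form the intertwiner is affine in `P - Q`, so it extends to arbitrary elements of `L^p`
in place of the difference of projections. -/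
lemma projectionIntertwiner_eq [Ring A] {P Q : A} (hQ : IsIdempotentElem Q) :
    projectionIntertwiner P Q = 1 - (1 - 2 * Q) * (P - Q) := by
  have h : Q * Q = Q := hQ
  calc _ = 1 - P - Q + 2 * (Q * P) := by rw [projectionIntertwiner]; noncomm_ring
    _ = 1 - P + Q + 2 * (Q * P) - 2 * (Q * Q) := by rw [h]; noncomm_ring
    _ = _ := by noncomm_ring

lemma projectionIntertwiner_mul [Ring A] {P Q : A} (hP : IsIdempotentElem P) :
    projectionIntertwiner P Q * P = Q * P := by
  have h : P * P = P := hP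
  calc _ = Q * (P * P) + (1 - Q) * (P - P * P) := by rw [projectionIntertwiner]; noncomm_ring
    _ = Q * P := by rw [h]; simp

lemma mul_projectionIntertwiner [Ring A] {P Q : A} (hQ : IsIdempotentElem Q) :
    Q * projectionIntertwiner P Q = Q * P := by
  have h : Q * Q = Q := hQ
  calc _ = (Q * Q) * P + (Q - Q * Q) * (1 - P) := by rw [projectionIntertwiner]; noncomm_ring
    _ = Q * P := by rw [h]; simp

/-- Write `X` for the intertwiner. From `X P = Q P = Q X` follows `X⁻¹ Q = P X⁻¹`, which exhibits at
once the range of `P` and the kernel of `Q`. -/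
lemma isObliqueProjection_of_isUnit [Ring A] {P Q : A} (hP : IsIdempotentElem P)
    (hQ : IsIdempotentElem Q) (h : IsUnit (projectionIntertwiner P Q)) :
    IsObliqueProjection P Q (Ring.inverse (projectionIntertwiner P Q) * Q) := by
  obtain ⟨u, hu⟩ := h
  have h1 : (u : A) * P = Q * P := hu ▸ projectionIntertwiner_mul hP
  have h2 : Q * (u : A) = Q * P := hu ▸ mul_projectionIntertwiner hQ
  have h3 : (↑u⁻¹ : A) * Q = P * ↑u⁻¹ := by
    rw [Units.inv_mul_eq_iff_eq_mul, ← mul_assoc, h1, ← h2, mul_assoc, Units.mul_inv, mul_one]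
  have hPP : P * P = P := hP
  have hQQ : Q * Q = Q := hQ
  rw [← hu, Ring.inverse_unit]
  refine ⟨?_, ?_, ?_, ?_⟩
  · rw [h3, ← mul_assoc, hPP]
  · rw [mul_assoc, ← h1, ← mul_assoc, Units.inv_mul, one_mul]
  · rw [mul_assoc, hQQ]
  · rw [h3, ← mul_assoc, ← h2, mul_assoc, Units.mul_inv, mul_one]

/-- If `T` projects onto the range of `P` along the kernel of `Q`, then `1 - T*` plays the same role
for `1 - P` and `1 - Q`. Gluing the two on the summands of `Q` gives the explicit inverse. -/
lemma IsObliqueProjection.isUnit [Ring A] [StarRing A] {P Q T : A} (hP : IsStarProjection P)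
    (hQ : IsStarProjection Q) (h : IsObliqueProjection P Q T) :
    IsUnit (projectionIntertwiner P Q) := by
  have hPs : star P = P := hP.isSelfAdjoint.star_eq
  have hQs : star Q = Q := hQ.isSelfAdjoint.star_eq
  have hPP : P * P = P := hP.isIdempotentElem.eq
  have hQQ : Q * Q = Q := hQ.isIdempotentElem.eq
  obtain ⟨h1, h2, h3, h4⟩ := h
  have s1 : star T * P = star T := by simpa [hPs] using congrArg star h1
  have s2 : P * star T = P := by simpa [hPs] using congrArg star h2
  have s3 : Q * star T = star T := by simpa [hQs] using congrArg star h3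
  have s4 : star T * Q = Q := by simpa [hQs] using congrArg star h4
  refine isUnit_iff_exists.2 ⟨T * Q + (1 - star T) * (1 - Q), ?_, ?_⟩
  · calc projectionIntertwiner P Q * (T * Q + (1 - star T) * (1 - Q))
        = Q * (P * T) * Q + (1 - Q) * (T - P * T) * Q + Q * (P - P * star T) * (1 - Q)
          + (1 - Q) * (1 - star T - P + P * star T) * (1 - Q) := by
          rw [projectionIntertwiner]; noncomm_ring
      _ = (Q * T) * Q + (1 - Q) * (1 - star T) * (1 - Q) := by rw [h1, s2]; noncomm_ring
      _ = Q * Q + (1 - Q) * (1 - Q) - (star T - Q * star T) * (1 - Q) := by rw [h4]; noncomm_ring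
      _ = 1 - 2 * Q + 2 * (Q * Q) := by rw [s3]; noncomm_ring
      _ = 1 := by rw [hQQ]; noncomm_ring
  · calc (T * Q + (1 - star T) * (1 - Q)) * projectionIntertwiner P Q
        = T * (Q * Q) * P + T * (Q - Q * Q) * (1 - P) + (1 - star T) * (Q - Q * Q) * P
          + (1 - star T) * (1 - 2 * Q + Q * Q) * (1 - P) := by
          rw [projectionIntertwiner]; noncomm_ring
      _ = (T * Q) * P + (1 - Q - star T + star T * Q) * (1 - P) := by rw [hQQ]; noncomm_ring
      _ = P + (1 - star T) * (1 - P) := by rw [h3, h2, s4]; noncomm_ring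
      _ = 1 - star T + star T * P := by noncomm_ring
      _ = 1 := by rw [s1]; noncomm_ring

lemma IsObliqueProjection.inverse_mul [Ring A] [StarRing A] {P Q T : A} (hP : IsStarProjection P)
    (hQ : IsStarProjection Q) (h : IsObliqueProjection P Q T) :
    Ring.inverse (projectionIntertwiner P Q) * Q = T := by
  have h1 : projectionIntertwiner P Q * T = Q := by
    have hQQ : Q * Q = Q := hQ.isIdempotentElem.eq
    calc _ = Q * (P * T) + (1 - Q) * (T - P * T) := by rw [projectionIntertwiner]; noncomm_ring
      _ = Q := by rw [h.left_mul, h.right_mul]; simp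
  calc Ring.inverse (projectionIntertwiner P Q) * Q
      = Ring.inverse (projectionIntertwiner P Q) * (projectionIntertwiner P Q * T) := by rw [h1]
    _ = T := by rw [← mul_assoc, Ring.inverse_mul_cancel _ (h.isUnit hP hQ), one_mul]

/-- An orthogonal projection is determined by its range, and `T` determines the range of `P`. -/
lemma IsObliqueProjection.unique [Ring A] [StarRing A] {P P' Q T : A} (hP : IsStarProjection P)
    (hP' : IsStarProjection P') (h : IsObliqueProjection P Q T) (h' : IsObliqueProjection P' Q T) :
    P = P' := by
  have h1 : P' * P = P := by rw [← h.mul_left, ← mul_assoc, h'.left_mul]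
  have h2 : P * P' = P' := by rw [← h'.mul_left, ← mul_assoc, h.left_mul]
  have h3 := congrArg star h1
  rw [star_mul, hP.isSelfAdjoint.star_eq, hP'.isSelfAdjoint.star_eq, h2] at h3
  exact h3.symm

/-- `i S` is self-adjoint, so its spectrum is real and misses `i`; and `1 - S = -i (i - i S)`. -/
lemma isUnit_one_sub_of_skewAdjoint [CStarAlgebra A] {S : A} (hS : star S = -S) :
    IsUnit (1 - S) := by
  have hsa : IsSelfAdjoint (Complex.I • S) := by
    rw [isSelfAdjoint_iff, star_smul, hS]
    simp
  by_contra h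
  have h1 : Complex.I ∈ spectrum ℂ (Complex.I • S) := by
    rw [spectrum.mem_iff]
    intro h2
    refine h ?_
    have h3 : (1 : A) - S = (-Complex.I) • (algebraMap ℂ A Complex.I - Complex.I • S) := by
      rw [Algebra.algebraMap_eq_smul_one, smul_sub, smul_smul, smul_smul]
      simp
    rw [h3]
    have h4 : IsUnit (-Complex.I) := (neg_ne_zero.2 Complex.I_ne_zero).isUnit
    obtain ⟨c, hc⟩ := h4
    rw [← hc]
    exact h2.smul c
  have h2 := hsa.im_eq_zero_of_mem_spectrum h1
  simp at h2

/-- The orthogonal projection onto the graph of `a`, where `Q * a = 0` and `a * Q = a`. -/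
def graphProjection [Ring A] [StarRing A] (Q a : A) : A :=
  (Q + a) * (Ring.inverse (1 - (a - star a)) * (2 * Q - 1))

/-- Every term on the right contains a factor `a` or `a - a*`. With `a` in `L^p` this places the
difference in `L^p`, and shows it to depend smoothly on `a` there. -/
lemma graphProjection_sub [CStarAlgebra A] {Q a : A} (hQ : IsStarProjection Q) (haQ : a * Q = a) :
    graphProjection Q a - Q = a + (Q + a) * ((a - star a) *
      (Ring.inverse (1 - (a - star a)) * (2 * Q - 1))) := by
  have hQQ : Q * Q = Q := hQ.isIdempotentElem.eq
  have hu : IsUnit (1 - (a - star a)) := isUnit_one_sub_of_skewAdjoint (by simp)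
  set S := a - star a with hS
  have h1 : Ring.inverse (1 - S) = 1 + S * Ring.inverse (1 - S) := by
    calc Ring.inverse (1 - S) = (1 - S) * Ring.inverse (1 - S) + S * Ring.inverse (1 - S) := by
          noncomm_ring
      _ = _ := by rw [Ring.mul_inverse_cancel _ hu]
  rw [graphProjection, ← hS]
  conv_lhs => rw [h1]
  calc (Q + a) * ((1 + S * Ring.inverse (1 - S)) * (2 * Q - 1)) - Q
      = 2 * (Q * Q) - Q + 2 * (a * Q) - a - Q + (Q + a) * (S * (Ring.inverse (1 - S) * (2 * Q - 1)))
        := by noncomm_ring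
    _ = _ := by rw [hQQ, haQ]; noncomm_ring

/-- `T = Q + a` is an idempotent whose range is the graph. The operator `N = T + T* - 1` factors as
`(2 Q - 1) (1 - (a - a*))`, hence is invertible, and `N T = T* T = T* N`. So `T N⁻¹ = N⁻¹ T*` is
self-adjoint, and it is an idempotent with the range of `T`. -/
lemma isStarProjection_graphProjection [CStarAlgebra A] {Q a : A} (hQ : IsStarProjection Q)
    (hQa : Q * a = 0) (haQ : a * Q = a) : IsStarProjection (graphProjection Q a) ∧
      IsObliqueProjection (graphProjection Q a) Q (Q + a) := by
  have hQQ : Q * Q = Q := hQ.isIdempotentElem.eq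
  have hQs : star Q = Q := hQ.isSelfAdjoint.star_eq
  have hu : IsUnit (1 - (a - star a)) := isUnit_one_sub_of_skewAdjoint (by simp)
  have hQa' : star a * Q = 0 := by simpa [hQs] using congrArg star hQa
  have haQ' : Q * star a = star a := by simpa [hQs] using congrArg star haQ
  set T := Q + a with hT
  have hTs : star T = Q + star a := by rw [hT, star_add, hQs]
  have hTT : T * T = T := by
    rw [hT, add_mul, mul_add, mul_add, hQQ, hQa, haQ]
    have : a * a = 0 := by
      calc a * a = a * Q * a := by rw [haQ]
        _ = 0 := by rw [mul_assoc, hQa, mul_zero]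
    rw [this]; abel
  have hTTs : star T * star T = star T := by rw [← star_mul, hTT]
  set N := T + star T - 1 with hN
  set M := Ring.inverse (1 - (a - star a)) * (2 * Q - 1) with hM
  have hR : (2 * Q - 1) * (2 * Q - 1) = 1 := by
    calc (2 * Q - 1) * (2 * Q - 1) = 4 * (Q * Q) - 4 * Q + 1 := by noncomm_ring
      _ = 1 := by rw [hQQ]; noncomm_ring
  have hNfac : N = (2 * Q - 1) * (1 - (a - star a)) := by
    calc N = 2 * Q - 1 + a + star a := by rw [hN, hTs, hT]; noncomm_ring
      _ = 2 * Q - 1 + a - 2 * (Q * a) + 2 * (Q * star a) - star a := by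
        rw [hQa, haQ']; noncomm_ring
      _ = _ := by noncomm_ring
  have hNM : N * M = 1 := by
    rw [hNfac, hM, mul_assoc, ← mul_assoc (1 - (a - star a)), Ring.mul_inverse_cancel _ hu, one_mul,
      hR]
  have hMN : M * N = 1 := by
    rw [hNfac, hM, mul_assoc, ← mul_assoc (2 * Q - 1), hR, one_mul, Ring.inverse_mul_cancel _ hu]
  have hP : graphProjection Q a = T * M := rfl
  clear_value M N
  have hNs : star N = N := by rw [hN, star_sub, star_add, star_star, star_one, add_comm]
  have hMs : star M = M := by
    calc star M = star M * (N * M) := by rw [hNM, mul_one]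
      _ = star (N * M) * M := by rw [star_mul, hNs, mul_assoc]
      _ = M := by rw [hNM, star_one, one_mul]
  have hNT : N * T = star T * T := by
    rw [hN, sub_mul, add_mul, hTT]; noncomm_ring
  have hTN : star T * N = star T * T := by
    rw [hN, mul_sub, mul_add, hTTs]; noncomm_ring
  have hTM : T * M = M * star T := by
    calc T * M = M * (N * T) * M := by rw [← mul_assoc, hMN, one_mul]
      _ = M * (star T * N) * M := by rw [hNT, hTN]
      _ = M * star T * (N * M) := by noncomm_ring
      _ = M * star T := by rw [hNM, mul_one]
  have hPT : T * M * T = T := by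
    rw [hTM, mul_assoc, ← hNT, ← mul_assoc, hMN, one_mul]
  have hTP : T * (T * M) = T * M := by rw [← mul_assoc, hTT]
  rw [hP]
  refine ⟨⟨?_, ?_⟩, ⟨hPT, hTP, ?_, ?_⟩⟩
  · change T * M * (T * M) = T * M
    rw [← mul_assoc, hPT]
  · change star (T * M) = T * M
    rw [star_mul, hMs, hTM]
  · rw [hT, add_mul, hQQ, haQ]
  · rw [hT, mul_add, hQQ, hQa, add_zero]

end Oblique

section Oblique

variable {H : Type*} [NormedAddCommGroup H] [InnerProductSpace ℂ H] [CompleteSpace H]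

lemma IsStarProjection.mem_orthogonal_range_iff {Q : H →L[ℂ] H} (hQ : IsStarProjection Q) {x : H} :
    x ∈ Q.rangeᗮ ↔ Q x = 0 := by
  have hQs : ContinuousLinearMap.adjoint Q = Q := hQ.isSelfAdjoint.star_eq
  rw [ContinuousLinearMap.orthogonal_range, hQs]
  rfl

/-- Two projections are in general position iff the range of the first is a complement of the
kernel of the second. -/
lemma isCompl_range_orthogonal_iff {P Q : H →L[ℂ] H} (hP : IsStarProjection P)
    (hQ : IsStarProjection Q) :
    IsCompl P.range Q.rangeᗮ ↔ IsUnit (projectionIntertwiner P Q) := by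
  constructor
  · intro h
    have hPcl : IsClosed (P.range : Set H) :=
      ContinuousLinearMap.IsIdempotentElem.isClosed_range hP.isIdempotentElem
    -- Both summands are closed, so the algebraic oblique projection is bounded.
    have hcompl := Submodule.IsCompl.isTopCompl_of_isClosed h hPcl (Submodule.isClosed_orthogonal _)
    let T := P.range.projectionL Q.rangeᗮ hcompl
    refine IsObliqueProjection.isUnit (T := T) hP hQ ⟨?_, ?_, ?_, ?_⟩
    · ext x
      exact hP.apply_of_mem_range (Submodule.projectionL_apply_mem hcompl x)
    · ext x
      exact Submodule.projectionL_apply_left hcompl ⟨P x, x, rfl⟩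
    · ext x
      have h1 : x - Q x ∈ Q.rangeᗮ := by
        rw [hQ.mem_orthogonal_range_iff, map_sub,
          hQ.apply_of_mem_range (x := Q x) ⟨x, rfl⟩, sub_self]
      have h2 : T (x - Q x) = 0 := Submodule.projectionL_apply_right hcompl ⟨_, h1⟩
      rw [map_sub, sub_eq_zero] at h2
      exact h2.symm
    · ext x
      have h1 : x - T x ∈ Q.rangeᗮ := by
        have h2 := Submodule.projectionL_eq_self_sub_projectionL hcompl x
        change Q.rangeᗮ.projectionL P.range hcompl.symm x = x - T x at h2
        rw [← h2]
        exact Submodule.projectionL_apply_mem hcompl.symm x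
      rw [hQ.mem_orthogonal_range_iff, map_sub, sub_eq_zero] at h1
      exact h1.symm
  · intro h
    obtain ⟨h1, h2, h3, h4⟩ := isObliqueProjection_of_isUnit hP.isIdempotentElem
      hQ.isIdempotentElem h
    set T := Ring.inverse (projectionIntertwiner P Q) * Q
    have e1 : ∀ x, P (T x) = T x := fun x => congrArg (fun S : H →L[ℂ] H => S x) h1
    have e2 : ∀ x, T (P x) = P x := fun x => congrArg (fun S : H →L[ℂ] H => S x) h2
    have e3 : ∀ x, T (Q x) = T x := fun x => congrArg (fun S : H →L[ℂ] H => S x) h3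
    have e4 : ∀ x, Q (T x) = Q x := fun x => congrArg (fun S : H →L[ℂ] H => S x) h4
    refine ⟨Submodule.disjoint_def.2 fun x hx hx' => ?_,
      Submodule.codisjoint_iff_exists_add_eq.2 fun x => ⟨T x, x - T x, ⟨T x, e1 x⟩, ?_, by abel⟩⟩
    · rw [hQ.mem_orthogonal_range_iff] at hx'
      rw [← hP.apply_of_mem_range hx, ← e2, hP.apply_of_mem_range hx, ← e3, hx', map_zero]
    · rw [hQ.mem_orthogonal_range_iff, map_sub, e4, sub_self]

end Oblique

/-! ### The manifold structure of the restricted Grassmannian -/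

section SchattenSmooth

variable {p : ℝ} [Fact (p = 0 ∨ 1 < p)] {D E F G X : Type*}
  [NormedAddCommGroup D] [InnerProductSpace ℂ D] [NormedAddCommGroup E] [InnerProductSpace ℂ E]
  [NormedAddCommGroup F] [InnerProductSpace ℂ F] [NormedAddCommGroup G] [InnerProductSpace ℂ G]
  [NormedAddCommGroup X] [NormedSpace ℝ X] {n : WithTop ℕ∞} {x : X}

lemma ContDiffAt.schattenToCLM {T : X → SchattenClass p E F}
    (hT : ContDiffAt ℝ n T x) : ContDiffAt ℝ n (fun y => (T y).toCLM) x :=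
  ((SchattenClass.toCLML p E F).contDiff.restrict_scalars ℝ).contDiffAt.comp x hT

variable [CompleteSpace D] [CompleteSpace E] [CompleteSpace F] [CompleteSpace G]

lemma ContDiffAt.schattenCompL {f : X → F →L[ℂ] G} {T : X → SchattenClass p E F}
    (hf : ContDiffAt ℝ n f x) (hT : ContDiffAt ℝ n T x) :
    ContDiffAt ℝ n (fun y => SchattenClass.compL p E F G (f y) (T y)) x :=
  ((SchattenClass.compL p E F G).isBoundedBilinearMap.contDiff.restrict_scalars
    ℝ).contDiffAt.comp x (hf.prodMk hT)

lemma ContDiffAt.schattenCompR {f : X → D →L[ℂ] E} {T : X → SchattenClass p E F}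
    (hf : ContDiffAt ℝ n f x) (hT : ContDiffAt ℝ n T x) :
    ContDiffAt ℝ n (fun y => SchattenClass.compR p D E F (f y) (T y)) x :=
  ((SchattenClass.compR p D E F).isBoundedBilinearMap.contDiff.restrict_scalars
    ℝ).contDiffAt.comp x (hf.prodMk hT)

lemma ContDiffAt.schattenAdjoint {T : X → SchattenClass p E F}
    (hT : ContDiffAt ℝ n T x) : ContDiffAt ℝ n (fun y => SchattenClass.adjointL p E F (T y)) x :=
  (SchattenClass.adjointL p E F).contDiff.contDiffAt.comp x hT

lemma ContDiffAt.operatorStar {f : X → E →L[ℂ] E} (hf : ContDiffAt ℝ n f x) :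
    ContDiffAt ℝ n (fun y => star (f y)) x :=
  (starL' ℝ : (E →L[ℂ] E) ≃L[ℝ] (E →L[ℂ] E)).contDiff.contDiffAt.comp x hf

lemma ContDiffAt.operatorInverse {f : X → E →L[ℂ] E} (hf : ContDiffAt ℝ n f x)
    (h : IsUnit (f x)) : ContDiffAt ℝ n (fun y => Ring.inverse (f y)) x := by
  obtain ⟨u, hu⟩ := h
  exact ContDiffAt.comp x (hu ▸ contDiffAt_ringInverse ℝ u) hf

/-- Conjugation by unitary operators identifies the Schatten classes of isometric spaces. -/
def SchattenClass.congr (f : D ≃ₗᵢ[ℂ] E) (g : F ≃ₗᵢ[ℂ] G) :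
    SchattenClass p D F ≃L[ℝ] SchattenClass p E G :=
  let a : SchattenClass p D F →L[ℂ] SchattenClass p E G :=
    (SchattenClass.compL p E F G (g : F →L[ℂ] G)).comp
      (SchattenClass.compR p E D F (f.symm : E →L[ℂ] D))
  let b : SchattenClass p E G →L[ℂ] SchattenClass p D F :=
    (SchattenClass.compL p D G F (g.symm : G →L[ℂ] F)).comp
      (SchattenClass.compR p D E G (f : D →L[ℂ] E))
  have hab : Function.LeftInverse b a := fun T => SchattenClass.toCLM_injective (by
    ext x
    change g.symm (g (T.toCLM (f.symm (f x)))) = T.toCLM x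
    simp)
  have hba : Function.RightInverse b a := fun T => SchattenClass.toCLM_injective (by
    ext x
    change g (g.symm (T.toCLM (f (f.symm x)))) = T.toCLM x
    simp)
  ContinuousLinearEquiv.equivOfInverse (a.restrictScalars ℝ) (b.restrictScalars ℝ) hab hba

end SchattenSmooth

/-! ### Graph charts and the atlas of the Grassmannian -/

namespace RestrictedGrassmannian

variable {p : ℝ} {H : Type*} [NormedAddCommGroup H]
  [InnerProductSpace ℂ H] [CompleteSpace H] {Hp : Submodule ℂ H} [CompleteSpace Hp]

lemma isStarProjection (W : RestrictedGrassmannian p Hp) : IsStarProjection W.proj :=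
  W.isRestricted.isStarProjection

instance (W : RestrictedGrassmannian p Hp) : CompleteSpace W.space :=
  W.isStarProjection.completeSpace_range

lemma starProjection_space (W : RestrictedGrassmannian p Hp) : W.space.starProjection = W.proj := by
  have : CompleteSpace W.proj.range := W.isStarProjection.completeSpace_range
  exact W.isStarProjection.eq_starProjection.symm

lemma proj_eq_self (W : RestrictedGrassmannian p Hp) {x : H} (hx : x ∈ W.space) : W.proj x = x :=
  W.isStarProjection.apply_of_mem_range hx

lemma mem_orthogonal_iff (W : RestrictedGrassmannian p Hp) {x : H} :
    x ∈ W.spaceᗮ ↔ W.proj x = 0 :=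
  W.isStarProjection.mem_orthogonal_range_iff

lemma starProjection_orthogonal_apply (W : RestrictedGrassmannian p Hp) (x : H) :
    W.spaceᗮ.starProjection x = x - W.proj x := by
  rw [Submodule.starProjection_orthogonal', W.starProjection_space]
  rfl

lemma self_mem_grassmannianChartDomain (W : RestrictedGrassmannian p Hp) :
    W ∈ grassmannianChartDomain W :=
  Submodule.isCompl_orthogonal W.space

variable [Fact (p = 0 ∨ 1 < p)]

/-- The difference of the orthogonal projections onto `V` and `H₊`, as an operator of class `L^p`. -/
def diff (V : RestrictedGrassmannian p Hp) : SchattenClass p H H :=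
  SchattenClass.mk (V.proj - Hp.starProjection) V.isRestricted.isSchatten_sub

lemma toCLM_diff (V : RestrictedGrassmannian p Hp) :
    V.diff.toCLM = V.proj - Hp.starProjection := rfl

lemma toCLM_diff_sub_diff (V W : RestrictedGrassmannian p Hp) :
    (V.diff - W.diff).toCLM = V.proj - W.proj := by
  rw [SchattenClass.toCLM_sub, toCLM_diff, toCLM_diff]
  abel

lemma diff_injective : Function.Injective (diff : RestrictedGrassmannian p Hp → _) := by
  intro V W h
  have h1 := congrArg SchattenClass.toCLM h
  rw [toCLM_diff, toCLM_diff] at h1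
  exact RestrictedGrassmannian.ext (sub_left_injective h1)

/-- The `L^p` norm of the difference of projectors is used rather than the operator norm, so that
the graph charts become homeomorphisms onto `L^p(W, Wᗮ)`. -/
instance : TopologicalSpace (RestrictedGrassmannian p Hp) := TopologicalSpace.induced diff inferInstance

lemma isInducing_diff : Topology.IsInducing (diff : RestrictedGrassmannian p Hp → _) := ⟨rfl⟩

instance : T2Space (RestrictedGrassmannian p Hp) :=
  T2Space.of_injective_continuous diff_injective isInducing_diff.continuous

/-- The extension of the operator intertwining `P_V` and `P_W` to a function of `P_V - P₊`. -/
def intertwiner (W : RestrictedGrassmannian p Hp) (K : SchattenClass p H H) : H →L[ℂ] H :=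
  1 - (1 - 2 * W.proj) * (K - W.diff).toCLM

lemma intertwiner_diff (W V : RestrictedGrassmannian p Hp) :
    W.intertwiner V.diff = projectionIntertwiner V.proj W.proj := by
  rw [projectionIntertwiner_eq W.isStarProjection.isIdempotentElem, intertwiner,
    toCLM_diff_sub_diff]

/-- The extension of the chart around `W` to a function of `P_V - P₊`. -/
def graphCoordinate (W : RestrictedGrassmannian p Hp) (K : SchattenClass p H H) :
    SchattenClass p W.space W.spaceᗮ :=
  SchattenClass.compR p W.space H W.spaceᗮ W.space.subtypeL (SchattenClass.compL p H H W.spaceᗮ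
    (W.spaceᗮ.orthogonalProjectionOnto ∘L (Ring.inverse (W.intertwiner K) * (1 - 2 * W.proj)))
    (K - W.diff))

/-- An operator `W → Wᗮ` as an operator on `H`. -/
def extend (W : RestrictedGrassmannian p Hp) (A : SchattenClass p W.space W.spaceᗮ) :
    SchattenClass p H H :=
  SchattenClass.compR p H W.space H W.space.orthogonalProjectionOnto
    (SchattenClass.compL p W.space W.spaceᗮ H W.spaceᗮ.subtypeL A)

lemma toCLM_extend_apply (W : RestrictedGrassmannian p Hp) (A : SchattenClass p W.space W.spaceᗮ)
    (x : H) : (W.extend A).toCLM x = A.toCLM ⟨W.proj x, W.proj_mem x⟩ := by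
  have h : W.space.orthogonalProjectionOnto x = ⟨W.proj x, W.proj_mem x⟩ :=
    Subtype.ext (congrArg (fun T : H →L[ℂ] H => T x) W.starProjection_space)
  rw [← h]
  rfl

lemma proj_mul_extend (W : RestrictedGrassmannian p Hp) (A : SchattenClass p W.space W.spaceᗮ) :
    W.proj * (W.extend A).toCLM = 0 := by
  ext x
  change W.proj ((W.extend A).toCLM x) = 0
  rw [toCLM_extend_apply]
  exact W.mem_orthogonal_iff.1 (Subtype.property _)

lemma extend_mul_proj (W : RestrictedGrassmannian p Hp) (A : SchattenClass p W.space W.spaceᗮ) :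
    (W.extend A).toCLM * W.proj = (W.extend A).toCLM := by
  ext x
  change (W.extend A).toCLM (W.proj x) = _
  rw [toCLM_extend_apply, toCLM_extend_apply]
  simp only [W.proj_eq_self (W.proj_mem x)]

/-- `P_V - P_W` for the graph `V` of `A : W → Wᗮ`. -/
def graphDiff (W : RestrictedGrassmannian p Hp) (A : SchattenClass p W.space W.spaceᗮ) :
    SchattenClass p H H :=
  W.extend A + SchattenClass.compL p H H H (W.proj + (W.extend A).toCLM)
    (SchattenClass.compR p H H H
      (Ring.inverse (1 - ((W.extend A).toCLM - star (W.extend A).toCLM)) * (2 * W.proj - 1))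
      (W.extend A - SchattenClass.adjointL p H H (W.extend A)))

lemma toCLM_graphDiff (W : RestrictedGrassmannian p Hp) (A : SchattenClass p W.space W.spaceᗮ) :
    (W.graphDiff A).toCLM = graphProjection W.proj (W.extend A).toCLM - W.proj := by
  rw [graphProjection_sub W.isStarProjection (W.extend_mul_proj A)]
  rfl

/-- The graph of `A : W → Wᗮ`. -/
def ofGraph (W : RestrictedGrassmannian p Hp) (A : SchattenClass p W.space W.spaceᗮ) :
    RestrictedGrassmannian p Hp :=
  ⟨graphProjection W.proj (W.extend A).toCLM, isRestrictedProjector_of_isSchatten_sub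
    (isStarProjection_graphProjection W.isStarProjection (W.proj_mul_extend A)
      (W.extend_mul_proj A)).1 (by
    have h := (W.graphDiff A + W.diff).isSchatten
    rwa [SchattenClass.toCLM_add, toCLM_graphDiff, toCLM_diff, sub_add_sub_cancel] at h)⟩

lemma diff_ofGraph (W : RestrictedGrassmannian p Hp) (A : SchattenClass p W.space W.spaceᗮ) :
    (W.ofGraph A).diff = W.graphDiff A + W.diff := by
  refine SchattenClass.toCLM_injective ?_
  rw [SchattenClass.toCLM_add, toCLM_graphDiff, toCLM_diff, toCLM_diff, sub_add_sub_cancel]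
  rfl

lemma isObliqueProjection_ofGraph (W : RestrictedGrassmannian p Hp)
    (A : SchattenClass p W.space W.spaceᗮ) :
    IsObliqueProjection (W.ofGraph A).proj W.proj (W.proj + (W.extend A).toCLM) :=
  (isStarProjection_graphProjection W.isStarProjection (W.proj_mul_extend A)
    (W.extend_mul_proj A)).2

lemma mem_grassmannianChartDomain_iff (W V : RestrictedGrassmannian p Hp) :
    V ∈ grassmannianChartDomain W ↔ IsUnit (W.intertwiner V.diff) := by
  rw [intertwiner_diff]
  exact isCompl_range_orthogonal_iff V.isStarProjection W.isStarProjection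

/-- With `X` the intertwiner, `(1 - 2 P_W)(P_V - P_W) = 1 - X`, so the defining formula contains
`X⁻¹ - 1`, and on `W` it yields the oblique projection minus the identity. Keeping the factor `P_V -
P_W` in the definition is what makes the coordinate visibly of class `L^p`. -/
lemma coe_toCLM_graphCoordinate (W : RestrictedGrassmannian p Hp)
    {V : RestrictedGrassmannian p Hp} (hV : V ∈ grassmannianChartDomain W) (w : W.space) :
    ((W.graphCoordinate V.diff).toCLM w : H) =
      (Ring.inverse (projectionIntertwiner V.proj W.proj) * W.proj) w - w := by
  have hu := (W.mem_grassmannianChartDomain_iff V).1 hV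
  rw [intertwiner_diff] at hu
  have hobl := isObliqueProjection_of_isUnit V.isStarProjection.isIdempotentElem
    W.isStarProjection.isIdempotentElem hu
  have h1 : ((W.graphCoordinate V.diff).toCLM w : H) = W.spaceᗮ.starProjection
      ((Ring.inverse (W.intertwiner V.diff) * ((1 - 2 * W.proj) * (V.diff - W.diff).toCLM)) w) :=
    rfl
  have h2 : (1 - 2 * W.proj) * (V.diff - W.diff).toCLM = 1 - W.intertwiner V.diff := by
    rw [intertwiner]; abel
  rw [h1, h2, mul_sub, mul_one, intertwiner_diff, Ring.inverse_mul_cancel _ hu,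
    starProjection_orthogonal_apply]
  have hw : W.proj w = w := W.proj_eq_self w.2
  have h3 : W.proj ((Ring.inverse (projectionIntertwiner V.proj W.proj) * W.proj) w) = W.proj w :=
    congrArg (fun T : H →L[ℂ] H => T w) hobl.right_mul
  change W.proj (Ring.inverse (projectionIntertwiner V.proj W.proj) (W.proj w)) = _ at h3
  rw [hw] at h3
  change (Ring.inverse (projectionIntertwiner V.proj W.proj) (w : H) - (w : H)) -
    W.proj (Ring.inverse (projectionIntertwiner V.proj W.proj) (w : H) - (w : H)) =
    Ring.inverse (projectionIntertwiner V.proj W.proj) (W.proj w) - w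
  rw [map_sub, h3, hw]
  abel

lemma extend_graphCoordinate (W : RestrictedGrassmannian p Hp)
    {V : RestrictedGrassmannian p Hp} (hV : V ∈ grassmannianChartDomain W) :
    W.proj + (W.extend (W.graphCoordinate V.diff)).toCLM =
      Ring.inverse (projectionIntertwiner V.proj W.proj) * W.proj := by
  ext x
  change W.proj x + (W.extend (W.graphCoordinate V.diff)).toCLM x = _
  rw [toCLM_extend_apply, coe_toCLM_graphCoordinate W hV]
  change W.proj x + (Ring.inverse (projectionIntertwiner V.proj W.proj) (W.proj (W.proj x)) -
    W.proj x) = Ring.inverse (projectionIntertwiner V.proj W.proj) (W.proj x)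
  rw [W.proj_eq_self (W.proj_mem x)]
  abel

lemma isObliqueProjection_graphCoordinate (W : RestrictedGrassmannian p Hp)
    {V : RestrictedGrassmannian p Hp} (hV : V ∈ grassmannianChartDomain W) :
    IsObliqueProjection V.proj W.proj
      (W.proj + (W.extend (W.graphCoordinate V.diff)).toCLM) := by
  have hu := (W.mem_grassmannianChartDomain_iff V).1 hV
  rw [intertwiner_diff] at hu
  rw [extend_graphCoordinate W hV]
  exact isObliqueProjection_of_isUnit V.isStarProjection.isIdempotentElem
    W.isStarProjection.isIdempotentElem hu

/-- Both subspaces have the same oblique projection along `Wᗮ`, which determines them. -/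
lemma ofGraph_graphCoordinate (W : RestrictedGrassmannian p Hp)
    {V : RestrictedGrassmannian p Hp} (hV : V ∈ grassmannianChartDomain W) :
    W.ofGraph (W.graphCoordinate V.diff) = V :=
  RestrictedGrassmannian.ext (IsObliqueProjection.unique (W.ofGraph _).isStarProjection
    V.isStarProjection (W.isObliqueProjection_ofGraph _) (W.isObliqueProjection_graphCoordinate hV))

lemma ofGraph_mem (W : RestrictedGrassmannian p Hp) (A : SchattenClass p W.space W.spaceᗮ) :
    W.ofGraph A ∈ grassmannianChartDomain W := by
  rw [mem_grassmannianChartDomain_iff, intertwiner_diff]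
  exact (W.isObliqueProjection_ofGraph A).isUnit (W.ofGraph A).isStarProjection W.isStarProjection

lemma graphCoordinate_ofGraph (W : RestrictedGrassmannian p Hp)
    (A : SchattenClass p W.space W.spaceᗮ) : W.graphCoordinate (W.ofGraph A).diff = A := by
  refine SchattenClass.toCLM_injective (ContinuousLinearMap.ext fun w => Subtype.ext ?_)
  rw [coe_toCLM_graphCoordinate W (W.ofGraph_mem A),
    (W.isObliqueProjection_ofGraph A).inverse_mul (W.ofGraph A).isStarProjection W.isStarProjection]
  change W.proj w + (W.extend A).toCLM w - w = A.toCLM w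
  have h : (⟨W.proj w, W.proj_mem w⟩ : W.space) = w := Subtype.ext (W.proj_eq_self w.2)
  rw [toCLM_extend_apply, h, W.proj_eq_self w.2]
  abel

lemma isGrassmannianCoordinate (W : RestrictedGrassmannian p Hp)
    {V : RestrictedGrassmannian p Hp} (hV : V ∈ grassmannianChartDomain W) :
    IsGrassmannianCoordinate W V (W.graphCoordinate V.diff) := by
  intro x hx
  have h1 := congrArg (fun T : H →L[ℂ] H => T x) (W.isObliqueProjection_graphCoordinate hV).mul_left
  change W.proj (V.proj x) + (W.extend (W.graphCoordinate V.diff)).toCLM (V.proj x) = V.proj x at h1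
  rw [V.proj_eq_self hx, toCLM_extend_apply] at h1
  rw [eq_sub_iff_add_eq, add_comm]
  exact h1

lemma contDiff_intertwiner (W : RestrictedGrassmannian p Hp) {n : WithTop ℕ∞} :
    ContDiff ℝ n W.intertwiner := by
  refine contDiff_iff_contDiffAt.2 fun K => ?_
  exact contDiffAt_const.sub (contDiffAt_const.mul
    (contDiffAt_id.sub contDiffAt_const).schattenToCLM)

lemma contDiffAt_graphCoordinate (W : RestrictedGrassmannian p Hp) {n : WithTop ℕ∞}
    {K : SchattenClass p H H} (hK : IsUnit (W.intertwiner K)) :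
    ContDiffAt ℝ n W.graphCoordinate K := by
  refine ContDiffAt.schattenCompR contDiffAt_const (ContDiffAt.schattenCompL ?_
    (contDiffAt_id.sub contDiffAt_const))
  have h1 : ContDiffAt ℝ n (fun K => Ring.inverse (W.intertwiner K) * (1 - 2 * W.proj)) K :=
    (W.contDiff_intertwiner.contDiffAt.operatorInverse hK).mul contDiffAt_const
  exact ((ContinuousLinearMap.compL ℂ H H W.spaceᗮ
    W.spaceᗮ.orthogonalProjectionOnto).contDiff.restrict_scalars ℝ).contDiffAt.comp K h1

lemma contDiff_graphDiff (W : RestrictedGrassmannian p Hp) {n : WithTop ℕ∞} :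
    ContDiff ℝ n W.graphDiff := by
  refine contDiff_iff_contDiffAt.2 fun A => ?_
  have h1 : ContDiffAt ℝ n W.extend A :=
    ContDiffAt.schattenCompR contDiffAt_const (ContDiffAt.schattenCompL contDiffAt_const contDiffAt_id)
  have h2 := h1.schattenToCLM
  refine h1.add (ContDiffAt.schattenCompL (contDiffAt_const.add h2)
    (ContDiffAt.schattenCompR (ContDiffAt.mul ?_ contDiffAt_const) (h1.sub h1.schattenAdjoint)))
  exact (contDiffAt_const.sub (h2.sub h2.operatorStar)).operatorInverse
    (isUnit_one_sub_of_skewAdjoint (by simp))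

/-- The chart around `W` as a bijection. -/
def graphPartialEquiv (W : RestrictedGrassmannian p Hp) :
    PartialEquiv (RestrictedGrassmannian p Hp) (SchattenClass p W.space W.spaceᗮ) where
  toFun V := W.graphCoordinate V.diff
  invFun := W.ofGraph
  source := grassmannianChartDomain W
  target := Set.univ
  map_source' _ _ := Set.mem_univ _
  map_target' A _ := W.ofGraph_mem A
  left_inv' _ hV := W.ofGraph_graphCoordinate hV
  right_inv' A _ := W.graphCoordinate_ofGraph A

lemma exists_graphChart (W : RestrictedGrassmannian p Hp) :
    ∃ φ : OpenPartialHomeomorph (RestrictedGrassmannian p Hp) (SchattenClass p W.space W.spaceᗮ),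
      φ.toPartialEquiv = W.graphPartialEquiv ∧
      IsAdaptedChart 𝓘(ℝ, SchattenClass p H H) diff φ := by
  refine exists_isAdaptedChart isInducing_diff W.graphPartialEquiv isOpen_univ ?_
    (O := {K | IsUnit (W.intertwiner K)}) (f := W.graphCoordinate)
    (Units.isOpen.preimage (W.contDiff_intertwiner (n := 0)).continuous) ?_ ?_ fun V hV => rfl
  · rw [contMDiffOn_iff_contDiffOn]
    have h : diff ∘ W.graphPartialEquiv.symm = fun A => W.graphDiff A + W.diff :=
      funext fun A => W.diff_ofGraph A
    rw [h]
    exact (W.contDiff_graphDiff.add contDiff_const).contDiffOn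
  · rw [contMDiffOn_iff_contDiffOn]
    exact fun K hK => (W.contDiffAt_graphCoordinate hK).contDiffWithinAt
  · ext V
    exact W.mem_grassmannianChartDomain_iff V

/-- The chart around `W`. -/
def graphChart (W : RestrictedGrassmannian p Hp) :
    OpenPartialHomeomorph (RestrictedGrassmannian p Hp) (SchattenClass p W.space W.spaceᗮ) :=
  W.exists_graphChart.choose

lemma isAdaptedChart_graphChart (W : RestrictedGrassmannian p Hp) :
    IsAdaptedChart 𝓘(ℝ, SchattenClass p H H) diff W.graphChart :=
  W.exists_graphChart.choose_spec.2

lemma graphChart_source (W : RestrictedGrassmannian p Hp) :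
    W.graphChart.source = grassmannianChartDomain W :=
  congrArg PartialEquiv.source W.exists_graphChart.choose_spec.1

lemma graphChart_target (W : RestrictedGrassmannian p Hp) : W.graphChart.target = Set.univ :=
  congrArg PartialEquiv.target W.exists_graphChart.choose_spec.1

lemma graphChart_apply (W V : RestrictedGrassmannian p Hp) :
    W.graphChart V = W.graphCoordinate V.diff :=
  congrArg (fun e : PartialEquiv _ _ => e V) W.exists_graphChart.choose_spec.1

variable [Fact (¬ FiniteDimensional ℂ Hp)] [Fact (¬ FiniteDimensional ℂ Hpᗮ)]

/-- A charted space has one model space, whereas the graph charts take values in spaces depending on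
`W`. The Fredholm projections `W → Hp` and `Wᗮ → Hpᗮ` provide isometries, because the targets are
infinite-dimensional. -/
lemma nonempty_schattenClass_equiv (W : RestrictedGrassmannian p Hp) :
    Nonempty (SchattenClass p W.space W.spaceᗮ ≃L[ℝ] SchattenClass p Hp Hpᗮ) := by
  obtain ⟨f⟩ : Nonempty (W.space ≃ₗᵢ[ℂ] Hp) := by
    have : CompleteSpace W.proj.range := W.isStarProjection.completeSpace_range
    exact W.isRestricted.fredholm.nonempty_linearIsometryEquiv Fact.out
  obtain ⟨g⟩ : Nonempty (W.spaceᗮ ≃ₗᵢ[ℂ] Hpᗮ) := by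
    have h : W.spaceᗮ = (1 - W.proj).range := by
      ext x
      rw [mem_orthogonal_iff]
      constructor
      · intro hx
        exact ⟨x, by change x - W.proj x = x; rw [hx, sub_zero]⟩
      · rintro ⟨y, rfl⟩
        change W.proj (y - W.proj y) = 0
        rw [map_sub, W.proj_eq_self (W.proj_mem y), sub_self]
    rw [h]
    have := W.isRestricted.one_sub.isStarProjection.completeSpace_range
    exact W.isRestricted.one_sub.fredholm.nonempty_linearIsometryEquiv Fact.out
  exact ⟨SchattenClass.congr f g⟩

/-- An identification of the model spaces of the charts. -/
def schattenClassEquiv (W : RestrictedGrassmannian p Hp) :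
    SchattenClass p W.space W.spaceᗮ ≃L[ℝ] SchattenClass p Hp Hpᗮ :=
  W.nonempty_schattenClass_equiv.some

instance : ChartedSpace (SchattenClass p Hp Hpᗮ) (RestrictedGrassmannian p Hp) where
  atlas := Set.range fun W : RestrictedGrassmannian p Hp =>
    W.graphChart.transHomeomorph W.schattenClassEquiv.toHomeomorph
  chartAt W := W.graphChart.transHomeomorph W.schattenClassEquiv.toHomeomorph
  mem_chart_source W := by
    change W ∈ W.graphChart.source
    rw [graphChart_source]
    exact W.self_mem_grassmannianChartDomain
  chart_mem_atlas W := ⟨W, rfl⟩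

lemma isAdaptedChart_of_mem_atlas :
    ∀ φ ∈ atlas (SchattenClass p Hp Hpᗮ) (RestrictedGrassmannian p Hp),
      IsAdaptedChart 𝓘(ℝ, SchattenClass p H H) diff φ := by
  rintro _ ⟨W, rfl⟩
  exact W.isAdaptedChart_graphChart.transHomeomorph W.schattenClassEquiv

instance : IsManifold 𝓘(ℝ, SchattenClass p Hp Hpᗮ) ∞ (RestrictedGrassmannian p Hp) :=
  isManifold_of_isAdaptedChart isAdaptedChart_of_mem_atlas

lemma contMDiff_diff : ContMDiff 𝓘(ℝ, SchattenClass p Hp Hpᗮ) 𝓘(ℝ, SchattenClass p H H) ∞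
    (diff : RestrictedGrassmannian p Hp → SchattenClass p H H) :=
  contMDiff_of_isAdaptedChart isAdaptedChart_of_mem_atlas

lemma isSmoothChart_graphChart (W : RestrictedGrassmannian p Hp) :
    IsSmoothChart (E := SchattenClass p Hp Hpᗮ) W.graphChart :=
  W.isAdaptedChart_graphChart.isSmoothChart isInducing_diff isAdaptedChart_of_mem_atlas

lemma contMDiff_proj : ContMDiff 𝓘(ℝ, SchattenClass p Hp Hpᗮ) 𝓘(ℝ, H →L[ℂ] H) ∞
    (proj : RestrictedGrassmannian p Hp → H →L[ℂ] H) := by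
  have h : (proj : RestrictedGrassmannian p Hp → H →L[ℂ] H) =
      (fun K : SchattenClass p H H => K.toCLM + Hp.starProjection) ∘ diff := by
    funext V
    change V.proj = V.diff.toCLM + Hp.starProjection
    rw [toCLM_diff, sub_add_cancel]
  rw [h]
  refine ContMDiff.comp (I' := 𝓘(ℝ, SchattenClass p H H)) ?_ contMDiff_diff
  exact (contDiff_iff_contDiffAt.2 fun K =>
    (contDiffAt_id.schattenToCLM.add contDiffAt_const)).contMDiff

end RestrictedGrassmannian

/-! ### Smooth local cross sections -/

/-! ### Smooth square roots near the unit -/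

section SquareRoot

open Filter Topology

/-- Inverse function theorem for squaring, whose derivative at `1` is multiplication by `2`. The
last clause is local uniqueness of the root. -/
lemma exists_smooth_sqrt (A : Type*) [NormedRing A] [NormedAlgebra ℝ A] [CompleteSpace A] :
    ∃ r : A → A, r 1 = 1 ∧ (∀ᶠ b in 𝓝 1, ContDiffAt ℝ ∞ r b) ∧ (∀ᶠ b in 𝓝 1, r b * r b = b) ∧
      ∀ᶠ x in 𝓝 1, r (x * x) = x := by
  -- Analyticity is used because being of class `ω` at a point propagates to a neighbourhood, unlike
  -- being of class `∞` at a point.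
  have hf : ContDiffAt ℝ ω (fun x : A => x * x) 1 := contDiffAt_id.mul contDiffAt_id
  let e : A ≃L[ℝ] A := ContinuousLinearEquiv.smulLeft (Units.mk0 (2 : ℝ) two_ne_zero)
  have hf' : HasFDerivAt (fun x : A => x * x) (e : A →L[ℝ] A) 1 := by
    have h := (hasFDerivAt_id (𝕜 := ℝ) (1 : A)).mul' (hasFDerivAt_id (𝕜 := ℝ) (1 : A))
    refine h.congr_fderiv ?_
    ext y
    change (1 : A) * y + y * 1 = (2 : ℝ) • y
    rw [one_mul, mul_one, two_smul]
  have hn : (ω : WithTop ℕ∞) ≠ 0 := by simp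
  have h1 : hf.localInverse hf' hn 1 = 1 := by
    have := hf.localInverse_apply_image hf' hn
    simpa using this
  have h2 := hf.to_localInverse hf' hn
  simp only [mul_one] at h2
  refine ⟨hf.localInverse hf' hn, h1, ?_, ?_, ?_⟩
  · filter_upwards [h2.eventually (by simp)] with b hb
    exact hb.of_le le_top
  · have := (hf.hasStrictFDerivAt' hf' hn).eventually_right_inverse
    simp only [mul_one] at this
    exact this
  · exact (hf.hasStrictFDerivAt' hf' hn).eventually_left_inverse

/-- A smooth square root near the unit which respects the involution and a symmetry. -/
lemma exists_smooth_sqrt_star {A : Type*} [CStarAlgebra A] {R : A} (hR : R * R = 1) :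
    ∃ (r : A → A) (N : Set A), IsOpen N ∧ 1 ∈ N ∧ ∀ b ∈ N, ContDiffAt ℝ ∞ r b ∧ IsUnit (r b) ∧
      r b * r b = b ∧ (star b = b → star (r b) = r b) ∧ (R * b = b * R → R * r b = r b * R) := by
  obtain ⟨r, h1, h2, h3, h4⟩ := exists_smooth_sqrt A
  have hc : Tendsto r (𝓝 1) (𝓝 1) := by
    have := h2.self_of_nhds.continuousAt.tendsto
    rwa [h1] at this
  -- For `b` near `1`, `(r b)*` and `R (r b) R` are also near `1`. If `b` has the corresponding
  -- symmetry they are square roots of `b`, so by local uniqueness they equal `r b`.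
  have hs : Tendsto (fun b => star (r b)) (𝓝 1) (𝓝 1) := by
    have := hc.star
    rwa [star_one] at this
  have hr : Tendsto (fun b => R * r b * R) (𝓝 1) (𝓝 1) := by
    have := ((tendsto_const_nhds (x := R)).mul hc).mul (tendsto_const_nhds (x := R))
    rwa [mul_one, hR] at this
  have hu : ∀ᶠ x : A in 𝓝 1, IsUnit x := Units.isOpen.mem_nhds isUnit_one
  obtain ⟨N, hN, hNo, hN1⟩ := eventually_nhds_iff.1
    (h2.and ((hc.eventually hu).and (h3.and ((hs.eventually h4).and (hr.eventually h4)))))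
  refine ⟨r, N, hNo, hN1, fun b hb => ?_⟩
  obtain ⟨k1, k2, k3, k4, k5⟩ := hN b hb
  refine ⟨k1, k2, k3, fun h => ?_, fun h => ?_⟩
  · rw [← star_mul, k3, h] at k4
    exact k4.symm
  · have h5 : R * r b * R * (R * r b * R) = b := by
      calc _ = R * (r b * ((R * R) * (r b * R))) := by simp only [mul_assoc]
        _ = R * (r b * r b) * R := by rw [hR, one_mul]; simp only [mul_assoc]
        _ = b := by rw [k3, h, mul_assoc, hR, mul_one]
    rw [h5] at k5
    nth_rewrite 2 [k5]
    rw [mul_assoc, hR, mul_one]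

end SquareRoot

section SmoothOperators

variable {E H' M : Type*} [NormedAddCommGroup E] [NormedSpace ℝ E] [TopologicalSpace H']
  {I : ModelWithCorners ℝ E H'} [TopologicalSpace M] [ChartedSpace H' M] {s : Set M}
  {K : Type*} [NormedAddCommGroup K] [InnerProductSpace ℂ K] [CompleteSpace K]
  {n : WithTop ℕ∞} {f g : M → K →L[ℂ] K}

lemma ContMDiffOn.operatorMul (hf : ContMDiffOn I 𝓘(ℝ, K →L[ℂ] K) n f s)
    (hg : ContMDiffOn I 𝓘(ℝ, K →L[ℂ] K) n g s) :
    ContMDiffOn I 𝓘(ℝ, K →L[ℂ] K) n (fun x => f x * g x) s :=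
  ContMDiff.comp_contMDiffOn (g := fun x : (K →L[ℂ] K) × (K →L[ℂ] K) => x.1 * x.2)
    (contDiff_fst.mul contDiff_snd).contMDiff (hf.prodMk_space hg)

lemma ContMDiffOn.operatorStar (hf : ContMDiffOn I 𝓘(ℝ, K →L[ℂ] K) n f s) :
    ContMDiffOn I 𝓘(ℝ, K →L[ℂ] K) n (fun x => star (f x)) s :=
  ContMDiff.comp_contMDiffOn (g := fun x : K →L[ℂ] K => star x)
    (contDiff_iff_contDiffAt.2 fun _ => contDiffAt_id.operatorStar).contMDiff hf

lemma ContMDiffOn.operatorInverse (hf : ContMDiffOn I 𝓘(ℝ, K →L[ℂ] K) n f s)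
    (h : ∀ x ∈ s, IsUnit (f x)) :
    ContMDiffOn I 𝓘(ℝ, K →L[ℂ] K) n (fun x => Ring.inverse (f x)) s := fun x hx =>
  (contDiffAt_id.operatorInverse (h x hx)).comp_contMDiffWithinAt (hf x hx)

end SmoothOperators

/-! ### Cross sections by polar decomposition -/

section CrossSection

variable {p : ℝ} [Fact (p = 0 ∨ 1 < p)] {H : Type*} [NormedAddCommGroup H]
  [InnerProductSpace ℂ H] [CompleteSpace H] {Hp : Submodule ℂ H} [CompleteSpace Hp]

lemma IsSmoothCrossSection.mul_starProjection_mul_star {E : Type*} [NormedAddCommGroup E]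
    [NormedSpace ℝ E] [TopologicalSpace (RestrictedGrassmannian p Hp)]
    [ChartedSpace E (RestrictedGrassmannian p Hp)] {Ω : Set (RestrictedGrassmannian p Hp)}
    {σ : RestrictedGrassmannian p Hp → (H →L[ℂ] H)} (h : IsSmoothCrossSection (E := E) Ω σ)
    {V : RestrictedGrassmannian p Hp} (hV : V ∈ Ω) :
    σ V * Hp.starProjection * star (σ V) = V.proj := by
  have hu := h.mem_unitary V hV
  have hm := h.map_eq V hV
  have h1 := Unitary.star_mul_self_of_mem hu
  have h2 := Unitary.mul_star_self_of_mem hu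
  have he : IsStarProjection Hp.starProjection := isStarProjection_starProjection
  refine ContinuousLinearMap.IsStarProjection.ext ⟨?_, ?_⟩ V.isStarProjection ?_
  · change _ * _ = _
    calc _ = σ V * (Hp.starProjection * (star (σ V) * σ V) * Hp.starProjection) * star (σ V) := by
          simp only [mul_assoc]
      _ = _ := by rw [h1, mul_one, he.isIdempotentElem.eq]
  · rw [IsSelfAdjoint, star_mul, star_mul, star_star, he.isSelfAdjoint.star_eq, mul_assoc]
  · change _ = V.space
    rw [← hm]
    ext x
    constructor
    · rintro ⟨y, rfl⟩
      exact ⟨Hp.starProjection (star (σ V) y), Submodule.starProjection_apply_mem _ _, rfl⟩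
    · rintro ⟨y, hy, rfl⟩
      refine ⟨σ V y, ?_⟩
      change σ V (Hp.starProjection ((star (σ V) * σ V) y)) = σ V y
      rw [h1]
      exact congrArg _ (Submodule.starProjection_eq_self_iff.2 hy)

namespace RestrictedGrassmannian

variable [Fact (¬ FiniteDimensional ℂ Hp)] [Fact (¬ FiniteDimensional ℂ Hpᗮ)]

/-- The commutator condition is automatic: `[σ V, P₊] = (P_V - P₊) σ V`, the product of the smooth
`L^p`-valued map `diff` with `σ`. -/
lemma isSmoothCrossSection_of_mul_starProjection {Ω : Set (RestrictedGrassmannian p Hp)}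
    {σ : RestrictedGrassmannian p Hp → (H →L[ℂ] H)} (hΩ : IsOpen Ω)
    (hu : ∀ V ∈ Ω, σ V ∈ unitary (H →L[ℂ] H))
    (hσ : ∀ V ∈ Ω, σ V * Hp.starProjection = V.proj * σ V)
    (hsmooth : ContMDiffOn 𝓘(ℝ, SchattenClass p Hp Hpᗮ) 𝓘(ℝ, H →L[ℂ] H) ∞ σ Ω) :
    IsSmoothCrossSection (E := SchattenClass p Hp Hpᗮ) Ω σ where
  isOpen := hΩ
  mem_unitary := hu
  smooth := hsmooth
  map_eq V hV := by
    have h : ∀ x, σ V (Hp.starProjection x) = V.proj (σ V x) := fun x =>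
      congrArg (fun T : H →L[ℂ] H => T x) (hσ V hV)
    ext x
    constructor
    · rintro ⟨y, hy, rfl⟩
      refine ⟨σ V y, ?_⟩
      change V.proj (σ V y) = σ V y
      rw [← h, Submodule.starProjection_eq_self_iff.2 hy]
    · intro hx
      have h2 : σ V (star (σ V) x) = x :=
        congrArg (fun T : H →L[ℂ] H => T x) (Unitary.mul_star_self_of_mem (hu V hV))
      refine ⟨Hp.starProjection (star (σ V) x), Submodule.starProjection_apply_mem _ _, ?_⟩
      change σ V (Hp.starProjection (star (σ V) x)) = x
      rw [h, h2, V.proj_eq_self hx]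
  smooth_commutator := by
    refine ⟨fun V => SchattenClass.compR p H H H (σ V) V.diff, fun V hV => ?_, ?_⟩
    · change (V.proj - Hp.starProjection) * σ V = _
      rw [hσ V hV, sub_mul]
    · exact ContMDiff.comp_contMDiffOn
        (g := fun x : (H →L[ℂ] H) × SchattenClass p H H => SchattenClass.compR p H H H x.1 x.2)
        (contDiff_iff_contDiffAt.2 fun _ =>
          contDiffAt_fst.schattenCompR contDiffAt_snd).contMDiff
        (hsmooth.prodMk_space contMDiff_diff.contMDiffOn)

/-- The adjoint `X V` of the intertwiner satisfies `X P_W = P_V X` and `X W = 1`. Its polar part `X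
(X* X)^(-1/2)` is unitary and still intertwines, since `X* X` and its root commute with `P_W`.
Multiplying on the right by a fixed unitary that takes `Hp` to `W` gives the section. -/
lemma exists_isSmoothCrossSection (W : RestrictedGrassmannian p Hp) :
    ∃ Ω σ, W ∈ Ω ∧ Ω ⊆ grassmannianChartDomain W ∧
      IsSmoothCrossSection (E := SchattenClass p Hp Hpᗮ) Ω σ := by
  obtain ⟨U, hU, hUW⟩ := W.isRestricted.exists_unitary Fact.out Fact.out
  have hW := W.isStarProjection.isIdempotentElem
  -- Commuting with `P_W` is the same as commuting with the reflection `2 P_W - 1`, whose square is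
  -- `1` as the square-root lemma requires.
  have hR : (2 * W.proj - 1) * (2 * W.proj - 1) = 1 := by
    have : W.proj * W.proj = W.proj := hW.eq
    calc _ = 4 * (W.proj * W.proj) - 4 * W.proj + 1 := by noncomm_ring
      _ = 1 := by rw [this]; noncomm_ring
  obtain ⟨r, N, hN, hN1, hr⟩ := exists_smooth_sqrt_star hR
  let X : RestrictedGrassmannian p Hp → (H →L[ℂ] H) := fun V =>
    star (projectionIntertwiner V.proj W.proj)
  have hXs : ContMDiff 𝓘(ℝ, SchattenClass p Hp Hpᗮ) 𝓘(ℝ, H →L[ℂ] H) ∞ X := by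
    rw [← contMDiffOn_univ]
    refine ContMDiffOn.operatorStar ?_
    have h : ContDiff ℝ ∞ fun P : H →L[ℂ] H => projectionIntertwiner P W.proj :=
      (contDiff_const.mul contDiff_id).add (contDiff_const.mul (contDiff_const.sub contDiff_id))
    exact h.contMDiff.comp_contMDiffOn contMDiff_proj.contMDiffOn
  have hbs : ContMDiff 𝓘(ℝ, SchattenClass p Hp Hpᗮ) 𝓘(ℝ, H →L[ℂ] H) ∞
      fun V => star (X V) * X V := by
    rw [← contMDiffOn_univ]
    exact hXs.contMDiffOn.operatorStar.operatorMul hXs.contMDiffOn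
  have hXW : X W = 1 := by
    change star (projectionIntertwiner W.proj W.proj) = 1
    rw [projectionIntertwiner_eq hW, sub_self, mul_zero, sub_zero, star_one]
  have hXP : ∀ V, X V * W.proj = V.proj * X V := fun V => by
    have := congrArg star (mul_projectionIntertwiner (P := V.proj) hW)
    have h2 := congrArg star (projectionIntertwiner_mul (Q := W.proj)
      V.isStarProjection.isIdempotentElem)
    simp only [star_mul, W.isStarProjection.isSelfAdjoint.star_eq,
      V.isStarProjection.isSelfAdjoint.star_eq] at this h2
    exact this.trans h2.symm
  have hUe : U * Hp.starProjection = W.proj * U := by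
    rw [← hUW, mul_assoc, Unitary.star_mul_self_of_mem hU, mul_one]
  let Ω : Set (RestrictedGrassmannian p Hp) := X ⁻¹' {x | IsUnit x} ∩
    (fun V => star (X V) * X V) ⁻¹' N
  have hΩ : IsOpen Ω := (Units.isOpen.preimage hXs.continuous).inter (hN.preimage hbs.continuous)
  refine ⟨Ω, fun V => X V * Ring.inverse (r (star (X V) * X V)) * U, ?_, ?_,
    isSmoothCrossSection_of_mul_starProjection hΩ ?_ ?_ ?_⟩
  · refine ⟨?_, ?_⟩
    · change IsUnit (X W)
      rw [hXW]; exact isUnit_one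
    · change star (X W) * X W ∈ N
      rwa [hXW, star_one, mul_one]
  · rintro V ⟨hV, -⟩
    rw [mem_grassmannianChartDomain_iff, intertwiner_diff]
    exact isUnit_star.1 hV
  · rintro V ⟨hV, hVN⟩
    obtain ⟨-, h1, h2, h3, -⟩ := hr (star (X V) * X V) hVN
    have h4 : star (r (star (X V) * X V)) = r (star (X V) * X V) := h3 (by simp)
    set b := star (X V) * X V with hb
    have h5 : star (Ring.inverse (r b)) = Ring.inverse (r b) := by
      rw [← Ring.inverse_star, h4]
    have h6 : star (X V * Ring.inverse (r b)) * (X V * Ring.inverse (r b)) = 1 := by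
      rw [star_mul, h5]
      calc _ = Ring.inverse (r b) * b * Ring.inverse (r b) := by rw [hb]; simp only [mul_assoc]
        _ = (Ring.inverse (r b) * r b) * (r b * Ring.inverse (r b)) := by
          rw [mul_assoc _ b, mul_assoc _ (r b), ← mul_assoc (r b) (r b), h2]
        _ = 1 := by rw [Ring.inverse_mul_cancel _ h1, Ring.mul_inverse_cancel _ h1, mul_one]
    -- An invertible isometry is unitary; invertibility of `X V` is part of the definition of `Ω`.
    have h7 : IsUnit (X V * Ring.inverse (r b)) := hV.mul h1.ringInverse
    refine mul_mem (Unitary.mem_iff.2 ⟨h6, ?_⟩) hU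
    obtain ⟨w, hw⟩ := h7
    rw [← hw] at h6 ⊢
    have h8 : star (w : H →L[ℂ] H) = (w⁻¹ : (H →L[ℂ] H)ˣ) := by
      rw [← mul_one (star (w : H →L[ℂ] H)), ← w.mul_inv, ← mul_assoc, h6, one_mul]
    rw [h8, w.mul_inv]
  · rintro V ⟨hV, hVN⟩
    obtain ⟨-, h1, h2, -, h3⟩ := hr (star (X V) * X V) hVN
    set b := star (X V) * X V with hb
    have hbW : W.proj * b = b * W.proj := by
      have h4 := congrArg star (hXP V)
      simp only [star_mul, W.isStarProjection.isSelfAdjoint.star_eq,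
        V.isStarProjection.isSelfAdjoint.star_eq] at h4
      rw [hb, ← mul_assoc, h4, mul_assoc, ← hXP, mul_assoc]
    have h5 : (2 * W.proj - 1) * r b = r b * (2 * W.proj - 1) := by
      refine h3 ?_
      have e1 : (2 * W.proj - 1) * b = 2 * (W.proj * b) - b := by noncomm_ring
      have e2 : b * (2 * W.proj - 1) = 2 * (b * W.proj) - b := by noncomm_ring
      rw [e1, e2, hbW]
    have h6 : W.proj * r b = r b * W.proj := by
      have e1 : (2 * W.proj - 1) * r b = (2 : ℂ) • (W.proj * r b) - r b := by
        rw [two_smul]; noncomm_ring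
      have e2 : r b * (2 * W.proj - 1) = (2 : ℂ) • (r b * W.proj) - r b := by
        rw [two_smul]; noncomm_ring
      rw [e1, e2, sub_left_inj] at h5
      exact smul_right_injective _ (two_ne_zero (α := ℂ)) h5
    have h7 : Ring.inverse (r b) * W.proj = W.proj * Ring.inverse (r b) := by
      calc _ = Ring.inverse (r b) * (W.proj * r b) * Ring.inverse (r b) := by
            rw [mul_assoc, mul_assoc, Ring.mul_inverse_cancel _ h1, mul_one]
        _ = _ := by rw [h6, ← mul_assoc, Ring.inverse_mul_cancel _ h1, one_mul]
    calc _ = X V * Ring.inverse (r b) * (U * Hp.starProjection) := by rw [mul_assoc]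
      _ = X V * (Ring.inverse (r b) * W.proj) * U := by rw [hUe]; simp only [mul_assoc]
      _ = (X V * W.proj) * Ring.inverse (r b) * U := by rw [h7]; simp only [mul_assoc]
      _ = _ := by rw [hXP]; simp only [mul_assoc]
  · refine (hXs.contMDiffOn.operatorMul (ContMDiffOn.operatorInverse ?_ ?_)).operatorMul
      contMDiffOn_const
    · intro V hV
      exact (hr _ hV.2).1.comp_contMDiffWithinAt (f := fun V => star (X V) * X V)
        (hbs.contMDiffOn V hV)
    · exact fun V hV => (hr _ hV.2).2.1

end RestrictedGrassmannian

end CrossSection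

/-! ### Skew-adjoint operators and the Cayley transform -/

section SkewAdjoint

/-- The map `x ↦ (x - x*) / 2`. -/
def skewMap (A : Type*) [CStarAlgebra A] : A →L[ℝ] A :=
  (2⁻¹ : ℝ) • (ContinuousLinearMap.id ℝ A - (starL' ℝ : A ≃L[ℝ] A).toContinuousLinearMap)

lemma skewMap_apply {A : Type*} [CStarAlgebra A] (x : A) :
    skewMap A x = (2⁻¹ : ℝ) • (x - star x) := rfl

lemma skewMap_mem_skewAdjoint {A : Type*} [CStarAlgebra A] (x : A) :
    skewMap A x ∈ skewAdjoint A := by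
  rw [skewMap_apply, skewAdjoint.mem_iff, star_smul, star_sub, star_star, ← smul_neg, neg_sub]
  simp

lemma skewMap_of_mem {A : Type*} [CStarAlgebra A] {x : A} (hx : star x = -x) :
    skewMap A x = x := by
  rw [skewMap_apply, hx, sub_neg_eq_add, ← two_smul ℝ x, smul_smul, inv_mul_cancel₀ two_ne_zero,
    one_smul]

lemma isClosed_skewAdjoint {A : Type*} [CStarAlgebra A] : IsClosed (skewAdjoint A : Set A) := by
  have : (skewAdjoint A : Set A) = {x | star x = -x} := by
    ext x
    exact skewAdjoint.mem_iff
  rw [this]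
  exact isClosed_eq continuous_star continuous_neg

variable {H : Type*} [NormedAddCommGroup H] [InnerProductSpace ℂ H]
  {Hp : Submodule ℂ H} [CompleteSpace Hp]

namespace SkewAdjointOperators

lemma star_toCLM (X : SkewAdjointOperators Hp) : star X.toCLM = -X.toCLM :=
  skewAdjoint.mem_iff.1 X.2

lemma toCLM_injective : Function.Injective (toCLM : SkewAdjointOperators Hp → _) :=
  Subtype.val_injective

instance : CompleteSpace (SkewAdjointOperators Hp) :=
  (isClosed_skewAdjoint (A := Hp →L[ℂ] Hp)).completeSpace_coe

variable (Hp) in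
/-- The inclusion of the skew-adjoint operators. -/
def toCLML : SkewAdjointOperators Hp →L[ℝ] (Hp →L[ℂ] Hp) :=
  LinearMap.mkContinuous
    { toFun := toCLM
      map_add' := fun _ _ => rfl
      map_smul' := fun _ _ => rfl } 1 fun X => (one_mul ‖X‖).ge

variable (Hp) in
/-- The projection `x ↦ (x - x*) / 2` onto the skew-adjoint operators. -/
def skewPart : (Hp →L[ℂ] Hp) →L[ℝ] SkewAdjointOperators Hp :=
  let f : (Hp →L[ℂ] Hp) →ₗ[ℝ] SkewAdjointOperators Hp :=
    { toFun := fun x => ⟨skewMap (Hp →L[ℂ] Hp) x, skewMap_mem_skewAdjoint x⟩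
      map_add' := fun x y => toCLM_injective ((skewMap (Hp →L[ℂ] Hp)).map_add x y)
      map_smul' := fun r x => toCLM_injective ((skewMap (Hp →L[ℂ] Hp)).map_smul r x) }
  ⟨f, (skewMap (Hp →L[ℂ] Hp)).continuous.subtype_mk skewMap_mem_skewAdjoint⟩

/-- The projection onto skew-adjoint operators lets the Cayley coordinate be defined, with values in
the Lie algebra, on an open set of arbitrary operators; on Cayley transforms of unitaries it changes
nothing. -/
lemma toCLM_skewPart {x : Hp →L[ℂ] Hp} (hx : star x = -x) : (skewPart Hp x).toCLM = x :=
  skewMap_of_mem hx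

lemma skewPart_toCLM (X : SkewAdjointOperators Hp) : skewPart Hp X.toCLM = X :=
  toCLM_injective (toCLM_skewPart X.star_toCLM)

end SkewAdjointOperators

/-- The Cayley transform `(v - 1) (v + 1)⁻¹`. -/
def cayley {A : Type*} [Ring A] (v : A) : A := (v - 1) * Ring.inverse (v + 1)

/-- The inverse Cayley transform `(1 + X) (1 - X)⁻¹`. -/
def cayleyInv {A : Type*} [Ring A] (X : A) : A := (1 + X) * Ring.inverse (1 - X)

lemma one_sub_cayley {A : Type*} [Ring A] {v : A} (hv : IsUnit (v + 1)) :
    1 - cayley v = 2 * Ring.inverse (v + 1) := by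
  calc _ = (v + 1) * Ring.inverse (v + 1) - (v - 1) * Ring.inverse (v + 1) := by
        rw [Ring.mul_inverse_cancel _ hv, cayley]
    _ = _ := by noncomm_ring

lemma one_add_cayley {A : Type*} [Ring A] {v : A} (hv : IsUnit (v + 1)) :
    1 + cayley v = v * (2 * Ring.inverse (v + 1)) := by
  calc _ = (v + 1) * Ring.inverse (v + 1) + (v - 1) * Ring.inverse (v + 1) := by
        rw [Ring.mul_inverse_cancel _ hv, cayley]
    _ = _ := by noncomm_ring

variable {A : Type*} [CStarAlgebra A]

/-- For unitary `v`, `(v + 1)* = v* (v + 1)` and `(v - 1)* = -v* (v - 1)`; the factors `v*` cancel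
in the quotient. -/
lemma star_cayley {v : A} (hv : v ∈ unitary A) (h : IsUnit (v + 1)) :
    star (cayley v) = -cayley v := by
  have h1 := Unitary.star_mul_self_of_mem hv
  have h2 := Unitary.mul_star_self_of_mem hv
  have h3 : star (v + 1) = star v * (v + 1) := by
    rw [mul_add, h1, star_add, star_one, mul_one, add_comm]
  have h4 : star (v - 1) = -(star v * (v - 1)) := by
    rw [mul_sub, h1, star_sub, star_one, mul_one, neg_sub]
  have h5 : (v - 1) * Ring.inverse (v + 1) = Ring.inverse (v + 1) * (v - 1) := by
    have : (v + 1) * (v - 1) = (v - 1) * (v + 1) := by noncomm_ring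
    calc _ = Ring.inverse (v + 1) * ((v + 1) * (v - 1)) * Ring.inverse (v + 1) := by
          rw [← mul_assoc, Ring.inverse_mul_cancel _ h, one_mul]
      _ = _ := by rw [this, mul_assoc, mul_assoc, Ring.mul_inverse_cancel _ h, mul_one]
  have h6 : IsUnit (star (v + 1)) := h.star
  have h7 : star (v + 1) * (Ring.inverse (v + 1) * (v - 1)) = star (v - 1) * -1 := by
    rw [h3, mul_assoc, ← mul_assoc (v + 1), Ring.mul_inverse_cancel _ h, one_mul, h4]
    noncomm_ring
  have h8 : star (cayley v) = Ring.inverse (star (v + 1)) * star (v - 1) := by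
    rw [cayley, star_mul, Ring.inverse_star]
  rw [h8, cayley, h5, ← Ring.inverse_mul_cancel_left _ (Ring.inverse (v + 1) * (v - 1)) h6, h7]
  noncomm_ring

lemma cayleyInv_cayley {v : A} (h : IsUnit (v + 1)) : cayleyInv (cayley v) = v := by
  have h2 : IsUnit (2 : A) := by
    have : IsUnit (algebraMap ℂ A 2) := (two_ne_zero (α := ℂ)).isUnit.map _
    rwa [map_ofNat] at this
  rw [cayleyInv, one_add_cayley h, one_sub_cayley h,
    mul_assoc, Ring.mul_inverse_cancel _ (h2.mul h.ringInverse), mul_one]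

/-- The involution exchanges `1 + X` and `1 - X`, which are invertible and commute. -/
lemma cayleyInv_mem_unitary {X : A} (hX : star X = -X) : cayleyInv X ∈ unitary A := by
  have h1 : IsUnit (1 - X) := isUnit_one_sub_of_skewAdjoint hX
  have h2 : IsUnit (1 + X) := by
    have := isUnit_one_sub_of_skewAdjoint (S := -X) (by rw [star_neg, hX])
    rwa [sub_neg_eq_add] at this
  have h3 : star (cayleyInv X) = Ring.inverse (1 + X) * (1 - X) := by
    rw [cayleyInv, star_mul, ← Ring.inverse_star]
    simp [hX, sub_eq_add_neg]
  have hc : (1 - X) * (1 + X) = (1 + X) * (1 - X) := by noncomm_ring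
  rw [Unitary.mem_iff, h3, cayleyInv]
  constructor
  · calc _ = Ring.inverse (1 + X) * ((1 - X) * (1 + X)) * Ring.inverse (1 - X) := by
          simp only [mul_assoc]
      _ = (Ring.inverse (1 + X) * (1 + X)) * ((1 - X) * Ring.inverse (1 - X)) := by
          rw [hc]; simp only [mul_assoc]
      _ = 1 := by rw [Ring.inverse_mul_cancel _ h2, Ring.mul_inverse_cancel _ h1, mul_one]
  · have h4 : Ring.inverse (1 - X) * Ring.inverse (1 + X) =
        Ring.inverse (1 + X) * Ring.inverse (1 - X) := by
      obtain ⟨a, ha⟩ := h1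
      obtain ⟨b, hb⟩ := h2
      rw [← ha, ← hb] at hc ⊢
      have hab : a * b = b * a := Units.ext hc
      rw [Ring.inverse_unit, Ring.inverse_unit, ← Units.val_mul, ← Units.val_mul, ← mul_inv_rev,
        ← mul_inv_rev, hab]
    calc _ = (1 + X) * (Ring.inverse (1 - X) * Ring.inverse (1 + X)) * (1 - X) := by
          simp only [mul_assoc]
      _ = ((1 + X) * Ring.inverse (1 + X)) * (Ring.inverse (1 - X) * (1 - X)) := by
          rw [h4]; simp only [mul_assoc]
      _ = 1 := by rw [Ring.mul_inverse_cancel _ h2, Ring.inverse_mul_cancel _ h1, mul_one]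

lemma isUnit_cayleyInv_add_one {X : A} (hX : star X = -X) : IsUnit (cayleyInv X + 1) ∧
    cayley (cayleyInv X) = X := by
  have h1 : IsUnit (1 - X) := isUnit_one_sub_of_skewAdjoint hX
  have h2 : IsUnit (2 : A) := by
    have : IsUnit (algebraMap ℂ A 2) := (two_ne_zero (α := ℂ)).isUnit.map _
    rwa [map_ofNat] at this
  have h3 : cayleyInv X + 1 = 2 * Ring.inverse (1 - X) := by
    calc _ = (1 + X) * Ring.inverse (1 - X) + (1 - X) * Ring.inverse (1 - X) := by
          rw [Ring.mul_inverse_cancel _ h1, cayleyInv]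
      _ = _ := by noncomm_ring
  have h4 : cayleyInv X - 1 = X * (2 * Ring.inverse (1 - X)) := by
    calc _ = (1 + X) * Ring.inverse (1 - X) - (1 - X) * Ring.inverse (1 - X) := by
          rw [Ring.mul_inverse_cancel _ h1, cayleyInv]
      _ = _ := by noncomm_ring
  have h5 := h2.mul h1.ringInverse
  rw [cayley, h4, h3, mul_assoc, Ring.mul_inverse_cancel _ h5, mul_one]
  exact ⟨h5, rfl⟩

end SkewAdjoint

/-! ### Charts of the set of partial isometries -/

section Corner

variable {H : Type*} [NormedAddCommGroup H] [InnerProductSpace ℂ H]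
  (Hp : Submodule ℂ H) [CompleteSpace Hp]

/-- The compression of an operator to `Hp`. -/
def compress (b : H →L[ℂ] H) : Hp →L[ℂ] Hp := Hp.orthogonalProjectionOnto ∘L b ∘L Hp.subtypeL

/-- The extension of an operator on `Hp` by zero. -/
def dilate (c : Hp →L[ℂ] Hp) : H →L[ℂ] H := Hp.subtypeL ∘L c ∘L Hp.orthogonalProjectionOnto

lemma contDiff_compress {n : WithTop ℕ∞} : ContDiff ℝ n (compress Hp) :=
  (contDiff_const.clm_comp (contDiff_id.clm_comp contDiff_const) : ContDiff ℂ n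
    (fun b : H →L[ℂ] H => Hp.orthogonalProjectionOnto ∘L b ∘L Hp.subtypeL)).restrict_scalars ℝ

lemma contDiff_dilate {n : WithTop ℕ∞} : ContDiff ℝ n (dilate Hp) :=
  (contDiff_const.clm_comp (contDiff_id.clm_comp contDiff_const) : ContDiff ℂ n
    (fun c : Hp →L[ℂ] Hp => Hp.subtypeL ∘L c ∘L Hp.orthogonalProjectionOnto)).restrict_scalars ℝ

variable {Hp}

lemma orthogonalProjectionOnto_coe (y : Hp) : Hp.orthogonalProjectionOnto (y : H) = y := by
  simp

lemma compress_dilate (c : Hp →L[ℂ] Hp) : compress Hp (dilate Hp c) = c := by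
  ext x
  change ((Hp.orthogonalProjectionOnto ((c (Hp.orthogonalProjectionOnto (x : H)) : Hp) : H) : Hp) : H)
    = c x
  rw [orthogonalProjectionOnto_coe, orthogonalProjectionOnto_coe]

lemma dilate_compress (b : H →L[ℂ] H) :
    dilate Hp (compress Hp b) = Hp.starProjection * b * Hp.starProjection := rfl

lemma dilate_one : dilate Hp 1 = Hp.starProjection := rfl

lemma dilate_mul (c d : Hp →L[ℂ] Hp) : dilate Hp (c * d) = dilate Hp c * dilate Hp d := by
  ext x
  change ((c (d (Hp.orthogonalProjectionOnto x)) : Hp) : H) =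
    c (Hp.orthogonalProjectionOnto ((d (Hp.orthogonalProjectionOnto x) : Hp) : H))
  rw [orthogonalProjectionOnto_coe]

lemma dilate_injective : Function.Injective (dilate Hp) :=
  Function.LeftInverse.injective compress_dilate

variable [CompleteSpace H]

lemma star_dilate (c : Hp →L[ℂ] Hp) : star (dilate Hp c) = dilate Hp (star c) := by
  change ContinuousLinearMap.adjoint (Hp.subtypeL ∘L c ∘L Hp.orthogonalProjectionOnto) =
    Hp.subtypeL ∘L ContinuousLinearMap.adjoint c ∘L Hp.orthogonalProjectionOnto
  rw [ContinuousLinearMap.adjoint_comp, ContinuousLinearMap.adjoint_comp,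
    Submodule.adjoint_subtypeL, Submodule.adjoint_orthogonalProjectionOnto]
  rfl

lemma compress_mem_unitary {b : H →L[ℂ] H} (h1 : star b * b = Hp.starProjection)
    (h2 : b * star b = Hp.starProjection) (h3 : b * star b * b = b) :
    compress Hp b ∈ unitary (Hp →L[ℂ] Hp) ∧ dilate Hp (compress Hp b) = b := by
  have h4 : dilate Hp (compress Hp b) = b := by
    rw [dilate_compress, ← h2, h3, h2, ← h1, ← mul_assoc, h3]
  refine ⟨Unitary.mem_iff.2 ⟨dilate_injective ?_, dilate_injective ?_⟩, h4⟩
  · rw [dilate_mul, ← star_dilate, h4, h1, dilate_one]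
  · rw [dilate_mul, ← star_dilate, h4, h2, dilate_one]

/-- With `s = u* u`, the C*-square of `u u* u - u` is `s³ - 2 s² + s`, which vanishes for an
idempotent. -/
lemma IsPartialIsometry.mul_star_mul {u : H →L[ℂ] H} (hu : IsPartialIsometry u) :
    u * star u * u = u := by
  have h : star u * u * (star u * u) = star u * u := hu.isIdempotentElem
  have h1 : star (u * star u * u - u) * (u * star u * u - u) = 0 := by
    calc _ = star u * u * (star u * u) * (star u * u) - star u * u * (star u * u)
          - star u * u * (star u * u) + star u * u := by
          simp only [star_sub, star_mul, star_star]; noncomm_ring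
      _ = 0 := by rw [h, h]; noncomm_ring
  exact sub_eq_zero.1 ((CStarRing.star_mul_self_eq_zero_iff _).1 h1)

end Corner

namespace RestrictedPartialIsometry

open RestrictedGrassmannian

variable {p : ℝ} {H : Type*} [NormedAddCommGroup H]
  [InnerProductSpace ℂ H] [CompleteSpace H] {Hp : Submodule ℂ H} [CompleteSpace Hp]

/-- A partial isometry together with its target and its source. -/
def toProd (u : RestrictedPartialIsometry p Hp) :
    (H →L[ℂ] H) × RestrictedGrassmannian p Hp × RestrictedGrassmannian p Hp :=
  (u.toCLM, u.target, u.source)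

lemma toProd_injective : Function.Injective (toProd : RestrictedPartialIsometry p Hp → _) :=
  fun _ _ h => RestrictedPartialIsometry.ext (congrArg Prod.fst h)

variable [Fact (p = 0 ∨ 1 < p)]

/-- Source and target are recorded separately because they carry the `L^p` topology, which the
operator norm of `u` does not see. -/
instance : TopologicalSpace (RestrictedPartialIsometry p Hp) :=
  TopologicalSpace.induced toProd inferInstance

lemma isInducing_toProd : Topology.IsInducing (toProd : RestrictedPartialIsometry p Hp → _) := ⟨rfl⟩

instance : T2Space (RestrictedPartialIsometry p Hp) :=
  T2Space.of_injective_continuous toProd_injective isInducing_toProd.continuous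

section Algebra

variable {E : Type*} [NormedAddCommGroup E] [NormedSpace ℝ E]
  [ChartedSpace E (RestrictedGrassmannian p Hp)] {Ω Ω' : Set (RestrictedGrassmannian p Hp)}
  {σ σ' : RestrictedGrassmannian p Hp → (H →L[ℂ] H)}

/-- Conjugating by the unitaries at target and source turns both the initial and the final projector
of `u` into `P₊`, so only a unitary of `Hp` is left. This is the local trivialisation of the
groupoid. -/
lemma transportToHp_mem_unitary (hσ : IsSmoothCrossSection (E := E) Ω σ)
    (hσ' : IsSmoothCrossSection (E := E) Ω' σ') {u : RestrictedPartialIsometry p Hp}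
    (ht : u.target ∈ Ω) (hs : u.source ∈ Ω') :
    transportToHp σ σ' u ∈ unitary (Hp →L[ℂ] Hp) ∧
      u.toCLM = σ u.target * dilate Hp (transportToHp σ σ' u) * star (σ' u.source) := by
  have e1 : u.toCLM * star u.toCLM = σ u.target * Hp.starProjection * star (σ u.target) :=
    (hσ.mul_starProjection_mul_star ht).symm
  have e2 : star u.toCLM * u.toCLM = σ' u.source * Hp.starProjection * star (σ' u.source) :=
    (hσ'.mul_starProjection_mul_star hs).symm
  have e3 := u.isPartialIsometry.mul_star_mul
  have a1 := Unitary.star_mul_self_of_mem (hσ.mem_unitary _ ht)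
  have a2 := Unitary.mul_star_self_of_mem (hσ.mem_unitary _ ht)
  have b1 := Unitary.star_mul_self_of_mem (hσ'.mem_unitary _ hs)
  have b2 := Unitary.mul_star_self_of_mem (hσ'.mem_unitary _ hs)
  have h : transportToHp σ σ' u = compress Hp (star (σ u.target) * u.toCLM * σ' u.source) := rfl
  rw [h]
  generalize σ u.target = a at *
  generalize σ' u.source = b at *
  generalize u.toCLM = x at *
  have k := compress_mem_unitary (Hp := Hp) (b := star a * x * b) ?_ ?_ ?_
  · refine ⟨k.1, ?_⟩
    rw [k.2]
    calc x = (a * star a) * x * (b * star b) := by rw [a2, b2, one_mul, mul_one]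
      _ = _ := by simp only [mul_assoc]
  · calc _ = star b * (star x * (a * star a) * x) * b := by
          simp only [star_mul, star_star, mul_assoc]
      _ = (star b * b) * Hp.starProjection * (star b * b) := by
          rw [a2, mul_one, e2]; simp only [mul_assoc]
      _ = _ := by rw [b1, one_mul, mul_one]
  · calc _ = star a * (x * (b * star b) * star x) * a := by
          simp only [star_mul, star_star, mul_assoc]
      _ = (star a * a) * Hp.starProjection * (star a * a) := by
          rw [b2, mul_one, e1]; simp only [mul_assoc]
      _ = _ := by rw [a1, one_mul, mul_one]
  · calc _ = star a * (x * (b * star b) * star x * (a * star a) * x) * b := by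
          simp only [star_mul, star_star, mul_assoc]
      _ = _ := by rw [a2, b2, mul_one, mul_one, e3]

/-- Surjectivity of the trivialisation: the witness is `σ(V) c σ'(V')*`, with `c` extended by zero.
-/
lemma exists_transportToHp_eq (hσ : IsSmoothCrossSection (E := E) Ω σ)
    (hσ' : IsSmoothCrossSection (E := E) Ω' σ') {V V' : RestrictedGrassmannian p Hp}
    (hV : V ∈ Ω) (hV' : V' ∈ Ω') {c : Hp →L[ℂ] Hp} (hc : c ∈ unitary (Hp →L[ℂ] Hp)) :
    ∃ u : RestrictedPartialIsometry p Hp, u.target = V ∧ u.source = V' ∧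
      transportToHp σ σ' u = c := by
  have e1 := hσ.mul_starProjection_mul_star hV
  have e2 := hσ'.mul_starProjection_mul_star hV'
  have a1 := Unitary.star_mul_self_of_mem (hσ.mem_unitary _ hV)
  have b1 := Unitary.star_mul_self_of_mem (hσ'.mem_unitary _ hV')
  have h1 : (σ V * dilate Hp c * star (σ' V')) * star (σ V * dilate Hp c * star (σ' V')) =
      V.proj := by
    calc _ = σ V * (dilate Hp c * (star (σ' V') * σ' V') * star (dilate Hp c)) * star (σ V) := by
          simp only [star_mul, star_star, mul_assoc]
      _ = _ := by
        rw [b1, mul_one, star_dilate, ← dilate_mul, Unitary.mul_star_self_of_mem hc, dilate_one, e1]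
  have h2 : star (σ V * dilate Hp c * star (σ' V')) * (σ V * dilate Hp c * star (σ' V')) =
      V'.proj := by
    calc _ = σ' V' * (star (dilate Hp c) * (star (σ V) * σ V) * dilate Hp c) * star (σ' V') := by
          simp only [star_mul, star_star, mul_assoc]
      _ = _ := by
        rw [a1, mul_one, star_dilate, ← dilate_mul, Unitary.star_mul_self_of_mem hc, dilate_one, e2]
  let u : RestrictedPartialIsometry p Hp := ⟨σ V * dilate Hp c * star (σ' V'),
    by rw [IsPartialIsometry, h2]; exact V'.isStarProjection, h2 ▸ V'.isRestricted,
    h1 ▸ V.isRestricted⟩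
  have ht : u.target = V := RestrictedGrassmannian.ext h1
  have hs : u.source = V' := RestrictedGrassmannian.ext h2
  refine ⟨u, ht, hs, ?_⟩
  have h3 : transportToHp σ σ' u =
      compress Hp (star (σ u.target) * (σ V * dilate Hp c * star (σ' V')) * σ' u.source) := rfl
  have h4 : star (σ V) * (σ V * dilate Hp c * star (σ' V')) * σ' V' = dilate Hp c := by
    calc _ = (star (σ V) * σ V) * dilate Hp c * (star (σ' V') * σ' V') := by simp only [mul_assoc]
      _ = _ := by rw [a1, b1, one_mul, mul_one]
  rw [h3, ht, hs, h4, compress_dilate]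

end Algebra

end RestrictedPartialIsometry

section SkewAdjoint

variable {H : Type*} [NormedAddCommGroup H] [InnerProductSpace ℂ H]
  (Hp : Submodule ℂ H) [CompleteSpace Hp]

namespace SkewAdjointOperators

lemma contDiff_skewPart {n : WithTop ℕ∞} : ContDiff ℝ n (skewPart Hp) :=
  ContinuousLinearMap.contDiff (𝕜 := ℝ) (E := Hp →L[ℂ] Hp) (F := SkewAdjointOperators Hp) _

lemma contDiff_toCLM {n : WithTop ℕ∞} : ContDiff ℝ n (toCLM : SkewAdjointOperators Hp → _) :=
  ContinuousLinearMap.contDiff (𝕜 := ℝ) (E := SkewAdjointOperators Hp) (F := Hp →L[ℂ] Hp)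
    (toCLML Hp)

end SkewAdjointOperators

end SkewAdjoint

namespace RestrictedPartialIsometry

open RestrictedGrassmannian

variable {p : ℝ} {H : Type*} [NormedAddCommGroup H]
  [InnerProductSpace ℂ H] [CompleteSpace H] {Hp : Submodule ℂ H} [CompleteSpace Hp]

section GroupoidChart

variable (W W' : RestrictedGrassmannian p Hp) (Ω Ω' : Set (RestrictedGrassmannian p Hp))
  (σ σ' : RestrictedGrassmannian p Hp → (H →L[ℂ] H)) (g : unitary (Hp →L[ℂ] Hp))

/-- The argument of the Cayley transform in the chart, as a function of a partial isometry, its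
target and its source. -/
def chartTransport (x : (H →L[ℂ] H) × RestrictedGrassmannian p Hp × RestrictedGrassmannian p Hp) :
    Hp →L[ℂ] Hp :=
  star (g : Hp →L[ℂ] Hp) * compress Hp (star (σ x.2.1) * x.1 * σ' x.2.2)

lemma chartTransport_toProd (u : RestrictedPartialIsometry p Hp) :
    chartTransport σ σ' g u.toProd = star (g : Hp →L[ℂ] Hp) * transportToHp σ σ' u := rfl

variable [Fact (p = 0 ∨ 1 < p)] [Fact (¬ FiniteDimensional ℂ Hp)]
  [Fact (¬ FiniteDimensional ℂ Hpᗮ)]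

/-- The coordinates, as a function of a partial isometry, its target and its source. -/
def chartFun (x : (H →L[ℂ] H) × RestrictedGrassmannian p Hp × RestrictedGrassmannian p Hp) :
    SchattenClass p W.space W.spaceᗮ × SchattenClass p W'.space W'.spaceᗮ ×
      SkewAdjointOperators Hp :=
  (W.graphChart x.2.1, W'.graphChart x.2.2,
    SkewAdjointOperators.skewPart Hp (cayley (chartTransport σ σ' g x)))

/-- The partial isometry with given coordinates. -/
def chartInv (z : SchattenClass p W.space W.spaceᗮ × SchattenClass p W'.space W'.spaceᗮ ×
    SkewAdjointOperators Hp) : H →L[ℂ] H :=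
  σ (W.graphChart.symm z.1) * dilate Hp (g * cayleyInv z.2.2.toCLM) *
    star (σ' (W'.graphChart.symm z.2.1))

variable {W W' Ω Ω' σ σ'}

lemma contMDiffOn_chartTransport
    (hσ : IsSmoothCrossSection (E := SchattenClass p Hp Hpᗮ) Ω σ)
    (hσ' : IsSmoothCrossSection (E := SchattenClass p Hp Hpᗮ) Ω' σ') :
    ContMDiffOn (𝓘(ℝ, H →L[ℂ] H).prod
      (𝓘(ℝ, SchattenClass p Hp Hpᗮ).prod 𝓘(ℝ, SchattenClass p Hp Hpᗮ))) 𝓘(ℝ, Hp →L[ℂ] Hp) ∞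
      (chartTransport σ σ' g) {x | x.2.1 ∈ Ω ∧ x.2.2 ∈ Ω'} := by
  refine contMDiffOn_const.operatorMul ?_
  refine (contDiff_compress Hp).contMDiff.comp_contMDiffOn ?_
  refine (ContMDiffOn.operatorMul (ContMDiffOn.operatorStar ?_) contMDiffOn_fst).operatorMul ?_
  · exact hσ.smooth.comp (contMDiff_fst.comp contMDiff_snd).contMDiffOn fun x hx => hx.1
  · exact hσ'.smooth.comp (contMDiff_snd.comp contMDiff_snd).contMDiffOn fun x hx => hx.2

lemma isOpen_chartDomain
    (hσ : IsSmoothCrossSection (E := SchattenClass p Hp Hpᗮ) Ω σ)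
    (hσ' : IsSmoothCrossSection (E := SchattenClass p Hp Hpᗮ) Ω' σ') :
    IsOpen ({x : (H →L[ℂ] H) × RestrictedGrassmannian p Hp × RestrictedGrassmannian p Hp |
      x.2.1 ∈ Ω ∧ x.2.2 ∈ Ω'} ∩ (chartTransport σ σ' g) ⁻¹' {c | IsUnit (c + 1)}) := by
  have hu : IsOpen {c : Hp →L[ℂ] Hp | IsUnit (c + 1)} :=
    (Units.isOpen (R := Hp →L[ℂ] Hp)).preimage (f := fun c : Hp →L[ℂ] Hp => c + 1)
      (continuous_id.add continuous_const)
  refine (contMDiffOn_chartTransport g hσ hσ').continuousOn.isOpen_inter_preimage ?_ hu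
  exact (hσ.isOpen.preimage (continuous_fst.comp continuous_snd)).inter
    (hσ'.isOpen.preimage (continuous_snd.comp continuous_snd))

lemma contMDiffOn_chartFun (hΩ : Ω ⊆ grassmannianChartDomain W)
    (hΩ' : Ω' ⊆ grassmannianChartDomain W')
    (hσ : IsSmoothCrossSection (E := SchattenClass p Hp Hpᗮ) Ω σ)
    (hσ' : IsSmoothCrossSection (E := SchattenClass p Hp Hpᗮ) Ω' σ') :
    ContMDiffOn (𝓘(ℝ, H →L[ℂ] H).prod
      (𝓘(ℝ, SchattenClass p Hp Hpᗮ).prod 𝓘(ℝ, SchattenClass p Hp Hpᗮ)))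
      𝓘(ℝ, SchattenClass p W.space W.spaceᗮ × SchattenClass p W'.space W'.spaceᗮ ×
        SkewAdjointOperators Hp) ∞ (chartFun W W' σ σ' g)
      ({x | x.2.1 ∈ Ω ∧ x.2.2 ∈ Ω'} ∩ (chartTransport σ σ' g) ⁻¹' {c | IsUnit (c + 1)}) := by
  have h := (contMDiffOn_chartTransport g hσ hσ').mono (Set.inter_subset_left
    (t := (chartTransport σ σ' g) ⁻¹' {c | IsUnit (c + 1)}))
  refine ContMDiffOn.prodMk_space ?_ (ContMDiffOn.prodMk_space ?_ ?_)
  · refine W.isSmoothChart_graphChart.1.comp (contMDiff_fst.comp contMDiff_snd).contMDiffOn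
      fun x hx => ?_
    rw [Set.mem_preimage, graphChart_source]
    exact hΩ hx.1.1
  · refine W'.isSmoothChart_graphChart.1.comp (contMDiff_snd.comp contMDiff_snd).contMDiffOn
      fun x hx => ?_
    rw [Set.mem_preimage, graphChart_source]
    exact hΩ' hx.1.2
  · refine (SkewAdjointOperators.contDiff_skewPart Hp).contMDiff.comp_contMDiffOn ?_
    exact (h.sub contMDiffOn_const).operatorMul
      ((h.add contMDiffOn_const).operatorInverse fun x hx => hx.2)

lemma contMDiffOn_chartInv (hσ : IsSmoothCrossSection (E := SchattenClass p Hp Hpᗮ) Ω σ)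
    (hσ' : IsSmoothCrossSection (E := SchattenClass p Hp Hpᗮ) Ω' σ') :
    ContMDiffOn 𝓘(ℝ, SchattenClass p W.space W.spaceᗮ × SchattenClass p W'.space W'.spaceᗮ ×
        SkewAdjointOperators Hp) (𝓘(ℝ, H →L[ℂ] H).prod
      (𝓘(ℝ, SchattenClass p Hp Hpᗮ).prod 𝓘(ℝ, SchattenClass p Hp Hpᗮ))) ∞
      (fun z => (chartInv W W' σ σ' g z, W.graphChart.symm z.1, W'.graphChart.symm z.2.1))
      {z | W.graphChart.symm z.1 ∈ Ω ∧ W'.graphChart.symm z.2.1 ∈ Ω'} := by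
  have h1 : ContMDiff 𝓘(ℝ, SchattenClass p W.space W.spaceᗮ × SchattenClass p W'.space W'.spaceᗮ ×
      SkewAdjointOperators Hp) 𝓘(ℝ, SchattenClass p Hp Hpᗮ) ∞
      (fun z : SchattenClass p W.space W.spaceᗮ × SchattenClass p W'.space W'.spaceᗮ ×
        SkewAdjointOperators Hp => W.graphChart.symm z.1) := by
    have h := W.isSmoothChart_graphChart.2
    rw [graphChart_target, contMDiffOn_univ] at h
    exact h.comp contDiff_fst.contMDiff
  have h2 : ContMDiff 𝓘(ℝ, SchattenClass p W.space W.spaceᗮ × SchattenClass p W'.space W'.spaceᗮ ×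
      SkewAdjointOperators Hp) 𝓘(ℝ, SchattenClass p Hp Hpᗮ) ∞
      (fun z : SchattenClass p W.space W.spaceᗮ × SchattenClass p W'.space W'.spaceᗮ ×
        SkewAdjointOperators Hp => W'.graphChart.symm z.2.1) := by
    have h := W'.isSmoothChart_graphChart.2
    rw [graphChart_target, contMDiffOn_univ] at h
    exact h.comp (contDiff_fst.comp contDiff_snd).contMDiff
  have h3 : ContMDiff 𝓘(ℝ, SchattenClass p W.space W.spaceᗮ × SchattenClass p W'.space W'.spaceᗮ ×
      SkewAdjointOperators Hp) 𝓘(ℝ, Hp →L[ℂ] Hp) ∞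
      (fun z : SchattenClass p W.space W.spaceᗮ × SchattenClass p W'.space W'.spaceᗮ ×
        SkewAdjointOperators Hp => z.2.2.toCLM) :=
    ((SkewAdjointOperators.contDiff_toCLM Hp).comp (contDiff_snd.comp contDiff_snd)).contMDiff
  refine ContMDiffOn.prodMk ?_ (h1.contMDiffOn.prodMk h2.contMDiffOn)
  refine (ContMDiffOn.operatorMul ?_ ?_).operatorMul (ContMDiffOn.operatorStar ?_)
  · exact hσ.smooth.comp h1.contMDiffOn fun z hz => hz.1
  · refine (contDiff_dilate Hp).contMDiff.comp_contMDiffOn (contMDiffOn_const.operatorMul ?_)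
    exact (contMDiffOn_const.add h3.contMDiffOn).operatorMul
      ((contMDiffOn_const.sub h3.contMDiffOn).operatorInverse fun z _ =>
        isUnit_one_sub_of_skewAdjoint (A := Hp →L[ℂ] Hp) z.2.2.star_toCLM)
  · exact hσ'.smooth.comp h2.contMDiffOn fun z hz => hz.2

lemma toCLM_eq_chartInv (hΩ : Ω ⊆ grassmannianChartDomain W)
    (hΩ' : Ω' ⊆ grassmannianChartDomain W')
    (hσ : IsSmoothCrossSection (E := SchattenClass p Hp Hpᗮ) Ω σ)
    (hσ' : IsSmoothCrossSection (E := SchattenClass p Hp Hpᗮ) Ω' σ')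
    {u : RestrictedPartialIsometry p Hp} (hu : u ∈ groupoidChartDomain Ω Ω' σ σ' g) :
    (chartFun W W' σ σ' g u.toProd).2.2.toCLM = cayley (chartTransport σ σ' g u.toProd) ∧
    W.graphChart.symm (chartFun W W' σ σ' g u.toProd).1 = u.target ∧
    W'.graphChart.symm (chartFun W W' σ σ' g u.toProd).2.1 = u.source ∧
    chartInv W W' σ σ' g (chartFun W W' σ σ' g u.toProd) = u.toCLM := by
  obtain ⟨ht, hs, hc⟩ := hu
  obtain ⟨h1, h2⟩ := transportToHp_mem_unitary hσ hσ' ht hs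
  have h3 : star (g : Hp →L[ℂ] Hp) * transportToHp σ σ' u ∈ unitary (Hp →L[ℂ] Hp) :=
    mul_mem (Unitary.star_mem g.2) h1
  have h4 : (chartFun W W' σ σ' g u.toProd).2.2.toCLM = cayley (chartTransport σ σ' g u.toProd) :=
    SkewAdjointOperators.toCLM_skewPart (star_cayley (A := Hp →L[ℂ] Hp) h3 hc)
  have h5 : W.graphChart.symm (chartFun W W' σ σ' g u.toProd).1 = u.target :=
    W.graphChart.left_inv (by rw [graphChart_source]; exact hΩ ht)
  have h6 : W'.graphChart.symm (chartFun W W' σ σ' g u.toProd).2.1 = u.source :=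
    W'.graphChart.left_inv (by rw [graphChart_source]; exact hΩ' hs)
  refine ⟨h4, h5, h6, ?_⟩
  rw [chartInv, h4, h5, h6, chartTransport_toProd, cayleyInv_cayley (A := Hp →L[ℂ] Hp) hc, ← mul_assoc,
    Unitary.mul_star_self_of_mem g.2, one_mul, ← h2]

lemma bijOn_chartFun (hΩ : Ω ⊆ grassmannianChartDomain W)
    (hΩ' : Ω' ⊆ grassmannianChartDomain W')
    (hσ : IsSmoothCrossSection (E := SchattenClass p Hp Hpᗮ) Ω σ)
    (hσ' : IsSmoothCrossSection (E := SchattenClass p Hp Hpᗮ) Ω' σ') :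
    Set.BijOn (fun u : RestrictedPartialIsometry p Hp => chartFun W W' σ σ' g u.toProd)
      (groupoidChartDomain Ω Ω' σ σ' g)
      {z | W.graphChart.symm z.1 ∈ Ω ∧ W'.graphChart.symm z.2.1 ∈ Ω'} := by
  refine ⟨fun u hu => ?_, fun u hu v hv huv => ?_, fun z hz => ?_⟩
  · obtain ⟨-, h1, h2, -⟩ := toCLM_eq_chartInv g hΩ hΩ' hσ hσ' hu
    exact ⟨h1 ▸ hu.1, h2 ▸ hu.2.1⟩
  · have h1 := (toCLM_eq_chartInv g hΩ hΩ' hσ hσ' hu).2.2.2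
    have h2 := (toCLM_eq_chartInv g hΩ hΩ' hσ hσ' hv).2.2.2
    refine RestrictedPartialIsometry.ext ?_
    rw [← h1, ← h2]
    exact congrArg _ huv
  · have hX := z.2.2.star_toCLM
    obtain ⟨u, h1, h2, h3⟩ := exists_transportToHp_eq hσ hσ' hz.1 hz.2
      (mul_mem g.2 (cayleyInv_mem_unitary (A := Hp →L[ℂ] Hp) hX))
    have h4 : chartTransport σ σ' g u.toProd = cayleyInv z.2.2.toCLM := by
      rw [chartTransport_toProd, h3, ← mul_assoc, Unitary.star_mul_self_of_mem g.2, one_mul]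
    obtain ⟨h5, h6⟩ := isUnit_cayleyInv_add_one (A := Hp →L[ℂ] Hp) hX
    refine ⟨u, ⟨h1 ▸ hz.1, h2 ▸ hz.2, ?_⟩, ?_⟩
    · rw [← chartTransport_toProd, h4]
      exact h5
    · refine Prod.ext ?_ (Prod.ext ?_ ?_)
      · change W.graphChart u.target = z.1
        rw [h1]
        exact W.graphChart.right_inv (by rw [graphChart_target]; trivial)
      · change W'.graphChart u.source = z.2.1
        rw [h2]
        exact W'.graphChart.right_inv (by rw [graphChart_target]; trivial)
      · change SkewAdjointOperators.skewPart Hp (cayley (chartTransport σ σ' g u.toProd)) = z.2.2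
        rw [h4, h6, SkewAdjointOperators.skewPart_toCLM]

lemma exists_groupoidChart (hΩ : Ω ⊆ grassmannianChartDomain W)
    (hΩ' : Ω' ⊆ grassmannianChartDomain W')
    (hσ : IsSmoothCrossSection (E := SchattenClass p Hp Hpᗮ) Ω σ)
    (hσ' : IsSmoothCrossSection (E := SchattenClass p Hp Hpᗮ) Ω' σ') :
    ∃ Φ : OpenPartialHomeomorph (RestrictedPartialIsometry p Hp)
        (SchattenClass p W.space W.spaceᗮ × SchattenClass p W'.space W'.spaceᗮ ×
          SkewAdjointOperators Hp),
      Φ.source = groupoidChartDomain Ω Ω' σ σ' g ∧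
      (∀ u ∈ Φ.source, IsGroupoidCoordinate W W' σ σ' g u (Φ u)) ∧
      IsAdaptedChart (𝓘(ℝ, H →L[ℂ] H).prod
        (𝓘(ℝ, SchattenClass p Hp Hpᗮ).prod 𝓘(ℝ, SchattenClass p Hp Hpᗮ))) toProd Φ := by
  -- Extending the inverse of the bijection beyond its target requires some default value.
  have : Nonempty (RestrictedPartialIsometry p Hp) := ⟨unit W⟩
  have hbij := bijOn_chartFun g hΩ hΩ' hσ hσ'
  have hinv := contMDiffOn_chartInv (W := W) (W' := W') g hσ hσ'
  have htarget : IsOpen (Set.BijOn.toPartialEquiv _ _ _ hbij).target := by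
    change IsOpen {z : SchattenClass p W.space W.spaceᗮ × SchattenClass p W'.space W'.spaceᗮ ×
      SkewAdjointOperators Hp | W.graphChart.symm z.1 ∈ Ω ∧ W'.graphChart.symm z.2.1 ∈ Ω'}
    have k1 : Continuous W.graphChart.symm := by
      have := W.graphChart.continuousOn_symm
      rwa [graphChart_target, continuousOn_univ] at this
    have k2 : Continuous W'.graphChart.symm := by
      have := W'.graphChart.continuousOn_symm
      rwa [graphChart_target, continuousOn_univ] at this
    exact (hσ.isOpen.preimage (k1.comp continuous_fst)).inter
      (hσ'.isOpen.preimage (k2.comp (continuous_fst.comp continuous_snd)))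
  have hsymm : ContMDiffOn 𝓘(ℝ, SchattenClass p W.space W.spaceᗮ ×
      SchattenClass p W'.space W'.spaceᗮ × SkewAdjointOperators Hp) (𝓘(ℝ, H →L[ℂ] H).prod
        (𝓘(ℝ, SchattenClass p Hp Hpᗮ).prod 𝓘(ℝ, SchattenClass p Hp Hpᗮ))) ∞
      (toProd ∘ (Set.BijOn.toPartialEquiv _ _ _ hbij).symm)
      (Set.BijOn.toPartialEquiv _ _ _ hbij).target := by
    refine hinv.congr fun z hz => ?_
    set e := Set.BijOn.toPartialEquiv _ _ _ hbij with he
    have h3 : e.symm z ∈ groupoidChartDomain Ω Ω' σ σ' g := e.map_target hz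
    have h4 : chartFun W W' σ σ' g (e.symm z).toProd = z := e.right_inv hz
    obtain ⟨-, h5, h6, h7⟩ := toCLM_eq_chartInv g hΩ hΩ' hσ hσ' h3
    rw [h4] at h5 h6 h7
    change ((e.symm z).toCLM, (e.symm z).target, (e.symm z).source) = _
    rw [h5, h6, h7]
  obtain ⟨Φ, h1, h2⟩ := exists_isAdaptedChart isInducing_toProd
    (Set.BijOn.toPartialEquiv _ _ _ hbij) htarget hsymm (isOpen_chartDomain g hσ hσ')
    (contMDiffOn_chartFun g hΩ hΩ' hσ hσ') (Set.ext fun u => and_assoc.symm) fun u hu => rfl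
  have h3 : Φ.source = groupoidChartDomain Ω Ω' σ σ' g := congrArg PartialEquiv.source h1
  have h4 : ∀ u, Φ u = chartFun W W' σ σ' g u.toProd := fun u =>
    congrArg (fun e : PartialEquiv _ _ => e u) h1
  refine ⟨Φ, h3, fun u hu => ?_, h2⟩
  rw [h3] at hu
  rw [h4]
  refine ⟨?_, ?_, (toCLM_eq_chartInv g hΩ hΩ' hσ hσ' hu).1⟩
  · change IsGrassmannianCoordinate W u.target (W.graphChart u.target)
    rw [graphChart_apply]
    exact W.isGrassmannianCoordinate (hΩ hu.1)
  · change IsGrassmannianCoordinate W' u.source (W'.graphChart u.source)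
    rw [graphChart_apply]
    exact W'.isGrassmannianCoordinate (hΩ' hu.2.1)

end GroupoidChart

end RestrictedPartialIsometry

/-! ### The groupoid of partial isometries -/

section Submersion

open Topology

/-- Differentiating `f ∘ τ = id` shows that the derivative of `τ` is a continuous right inverse of
the tangent map, which gives both surjectivity and a complement of the kernel. -/
lemma isBanachSubmersion_of_localSections {EG EM G M : Type*} [NormedAddCommGroup EG]
    [NormedSpace ℝ EG] [NormedAddCommGroup EM] [NormedSpace ℝ EM] [TopologicalSpace G]
    [ChartedSpace EG G] [TopologicalSpace M] [ChartedSpace EM M] {f : G → M}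
    (hf : ContMDiff 𝓘(ℝ, EG) 𝓘(ℝ, EM) ∞ f)
    (h : ∀ x, ∃ τ : M → G, τ (f x) = x ∧ ContMDiffAt 𝓘(ℝ, EM) 𝓘(ℝ, EG) ∞ τ (f x) ∧
      ∀ᶠ y in 𝓝 (f x), f (τ y) = y) : IsBanachSubmersion (EG := EG) (EM := EM) f := by
  have key : ∀ x, ∃ A : EM →L[ℝ] EG, Function.RightInverse A
      (mfderiv 𝓘(ℝ, EG) 𝓘(ℝ, EM) f x : EG →L[ℝ] EM) := by
    intro x
    obtain ⟨τ, h1, h2, h3⟩ := h x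
    refine ⟨mfderiv 𝓘(ℝ, EM) 𝓘(ℝ, EG) τ (f x), fun v => ?_⟩
    have h4 : mfderiv 𝓘(ℝ, EM) 𝓘(ℝ, EM) (f ∘ τ) (f x) =
        (mfderiv 𝓘(ℝ, EG) 𝓘(ℝ, EM) f (τ (f x))).comp (mfderiv 𝓘(ℝ, EM) 𝓘(ℝ, EG) τ (f x)) :=
      mfderiv_comp (f x) (hf.mdifferentiableAt (by simp)) (h2.mdifferentiableAt (by simp))
    have h5 : mfderiv 𝓘(ℝ, EM) 𝓘(ℝ, EM) (f ∘ τ) (f x) = mfderiv 𝓘(ℝ, EM) 𝓘(ℝ, EM) id (f x) :=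
      Filter.EventuallyEq.mfderiv_eq h3
    rw [h5, mfderiv_id, h1] at h4
    exact (congrArg (fun T : EM →L[ℝ] EM => T v) h4).symm
  refine ⟨hf, fun x => ?_, fun x => ?_⟩
  · obtain ⟨A, hA⟩ := key x
    exact hA.surjective
  · obtain ⟨A, hA⟩ := key x
    exact ContinuousLinearMap.closedComplemented_ker_of_rightInverse
      (mfderiv 𝓘(ℝ, EG) 𝓘(ℝ, EM) f x : EG →L[ℝ] EM) A hA

end Submersion

/-! ### Smoothness of the structure maps -/

namespace RestrictedPartialIsometry

open RestrictedGrassmannian Topology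

variable {p : ℝ} {H : Type*} [NormedAddCommGroup H]
  [InnerProductSpace ℂ H] [CompleteSpace H] {Hp : Submodule ℂ H} [CompleteSpace Hp]

lemma source_inv (u : RestrictedPartialIsometry p Hp) : u.inv.source = u.target :=
  RestrictedGrassmannian.ext (congrArg (· * star u.toCLM) (star_star u.toCLM))

lemma target_inv (u : RestrictedPartialIsometry p Hp) : u.inv.target = u.source :=
  RestrictedGrassmannian.ext (congrArg (star u.toCLM * ·) (star_star u.toCLM))

lemma inv_inv (u : RestrictedPartialIsometry p Hp) : u.inv.inv = u :=
  RestrictedPartialIsometry.ext (star_star u.toCLM)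

lemma source_unit (V : RestrictedGrassmannian p Hp) : (unit V).source = V :=
  RestrictedGrassmannian.ext (by
    change star V.proj * V.proj = V.proj
    rw [V.isStarProjection.isSelfAdjoint.star_eq, V.isStarProjection.isIdempotentElem.eq])

lemma target_unit (V : RestrictedGrassmannian p Hp) : (unit V).target = V :=
  RestrictedGrassmannian.ext (by
    change V.proj * star V.proj = V.proj
    rw [V.isStarProjection.isSelfAdjoint.star_eq, V.isStarProjection.isIdempotentElem.eq])

lemma source_mul (gh : {gh : RestrictedPartialIsometry p Hp × RestrictedPartialIsometry p Hp //
    source gh.1 = target gh.2}) : (mul gh).source = gh.1.2.source := by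
  have h : star gh.1.1.toCLM * gh.1.1.toCLM = gh.1.2.toCLM * star gh.1.2.toCLM :=
    congrArg RestrictedGrassmannian.proj gh.2
  refine RestrictedGrassmannian.ext ?_
  change star (gh.1.1.toCLM * gh.1.2.toCLM) * (gh.1.1.toCLM * gh.1.2.toCLM) = _
  calc _ = star gh.1.2.toCLM * (star gh.1.1.toCLM * gh.1.1.toCLM) * gh.1.2.toCLM := by
        simp only [star_mul, mul_assoc]
    _ = star gh.1.2.toCLM * (gh.1.2.toCLM * star gh.1.2.toCLM * gh.1.2.toCLM) := by
        rw [h]; simp only [mul_assoc]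
    _ = _ := by rw [gh.1.2.isPartialIsometry.mul_star_mul]; rfl

lemma target_mul (gh : {gh : RestrictedPartialIsometry p Hp × RestrictedPartialIsometry p Hp //
    source gh.1 = target gh.2}) : (mul gh).target = gh.1.1.target := by
  have h : star gh.1.1.toCLM * gh.1.1.toCLM = gh.1.2.toCLM * star gh.1.2.toCLM :=
    congrArg RestrictedGrassmannian.proj gh.2
  refine RestrictedGrassmannian.ext ?_
  change (gh.1.1.toCLM * gh.1.2.toCLM) * star (gh.1.1.toCLM * gh.1.2.toCLM) = _
  calc _ = gh.1.1.toCLM * (gh.1.2.toCLM * star gh.1.2.toCLM) * star gh.1.1.toCLM := by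
        simp only [star_mul, mul_assoc]
    _ = (gh.1.1.toCLM * star gh.1.1.toCLM * gh.1.1.toCLM) * star gh.1.1.toCLM := by
        rw [← h]; simp only [mul_assoc]
    _ = _ := by rw [gh.1.1.isPartialIsometry.mul_star_mul]; rfl

variable [Fact (p = 0 ∨ 1 < p)] [Fact (¬ FiniteDimensional ℂ Hp)]
  [Fact (¬ FiniteDimensional ℂ Hpᗮ)]

lemma exists_chart_mem_source (u : RestrictedPartialIsometry p Hp) :
    ∃ φ : OpenPartialHomeomorph (RestrictedPartialIsometry p Hp)
        (SchattenClass p Hp Hpᗮ × SchattenClass p Hp Hpᗮ × SkewAdjointOperators Hp),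
      u ∈ φ.source ∧ IsAdaptedChart (𝓘(ℝ, H →L[ℂ] H).prod
        (𝓘(ℝ, SchattenClass p Hp Hpᗮ).prod 𝓘(ℝ, SchattenClass p Hp Hpᗮ))) toProd φ := by
  obtain ⟨Ω, σ, h1, h2, h3⟩ := u.target.exists_isSmoothCrossSection
  obtain ⟨Ω', σ', h1', h2', h3'⟩ := u.source.exists_isSmoothCrossSection
  -- Centring the Cayley chart at the transport of `u` itself makes `g⁻¹ v + 1` equal to `2` at `u`.
  have hg := (transportToHp_mem_unitary h3 h3' h1 h1').1
  obtain ⟨Φ, hΦ, -, hadapted⟩ := exists_groupoidChart ⟨_, hg⟩ h2 h2' h3 h3'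
  refine ⟨Φ.transHomeomorph (u.target.schattenClassEquiv.prodCongr
    (u.source.schattenClassEquiv.prodCongr (ContinuousLinearEquiv.refl ℝ _))).toHomeomorph,
    ?_, hadapted.transHomeomorph _⟩
  change u ∈ Φ.source
  rw [hΦ]
  refine ⟨h1, h1', ?_⟩
  change IsUnit (star (transportToHp σ σ' u) * transportToHp σ σ' u + 1)
  rw [Unitary.star_mul_self_of_mem hg, one_add_one_eq_two]
  have : IsUnit (algebraMap ℂ (Hp →L[ℂ] Hp) 2) := (two_ne_zero (α := ℂ)).isUnit.map _
  rwa [map_ofNat] at this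

instance : ChartedSpace (SchattenClass p Hp Hpᗮ × SchattenClass p Hp Hpᗮ × SkewAdjointOperators Hp)
    (RestrictedPartialIsometry p Hp) where
  atlas := Set.range fun u : RestrictedPartialIsometry p Hp => u.exists_chart_mem_source.choose
  chartAt u := u.exists_chart_mem_source.choose
  mem_chart_source u := u.exists_chart_mem_source.choose_spec.1
  chart_mem_atlas u := ⟨u, rfl⟩

lemma isAdaptedChart_of_mem_atlas :
    ∀ φ ∈ atlas (SchattenClass p Hp Hpᗮ × SchattenClass p Hp Hpᗮ × SkewAdjointOperators Hp)
      (RestrictedPartialIsometry p Hp), IsAdaptedChart (𝓘(ℝ, H →L[ℂ] H).prod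
        (𝓘(ℝ, SchattenClass p Hp Hpᗮ).prod 𝓘(ℝ, SchattenClass p Hp Hpᗮ))) toProd φ := by
  rintro _ ⟨u, rfl⟩
  exact u.exists_chart_mem_source.choose_spec.2

instance : IsManifold
    𝓘(ℝ, SchattenClass p Hp Hpᗮ × SchattenClass p Hp Hpᗮ × SkewAdjointOperators Hp) ∞
    (RestrictedPartialIsometry p Hp) :=
  isManifold_of_isAdaptedChart isAdaptedChart_of_mem_atlas

lemma contMDiff_toProd : ContMDiff
    𝓘(ℝ, SchattenClass p Hp Hpᗮ × SchattenClass p Hp Hpᗮ × SkewAdjointOperators Hp)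
    (𝓘(ℝ, H →L[ℂ] H).prod (𝓘(ℝ, SchattenClass p Hp Hpᗮ).prod 𝓘(ℝ, SchattenClass p Hp Hpᗮ))) ∞
    (toProd : RestrictedPartialIsometry p Hp → _) :=
  contMDiff_of_isAdaptedChart isAdaptedChart_of_mem_atlas

/-- The working criterion for maps into the groupoid: operator, target and source are checked
separately. -/
lemma contMDiffWithinAt_of_toProd {E' H' N' : Type*} [NormedAddCommGroup E']
    [NormedSpace ℝ E'] [TopologicalSpace H'] {I' : ModelWithCorners ℝ E' H'} [TopologicalSpace N']
    [ChartedSpace H' N'] {g : N' → RestrictedPartialIsometry p Hp} {s : Set N'} {x : N'}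
    (h1 : ContMDiffWithinAt I' 𝓘(ℝ, H →L[ℂ] H) ∞ (fun y => (g y).toCLM) s x)
    (h2 : ContMDiffWithinAt I' 𝓘(ℝ, SchattenClass p Hp Hpᗮ) ∞ (fun y => (g y).target) s x)
    (h3 : ContMDiffWithinAt I' 𝓘(ℝ, SchattenClass p Hp Hpᗮ) ∞ (fun y => (g y).source) s x) :
    ContMDiffWithinAt I'
      𝓘(ℝ, SchattenClass p Hp Hpᗮ × SchattenClass p Hp Hpᗮ × SkewAdjointOperators Hp) ∞ g s x :=
  contMDiffWithinAt_of_isAdaptedChart isInducing_toProd isAdaptedChart_of_mem_atlas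
    (h1.prodMk (h2.prodMk h3))

lemma contMDiff_toCLM : ContMDiff
    𝓘(ℝ, SchattenClass p Hp Hpᗮ × SchattenClass p Hp Hpᗮ × SkewAdjointOperators Hp)
    𝓘(ℝ, H →L[ℂ] H) ∞ (toCLM : RestrictedPartialIsometry p Hp → _) :=
  contMDiff_fst.comp contMDiff_toProd

lemma contMDiff_target : ContMDiff
    𝓘(ℝ, SchattenClass p Hp Hpᗮ × SchattenClass p Hp Hpᗮ × SkewAdjointOperators Hp)
    𝓘(ℝ, SchattenClass p Hp Hpᗮ) ∞ (target : RestrictedPartialIsometry p Hp → _) :=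
  (contMDiff_fst.comp contMDiff_snd).comp contMDiff_toProd

lemma contMDiff_source : ContMDiff
    𝓘(ℝ, SchattenClass p Hp Hpᗮ × SchattenClass p Hp Hpᗮ × SkewAdjointOperators Hp)
    𝓘(ℝ, SchattenClass p Hp Hpᗮ) ∞ (source : RestrictedPartialIsometry p Hp → _) :=
  (contMDiff_snd.comp contMDiff_snd).comp contMDiff_toProd

lemma contMDiff_inv : ContMDiff
    𝓘(ℝ, SchattenClass p Hp Hpᗮ × SchattenClass p Hp Hpᗮ × SkewAdjointOperators Hp)
    𝓘(ℝ, SchattenClass p Hp Hpᗮ × SchattenClass p Hp Hpᗮ × SkewAdjointOperators Hp) ∞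
    (inv : RestrictedPartialIsometry p Hp → _) := by
  rw [← contMDiffOn_univ]
  intro u hu
  refine contMDiffWithinAt_of_toProd ?_ ?_ ?_
  · exact contMDiff_toCLM.contMDiffOn.operatorStar u hu
  · simp only [target_inv]
    exact contMDiff_source.contMDiffOn u hu
  · simp only [source_inv]
    exact contMDiff_target.contMDiffOn u hu

lemma continuous_unit : Continuous (unit : RestrictedGrassmannian p Hp → _) := by
  refine isInducing_toProd.continuous_iff.2 ?_
  have h : toProd ∘ unit = fun V : RestrictedGrassmannian p Hp => (V.proj, V, V) := by
    funext V
    change ((unit V).toCLM, (unit V).target, (unit V).source) = _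
    rw [source_unit, target_unit]
    rfl
  rw [h]
  exact contMDiff_proj.continuous.prodMk (continuous_id.prodMk continuous_id)

/-- The section is `V ↦ u σ(s u) σ(V)*`: rotate the source by the cross section while the target
stays fixed. -/
lemma exists_source_localSection (u : RestrictedPartialIsometry p Hp) :
    ∃ τ : RestrictedGrassmannian p Hp → RestrictedPartialIsometry p Hp, τ u.source = u ∧
      ContMDiffAt 𝓘(ℝ, SchattenClass p Hp Hpᗮ)
        𝓘(ℝ, SchattenClass p Hp Hpᗮ × SchattenClass p Hp Hpᗮ × SkewAdjointOperators Hp) ∞ τ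
        u.source ∧
      ∀ᶠ V in 𝓝 u.source, (τ V).source = V := by
  obtain ⟨Ω, σ, h1, -, h3⟩ := u.source.exists_isSmoothCrossSection
  have hu : star u.toCLM * u.toCLM = u.source.proj := rfl
  have hex : ∀ V, ∃ w : RestrictedPartialIsometry p Hp, V ∈ Ω →
      w.toCLM = u.toCLM * σ u.source * star (σ V) ∧ w.target = u.target ∧ w.source = V := by
    intro V
    by_cases hV : V ∈ Ω
    · have k1 : star (u.toCLM * σ u.source * star (σ V)) * (u.toCLM * σ u.source * star (σ V)) =
          V.proj := by
        calc _ = σ V * (star (σ u.source) * (star u.toCLM * u.toCLM) * σ u.source) *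
              star (σ V) := by simp only [star_mul, star_star, mul_assoc]
          _ = σ V * ((star (σ u.source) * σ u.source) * Hp.starProjection *
              (star (σ u.source) * σ u.source)) * star (σ V) := by
            rw [hu, ← h3.mul_starProjection_mul_star h1]; simp only [mul_assoc]
          _ = V.proj := by
            rw [Unitary.star_mul_self_of_mem (h3.mem_unitary _ h1), one_mul, mul_one,
              h3.mul_starProjection_mul_star hV]
      have k2 : (u.toCLM * σ u.source * star (σ V)) * star (u.toCLM * σ u.source * star (σ V)) =
          u.toCLM * star u.toCLM := by
        calc _ = u.toCLM * (σ u.source * (star (σ V) * σ V) * star (σ u.source)) *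
              star u.toCLM := by simp only [star_mul, star_star, mul_assoc]
          _ = _ := by
            rw [Unitary.star_mul_self_of_mem (h3.mem_unitary _ hV), mul_one,
              Unitary.mul_star_self_of_mem (h3.mem_unitary _ h1), mul_one]
      refine ⟨⟨u.toCLM * σ u.source * star (σ V),
        by rw [IsPartialIsometry, k1]; exact V.isStarProjection, k1 ▸ V.isRestricted,
        k2 ▸ u.target_mem⟩, fun _ => ⟨rfl, RestrictedGrassmannian.ext k2,
        RestrictedGrassmannian.ext k1⟩⟩
    · exact ⟨u, fun h => absurd h hV⟩
  choose τ hτ using hex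
  have hΩ : Ω ∈ 𝓝 u.source := h3.isOpen.mem_nhds h1
  refine ⟨τ, RestrictedPartialIsometry.ext ?_, ?_, ?_⟩
  · rw [(hτ _ h1).1, mul_assoc, Unitary.mul_star_self_of_mem (h3.mem_unitary _ h1), mul_one]
  · refine ContMDiffWithinAt.contMDiffAt (s := Ω) (contMDiffWithinAt_of_toProd ?_ ?_ ?_) hΩ
    · exact (contMDiffOn_const.operatorMul h3.smooth.operatorStar _ h1).congr
        (fun V hV => (hτ V hV).1) (hτ _ h1).1
    · exact contMDiffWithinAt_const.congr (fun V hV => (hτ V hV).2.1) (hτ _ h1).2.1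
    · exact contMDiffWithinAt_id.congr (fun V hV => (hτ V hV).2.2) (hτ _ h1).2.2
  · filter_upwards [hΩ] with V hV
    exact (hτ V hV).2.2

lemma isBanachSubmersion_source : IsBanachSubmersion
    (EG := SchattenClass p Hp Hpᗮ × SchattenClass p Hp Hpᗮ × SkewAdjointOperators Hp)
    (EM := SchattenClass p Hp Hpᗮ)
    (source : RestrictedPartialIsometry p Hp → RestrictedGrassmannian p Hp) :=
  isBanachSubmersion_of_localSections contMDiff_source exists_source_localSection

/-- Inversion exchanges source and target, so it turns local sections of the source map into local
sections of the target map. -/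
lemma isBanachSubmersion_target : IsBanachSubmersion
    (EG := SchattenClass p Hp Hpᗮ × SchattenClass p Hp Hpᗮ × SkewAdjointOperators Hp)
    (EM := SchattenClass p Hp Hpᗮ)
    (target : RestrictedPartialIsometry p Hp → RestrictedGrassmannian p Hp) := by
  refine isBanachSubmersion_of_localSections contMDiff_target fun u => ?_
  obtain ⟨τ, h1, h2, h3⟩ := u.inv.exists_source_localSection
  rw [source_inv] at h1 h2 h3
  refine ⟨inv ∘ τ, ?_, contMDiff_inv.contMDiffAt.comp _ h2, ?_⟩
  · change (τ u.target).inv = u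
    rw [h1, inv_inv]
  · filter_upwards [h3] with V hV
    change (τ V).inv.target = V
    rw [target_inv, hV]

-- On composable pairs the operator of the product is bilinear in the two operators, its target is
-- that of the first factor and its source that of the second.
open Classical in
lemma contMDiffOn_mul : ContMDiffOn
    (𝓘(ℝ, SchattenClass p Hp Hpᗮ × SchattenClass p Hp Hpᗮ × SkewAdjointOperators Hp).prod
      𝓘(ℝ, SchattenClass p Hp Hpᗮ × SchattenClass p Hp Hpᗮ × SkewAdjointOperators Hp))
    𝓘(ℝ, SchattenClass p Hp Hpᗮ × SchattenClass p Hp Hpᗮ × SkewAdjointOperators Hp) ∞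
    (fun gh : RestrictedPartialIsometry p Hp × RestrictedPartialIsometry p Hp =>
      if h : source gh.1 = target gh.2 then mul ⟨gh, h⟩ else gh.1)
    {gh | source gh.1 = target gh.2} := by
  intro gh hgh
  refine contMDiffWithinAt_of_toProd ?_ ?_ ?_
  · refine ContMDiffWithinAt.congr (f := fun gh : RestrictedPartialIsometry p Hp ×
      RestrictedPartialIsometry p Hp => gh.1.toCLM * gh.2.toCLM) ?_ ?_ ?_
    · exact (contMDiff_toCLM.comp contMDiff_fst).contMDiffOn.operatorMul
        (contMDiff_toCLM.comp contMDiff_snd).contMDiffOn _ hgh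
    · intro y hy
      rw [dif_pos (show y.1.source = y.2.target from hy)]; rfl
    · rw [dif_pos (show gh.1.source = gh.2.target from hgh)]; rfl
  · refine ContMDiffWithinAt.congr ((contMDiff_target.comp contMDiff_fst) gh).contMDiffWithinAt
      ?_ ?_
    · intro y hy
      rw [dif_pos (show y.1.source = y.2.target from hy), target_mul]; rfl
    · rw [dif_pos (show gh.1.source = gh.2.target from hgh), target_mul]; rfl
  · refine ContMDiffWithinAt.congr ((contMDiff_source.comp contMDiff_snd) gh).contMDiffWithinAt
      ?_ ?_
    · intro y hy
      rw [dif_pos (show y.1.source = y.2.target from hy), source_mul]; rfl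
    · rw [dif_pos (show gh.1.source = gh.2.target from hgh), source_mul]; rfl

theorem isBanachLieGroupoid : IsBanachLieGroupoid
    (EG := SchattenClass p Hp Hpᗮ × SchattenClass p Hp Hpᗮ × SkewAdjointOperators Hp)
    (EM := SchattenClass p Hp Hpᗮ)
    (RestrictedPartialIsometry p Hp) (RestrictedGrassmannian p Hp) source target mul unit inv where
  complete_total := inferInstance
  complete_base := inferInstance
  hausdorff_total := inferInstance
  hausdorff_base := inferInstance
  manifold_total := inferInstance
  manifold_base := inferInstance
  source_surjective V := ⟨unit V, source_unit V⟩
  source_submersion := isBanachSubmersion_source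
  target_surjective V := ⟨unit V, target_unit V⟩
  target_submersion := isBanachSubmersion_target
  smooth_mul := contMDiffOn_mul
  source_mul := source_mul
  target_mul := target_mul
  assoc_defined g h k := by
    constructor
    · rintro ⟨h₁, h₂⟩
      rw [source_mul] at h₂
      exact ⟨h₂, by rw [target_mul]; exact h₁⟩
    · rintro ⟨h₂, h₁⟩
      rw [target_mul] at h₁
      exact ⟨h₁, by rw [source_mul]; exact h₂⟩
  mul_assoc g h k _ _ _ _ := RestrictedPartialIsometry.ext (mul_assoc g.toCLM h.toCLM k.toCLM)
  -- The source map is a continuous left inverse of the identity section.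
  embedding_unit := Function.LeftInverse.isEmbedding source_unit contMDiff_source.continuous
    continuous_unit
  source_unit := source_unit
  target_unit := target_unit
  mul_unit g _ := RestrictedPartialIsometry.ext
    ((mul_assoc _ _ _).symm.trans g.isPartialIsometry.mul_star_mul)
  unit_mul g _ := RestrictedPartialIsometry.ext g.isPartialIsometry.mul_star_mul
  diffeomorph_inv := ⟨⟨⟨inv, inv, inv_inv, inv_inv⟩, contMDiff_inv, contMDiff_inv⟩, rfl⟩
  mul_inv g := ⟨(target_inv g).symm, rfl⟩
  inv_mul g := ⟨source_inv g, rfl⟩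

end RestrictedPartialIsometry

end

/-! ### The Banach Lie groupoid of restricted partial isometries -/

theorem mainTheorem4 {H : Type*} [NormedAddCommGroup H] [InnerProductSpace ℂ H] [CompleteSpace H]
    (Hp : Submodule ℂ H) [CompleteSpace Hp]
    (hplus : ¬ FiniteDimensional ℂ Hp) (hminus : ¬ FiniteDimensional ℂ Hpᗮ)
    (p : ℝ) [Fact (p = 0 ∨ 1 < p)] :
    ∃ (_ : TopologicalSpace (RestrictedGrassmannian p Hp))
      (_ : ChartedSpace (SchattenClass p Hp Hpᗮ) (RestrictedGrassmannian p Hp))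
      (_ : TopologicalSpace (RestrictedPartialIsometry p Hp))
      (_ : ChartedSpace
        (SchattenClass p Hp Hpᗮ × SchattenClass p Hp Hpᗮ × SkewAdjointOperators Hp)
        (RestrictedPartialIsometry p Hp)),
      -- the graph charts are smooth charts of the restricted Grassmannian
      (∀ W : RestrictedGrassmannian p Hp, CompleteSpace (SchattenClass p W.space W.spaceᗮ) ∧
        ∃ φ : OpenPartialHomeomorph (RestrictedGrassmannian p Hp)
            (SchattenClass p W.space W.spaceᗮ),
          φ.source = grassmannianChartDomain W ∧ φ.target = Set.univ ∧
          (∀ V ∈ φ.source, IsGrassmannianCoordinate W V (φ V)) ∧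
          IsSmoothChart (E := SchattenClass p Hp Hpᗮ) φ) ∧
      -- the domains of the smooth local cross sections cover the restricted Grassmannian
      (∀ W : RestrictedGrassmannian p Hp, ∃ Ω σ, W ∈ Ω ∧
        IsSmoothCrossSection (E := SchattenClass p Hp Hpᗮ) Ω σ) ∧
      -- the charts built from local cross sections are smooth charts of the total space
      (∀ (W W' : RestrictedGrassmannian p Hp) (Ω Ω' : Set (RestrictedGrassmannian p Hp))
        (σ σ' : RestrictedGrassmannian p Hp → (H →L[ℂ] H)) (g : unitary (Hp →L[ℂ] Hp)),
        Ω ⊆ grassmannianChartDomain W → Ω' ⊆ grassmannianChartDomain W' →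
        IsSmoothCrossSection (E := SchattenClass p Hp Hpᗮ) Ω σ →
        IsSmoothCrossSection (E := SchattenClass p Hp Hpᗮ) Ω' σ' →
        ∃ Φ : OpenPartialHomeomorph (RestrictedPartialIsometry p Hp)
            (SchattenClass p W.space W.spaceᗮ × SchattenClass p W'.space W'.spaceᗮ ×
              SkewAdjointOperators Hp),
          Φ.source = groupoidChartDomain Ω Ω' σ σ' g ∧
          (∀ u ∈ Φ.source, IsGroupoidCoordinate W W' σ σ' g u (Φ u)) ∧
          IsSmoothChart
            (E := SchattenClass p Hp Hpᗮ × SchattenClass p Hp Hpᗮ × SkewAdjointOperators Hp) Φ) ∧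
      -- the groupoid
      IsBanachLieGroupoid
        (EG := SchattenClass p Hp Hpᗮ × SchattenClass p Hp Hpᗮ × SkewAdjointOperators Hp)
        (EM := SchattenClass p Hp Hpᗮ)
        (RestrictedPartialIsometry p Hp) (RestrictedGrassmannian p Hp)
        RestrictedPartialIsometry.source RestrictedPartialIsometry.target
        RestrictedPartialIsometry.mul RestrictedPartialIsometry.unit
        RestrictedPartialIsometry.inv := by
  have := Fact.mk hplus
  have := Fact.mk hminus
  refine ⟨inferInstance, inferInstance, inferInstance, inferInstance, fun W => ⟨inferInstance,
    W.graphChart, W.graphChart_source, W.graphChart_target, fun V hV => ?_,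
    W.isSmoothChart_graphChart⟩, fun W => ?_, fun W W' Ω Ω' σ σ' g hΩ hΩ' hσ hσ' => ?_,
    RestrictedPartialIsometry.isBanachLieGroupoid⟩
  · rw [W.graphChart_source] at hV
    rw [W.graphChart_apply]
    exact W.isGrassmannianCoordinate hV
  · obtain ⟨Ω, σ, h1, -, h2⟩ := W.exists_isSmoothCrossSection
    exact ⟨Ω, σ, h1, h2⟩
  · obtain ⟨Φ, h1, h2, h3⟩ :=
      RestrictedPartialIsometry.exists_groupoidChart g hΩ hΩ' hσ hσ'
    exact ⟨Φ, h1, h2, h3.isSmoothChart RestrictedPartialIsometry.isInducing_toProd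
      RestrictedPartialIsometry.isAdaptedChart_of_mem_atlas⟩
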